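/- Let $G$ be a 3-leg star graph, i.e. a tree with vertices $1,\dots,N$ having one vertex of degree $3$ and all other vertices of degree at most $2$. Let $M=(m_{jk})$ be a positive definite symmetric integral $N\times N$ matrix with $m_{jk}=-1$ if $j\ne k$ are adjacent and $m_{jk}=0$ if $j\neq k$ are not adjacent (the diagonal entries are arbitrary integers). Write $q=e^{2\pi i\tau}$, $q^r=e^{2\pi i r\tau}$ for $\tau$ in the upper half-plane $\mathbb H$, and define $$Z(q):=\frac{q^{\frac{-3N+\operatorname{tr}M}{2}}}{(2\pi i)^N}\,\mathrm{PV}\!\int_{|w_j|=1}\prod_{j=1}^N (w_j-w_j^{-1})^2\prod_{(k,\ell)\in E}\frac{1}{(w_k-w_k^{-1})(w_\ell-w_\ell^{-1})}\sum_{m\in M\mathbb Z^N}q^{\frac12 m^TM^{-1}m}\prod_{j=1}^N w_j^{m_j}\ \prod_{j=1}^N\frac{dw_j}{w_j},$$ where PV is the Cauchy principal value (singularities at $w_j=\pm1$). For $a\in\mathbb Z^N$ let $\widehat Z_a(q)$ be defined by the same formula with prefactor $q^{\frac{-3N+\operatorname{tr}M}{4}}$ and with the theta series replaced by $\sum_{\ell\in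 2M\mathbb Z^N+a}q^{\frac14\ell^TM^{-1}\ell}\prod_j w_j^{\ell_j}$. For $j\in\mathbb Z$, $p\in\mathbb N$ let $F_{j,p}(\tau)=\sum_{m\in\mathbb Z}\operatorname{sgn}^*(m)\,q^{(m+\frac{j}{2p})^2}$, with $\operatorname{sgn}^*(m)=1$ for $m\ge0$ and $-1$ for $m<0$. A function $F$ on $\mathbb H$ is called a quantum modular form of weight $k$ with quantum set $S\subseteq\mathbb Q$ if the limits $f(x)=\lim_{t\to0^+}F(x+it)$ exist for all $x\in S$ and there are a congruence subgroup $\Gamma\subseteq\mathrm{SL}_2(\mathbb Z)$ and a unitary multiplier system $\chi$ of weight $k$ on $\Gamma$ such that for every $\gamma=\left(\begin{smallmatrix}a&b\\c&d\end{smallmatrix}\right)\in\Gamma$ the obstruction $f(x)-\chi(\gamma)^{-1}(cx+d)^{-k}f(\gamma x)$, for $x\in S$ with $cx+d\ne0$ and $\gamma x\in S$, is the restriction of a real-analytic function on $\mathbb R\setminus\{-d/c\}$ (on all of $\mathbb R$ if $c=0$). Here $(cx+d)^{-k}$ is the boundary value of the principal branch from the lower half-plane, and $\chi$ is a multiplier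 system for this automorphy factor. Then: 1. The principal values defining $Z(q)$ exist for all $\tau\in\mathbb H$, and $Z(q)$ is a finite linear combination, with complex coefficients, of terms $q^{\rho}F(\tau)$, where $\rho\in\mathbb Q$ and each $F(\tau)=F_{j,p}(s\tau)$, with $j\in\mathbb Z$, $p\in\mathbb N$, $s\in\mathbb Q_{>0}$, is a quantum modular form of weight $\frac12$ with quantum set $\mathbb Q$. 2. There is $c_M\in\mathbb Q$ such that $q^{c_M}Z(q)$ is itself a quantum modular form of weight $\frac12$ with quantum set $\mathbb Q$. 3. If $M$ is unimodular, then for every $a\in\mathbb Z^N$ with $a_v\equiv\deg(v)\pmod 2$ for all $v$ the principal values defining $\widehat Z_a(q)$ exist for all $\tau\in\mathbb H$, and there is $c\in\mathbb Q$ such that $q^{c}\widehat Z_a(q)$ is a quantum modular form of weight $\frac12$ with quantum set $\mathbb Q$ (Gukov's conjecture for unimodular 3-leg star graphs). -/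

import Mathlib

open scoped MatrixGroups

noncomputable section

namespace Plumbing

/-- The rational power `q ^ r` of `q = exp (2 π i τ)`, that is `exp (2 π i r τ)`. -/
def qpow (r : ℚ) (τ : ℂ) : ℂ := Complex.exp (2 * Real.pi * Complex.I * (r : ℂ) * τ)

/-! ### Plumbing graphs and their matrices -/

/-- A tree with exactly one vertex of degree three (the centre), all other vertices having degree
at most two: three legs (paths with at least one vertex each) joined to a central vertex. -/
def IsThreeLegStar {N : ℕ} (G : SimpleGraph (Fin N)) [DecidableRel G.Adj] : Prop :=
  G.IsTree ∧ ∃ c : Fin N, G.degree c = 3 ∧ ∀ v, v ≠ c → G.degree v ≤ 2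

/-- `M` is an integral linking matrix of `G`: its off-diagonal entries are `-1` at the edges and
`0` elsewhere, its diagonal entries (the framing coefficients) are arbitrary integers. -/
def IsPlumbingMatrix {N : ℕ} (G : SimpleGraph (Fin N)) [DecidableRel G.Adj]
    (M : Matrix (Fin N) (Fin N) ℤ) : Prop :=
  ∀ j k, j ≠ k → M j k = if G.Adj j k then -1 else 0

/-! ### The integrals -/

/-- The function `1 / ((w_j - w_j⁻¹) (w_k - w_k⁻¹))` attached to the edge between `j` and `k`. -/
def edgeFactor {N : ℕ} (w : Fin N → ℂ) (e : Sym2 (Fin N)) : ℂ :=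
  Sym2.lift ⟨fun j k => 1 / ((w j - (w j)⁻¹) * (w k - (w k)⁻¹)),
    fun j k => by simp only [mul_comm]⟩ e

/-- The product of the vertex functions `(w_j - w_j⁻¹) ^ 2` and of the edge functions. -/
def graphFactor {N : ℕ} (G : SimpleGraph (Fin N)) [DecidableRel G.Adj] (w : Fin N → ℂ) : ℂ :=
  (∏ j, (w j - (w j)⁻¹) ^ 2) * ∏ e ∈ G.edgeFinset, edgeFactor w e

/-- The theta series `∑ q ^ (s * mᵀ M⁻¹ m) * ∏ w_j ^ (m_j)`, the sum being over `m ∈ L`. -/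
def latticeTheta {N : ℕ} (M : Matrix (Fin N) (Fin N) ℤ) (L : Set (Fin N → ℤ)) (s : ℚ)
    (τ : ℂ) (w : Fin N → ℂ) : ℂ :=
  ∑' m : L,
    qpow (s * ((fun j => (m.1 j : ℚ)) ⬝ᵥ
        Matrix.mulVec ((M.map (fun x : ℤ => (x : ℚ)))⁻¹) (fun j => (m.1 j : ℚ)))) τ
      * ∏ j, w j ^ (m.1 j)

/-- `I` is the Cauchy principal value of the contour integral of `f` over the torus
`|w_1| = ⋯ = |w_N| = 1`, for singularities along `w_j = 1` and `w_j = -1`: the symmetric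
neighbourhoods of radius `ε` of these points are removed, and `ε` tends to zero. -/
def HasTorusPV {N : ℕ} (f : (Fin N → ℂ) → ℂ) (I : ℂ) : Prop :=
  (∀ ε : ℝ, 0 < ε → TorusIntegrable
    ({w : Fin N → ℂ | ∀ j, ε ≤ ‖w j - 1‖ ∧ ε ≤ ‖w j + 1‖}.indicator f) 0 1) ∧
  Filter.Tendsto (fun ε : ℝ => torusIntegral
    ({w : Fin N → ℂ | ∀ j, ε ≤ ‖w j - 1‖ ∧ ε ≤ ‖w j + 1‖}.indicator f) 0 1)
    (nhdsWithin 0 (Set.Ioi 0)) (nhds I)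

/-- `z` is the value at `τ` of `q ^ r / (2 π i) ^ N` times the principal value of the integral
of `graphFactor * latticeTheta` against `∏ dw_j / w_j`. -/
def HasPlumbingIntegral {N : ℕ} (G : SimpleGraph (Fin N)) [DecidableRel G.Adj]
    (M : Matrix (Fin N) (Fin N) ℤ) (r : ℚ) (L : Set (Fin N → ℤ)) (s : ℚ) (τ z : ℂ) : Prop :=
  ∃ I : ℂ, HasTorusPV
      (fun w => graphFactor G w * latticeTheta M L s τ w * ∏ j, (w j)⁻¹) I ∧
    z = qpow r τ / (2 * Real.pi * Complex.I) ^ N * I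

/-- `z` is the value of `Z(q)` at `q = exp (2 π i τ)`; the theta series runs over `M ℤ^N`. -/
def HasZ {N : ℕ} (G : SimpleGraph (Fin N)) [DecidableRel G.Adj]
    (M : Matrix (Fin N) (Fin N) ℤ) (τ z : ℂ) : Prop :=
  HasPlumbingIntegral G M ((-3 * (N : ℚ) + (M.trace : ℚ)) / 2)
    {m | ∃ n : Fin N → ℤ, m = M.mulVec n} (1 / 2) τ z

/-- `z` is the value of the invariant `Ẑ_a(q)` at `q = exp (2 π i τ)`; the theta series runs
over `2 M ℤ^N + a`. -/
def HasZHat {N : ℕ} (G : SimpleGraph (Fin N)) [DecidableRel G.Adj]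
    (M : Matrix (Fin N) (Fin N) ℤ) (a : Fin N → ℤ) (τ z : ℂ) : Prop :=
  HasPlumbingIntegral G M ((-3 * (N : ℚ) + (M.trace : ℚ)) / 4)
    {m | ∃ n : Fin N → ℤ, m = (2 : ℤ) • M.mulVec n + a} (1 / 4) τ z

/-! ### False theta functions and quantum modular forms -/

/-- The false theta function `F_{j,p}(τ) = ∑_{m ∈ ℤ} sgn*(m) q ^ ((m + j / (2 p)) ^ 2)`, where
`sgn*(m)` is `1` for `m ≥ 0` and `-1` for `m < 0`. -/
def falseTheta (j : ℤ) (p : ℕ) (τ : ℂ) : ℂ :=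
  ∑' m : ℤ, (if 0 ≤ m then (1 : ℂ) else -1) * qpow (((m : ℚ) + (j : ℚ) / (2 * (p : ℚ))) ^ 2) τ

/-- The automorphy factor `(c x + d) ^ k` at a real point `x ≠ -d / c`, where `c` and `d` form the
bottom row of `γ`: the boundary value of the principal branch of `(c τ + d) ^ k` as `τ` tends to
`x` from the lower half-plane. For `c > 0` and `c x + d < 0` this takes `arg (c x + d) = -π`,
for `c ≤ 0` and `c x + d < 0` it takes `arg (c x + d) = π`. -/
def autFactor (k : ℝ) (γ : SL(2, ℤ)) (x : ℝ) : ℂ :=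
  if 0 < γ.1 1 0 then
    (starRingEnd ℂ) ((((γ.1 1 0 : ℝ) * x + (γ.1 1 1 : ℝ) : ℝ) : ℂ) ^ (k : ℂ))
  else (((γ.1 1 0 : ℝ) * x + (γ.1 1 1 : ℝ) : ℝ) : ℂ) ^ (k : ℂ)

/-- The action of `SL(2, ℤ)` by fractional linear transformations on elements of a field. -/
def moebius {K : Type*} [Field K] (γ : SL(2, ℤ)) (x : K) : K :=
  ((γ.1 0 0 : K) * x + (γ.1 0 1 : K)) / ((γ.1 1 0 : K) * x + (γ.1 1 1 : K))

/-- `χ` is a (unitary) multiplier system of weight `k` on `Γ`: the functions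
`χ(γ) (c τ + d) ^ k`, `γ ∈ Γ`, form a cocycle. -/
def IsMultiplierSystem (Γ : Subgroup SL(2, ℤ)) (k : ℝ) (χ : SL(2, ℤ) → ℂ) : Prop :=
  (∀ γ ∈ Γ, ‖χ γ‖ = 1) ∧
  ∀ γ ∈ Γ, ∀ δ ∈ Γ, ∀ x : ℝ,
    (δ.1 1 0 : ℝ) * x + (δ.1 1 1 : ℝ) ≠ 0 →
    ((γ * δ).1 1 0 : ℝ) * x + ((γ * δ).1 1 1 : ℝ) ≠ 0 →
    χ (γ * δ) * autFactor k (γ * δ) x =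
      (χ γ * autFactor k γ (moebius δ x)) * (χ δ * autFactor k δ x)

/-- `f : S → ℂ` (`S ⊆ ℚ`) is a quantum modular form of weight `k` on `Γ`: for some multiplier
system `χ`, every obstruction to modularity
`f(x) - χ(γ)⁻¹ (c x + d) ^ (-k) f(γ x)`, `γ ∈ Γ`, is the restriction of a
real-analytic function on `ℝ \ {-d / c}`. -/
def IsQuantumModularOn (Γ : Subgroup SL(2, ℤ)) (k : ℝ) (S : Set ℚ) (f : ℚ → ℂ) : Prop :=
  ∃ χ : SL(2, ℤ) → ℂ, IsMultiplierSystem Γ k χ ∧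
    ∀ γ ∈ Γ, ∃ h : ℝ → ℂ,
      AnalyticOnNhd ℝ h {x : ℝ | (γ.1 1 0 : ℝ) * x + (γ.1 1 1 : ℝ) ≠ 0} ∧
      ∀ x ∈ S, (γ.1 1 0 : ℚ) * x + (γ.1 1 1 : ℚ) ≠ 0 → moebius γ x ∈ S →
        f x - (χ γ)⁻¹ * autFactor (-k) γ (x : ℝ) * f (moebius γ x) = h (x : ℝ)

/-- A function `F` on the upper half-plane (values elsewhere are irrelevant) is a quantum modular
form of weight `k` with quantum set `S`: its vertical limits `F(x + i t)`, `t → 0⁺`, exist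
at all `x ∈ S`, and they form a quantum modular form of weight `k` on some congruence subgroup
of `SL(2, ℤ)`. -/
def IsQuantumModularForm (k : ℝ) (S : Set ℚ) (F : ℂ → ℂ) : Prop :=
  ∃ f : ℚ → ℂ,
    (∀ x ∈ S, Filter.Tendsto (fun t : ℝ => F ((x : ℂ) + (t : ℂ) * Complex.I))
      (nhdsWithin 0 (Set.Ioi 0)) (nhds (f x))) ∧
    ∃ Γ : Subgroup SL(2, ℤ), CongruenceSubgroup.IsCongruenceSubgroup Γ ∧
      IsQuantumModularOn Γ k S f

end Plumbing

end

/-! Once each edge function is shared between its two ends, a vertex of degree d carries (w -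
w⁻¹)^(2-d), and the integral of each monomial of the theta series splits into one-variable principal
values (`vertexValue`). At a leaf only the exponents 1 and -1 contribute, at a vertex of degree two
only 0, and at the centre the simple poles of 1/(w - w⁻¹) give πi·sgn(m) for odd m and 0 for even m
(`vertexValue_three`). Thus the lattice sum lives on finitely many lines parallel to the axis of the
centre, one for each choice of signs at the leaves, and the sign at the centre turns each line sum
into false theta functions.

On such a line the form xᵀM⁻¹x equals A(n + β)² + K. The point is that K, like A, does not depend on
the line (`exists_invForm_eq`): K pairs the leaf signs with the solution of the linear system from
which the centre has been removed; that system decouples into legs with one leaf each, and changing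
the sign at a leaf changes the sign of the solution on that leg. Hence a single power of q factors
out, and what remains is a linear combination of false theta functions with one common scaling. This
is why q^c Z is itself modular, and not only its constituents.

For modularity, a false theta function is, up to finitely many powers of q, a finite sum of series ∑
sgn(n) q^(n²/(2P)) over residue classes (`falseTheta_eq`), whose limit at a rational x is, up to a
constant, an Eichler integral of the weight 3/2 theta function ∑ n q^(n²/(2P)) along the vertical
line above x (`tendsto_signTheta`). On Γ(4P) all these theta functions transform with the same
multiplier, a normalised Gauss sum independent of the residue class (`unaryTheta_transform_of_pos`,
`exists_unaryTheta_multiplier`). The inverse of γ carries the vertical line above γx to the geodesic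
from x to -d/c, so by Cauchy's theorem the obstruction is the integral along the vertical line above
-d/c (`HasCuspDecay.obstruction_eq`), and this is real-analytic in x ≠ -d/c
(`HasCuspDecay.analyticOnNhd`). The bound y^(-1/4) for the theta functions at every cusp makes all
these integrals converge, so the quantum set is all of ℚ. Powers of q have analytic obstructions for
any multiplier, and at a common level P linear combinations are harmless. -/

namespace Plumbing

/-! ### Legs of a star graph -/

/-- The graph obtained from `G` by isolating the vertex `c`. -/
def isolate {V : Type*} (G : SimpleGraph V) (c : V) : SimpleGraph V where
  Adj u v := G.Adj u v ∧ u ≠ c ∧ v ≠ c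
  symm := ⟨fun _ _ h => ⟨h.1.symm, h.2.2, h.2.1⟩⟩
  loopless := ⟨fun _ h => G.loopless.irrefl _ h.1⟩

section Legs

variable {V : Type*} [Fintype V] {G : SimpleGraph V} [DecidableRel G.Adj]

theorem eq_of_adj_of_degree_one [DecidableEq V] {v a b : V} (hv : G.degree v = 1) (ha : G.Adj v a)
    (hb : G.Adj v b) : a = b := by
  rw [← SimpleGraph.card_neighborFinset_eq_degree, Finset.card_eq_one] at hv
  obtain ⟨x, hx⟩ := hv
  have h1 : a ∈ G.neighborFinset v := by simpa using ha
  have h2 : b ∈ G.neighborFinset v := by simpa using hb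
  rw [hx, Finset.mem_singleton] at h1 h2
  rw [h1, h2]

theorem eq_or_eq_of_adj_of_degree_le_two [DecidableEq V] {v a b x : V} (hv : G.degree v ≤ 2)
    (hab : a ≠ b) (ha : G.Adj v a) (hb : G.Adj v b) (hx : G.Adj v x) : x = a ∨ x = b := by
  by_contra! h
  have : ({x, a, b} : Finset V).card ≤ 2 := by
    refine (Finset.card_le_card ?_).trans hv
    intro y hy
    simp only [Finset.mem_insert, Finset.mem_singleton] at hy
    rw [SimpleGraph.mem_neighborFinset]
    rcases hy with rfl | rfl | rfl <;> assumption
  rw [Finset.card_eq_three.2 ⟨x, a, b, h.1, h.2, hab, rfl⟩] at this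
  omega

/-- Distinct leaves of a star lie on distinct legs. -/
theorem eq_of_reachable_isolate (hG : G.Connected) {c : V}
    (hdeg : ∀ v, v ≠ c → G.degree v ≤ 2) {k l : V} (hlc : l ≠ c)
    (hk : G.degree k = 1) (hl : G.degree l = 1) (h : (isolate G c).Reachable k l) : k = l := by
  classical
  by_contra hkl
  obtain ⟨p, hp⟩ := h.exists_isPath
  have hne : ∀ i, p.getVert i ≠ c := by
    intro i
    rcases lt_or_ge i p.length with hi | hi
    · exact (p.adj_getVert_succ hi).2.1
    · rw [p.getVert_of_length_le hi]; exact hlc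
  have hpos : 0 < p.length := by
    by_contra h0
    exact hkl (SimpleGraph.Walk.eq_of_length_eq_zero (p := p) (by omega))
  -- The path uses up all neighbours of its vertices: its ends are leaves and its inner vertices
  -- have degree at most two. By connectedness a set closed under adjacency must contain the centre,
  -- which the path avoids.
  have hclosed : ∀ u ∈ p.support, ∀ v, G.Adj u v → v ∈ p.support := by
    intro u hu v huv
    obtain ⟨i, rfl, hi⟩ := SimpleGraph.Walk.mem_support_iff_exists_getVert.1 hu
    rcases Nat.eq_zero_or_pos i with rfl | hi0
    · have h1 := (p.adj_getVert_succ hpos).1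
      rw [p.getVert_zero] at h1 huv
      rw [eq_of_adj_of_degree_one hk huv h1]
      exact p.getVert_mem_support _
    · obtain ⟨i, rfl⟩ : ∃ j, i = j + 1 := ⟨i - 1, by omega⟩
      have h1 := (p.adj_getVert_succ (i := i) (by omega)).1.symm
      rcases hi.eq_or_lt with hi | hi
      · rw [hi, p.getVert_length] at huv
        rw [hi, p.getVert_length] at h1
        rw [eq_of_adj_of_degree_one hl huv h1]
        exact p.getVert_mem_support _
      · have h2 := (p.adj_getVert_succ hi).1
        have h3 : p.getVert i ≠ p.getVert (i + 1 + 1) := by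
          intro h
          have := hp.getVert_injOn (by simp; omega) (by simp; omega) h
          omega
        rcases eq_or_eq_of_adj_of_degree_le_two (hdeg _ (hne _)) h3 h1 h2 huv with h | h <;>
          rw [h] <;> exact p.getVert_mem_support _
  have hall : ∀ u v, G.Walk u v → u ∈ p.support → v ∈ p.support := by
    intro u v w
    induction w with
    | nil => exact id
    | cons h _ ih => exact fun hu => ih (hclosed _ hu _ h)
  obtain ⟨w⟩ := hG.preconnected k c
  obtain ⟨i, hi, -⟩ := SimpleGraph.Walk.mem_support_iff_exists_getVert.1
    (hall k c w p.start_mem_support)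
  exact hne i hi

/-- Signs prescribed at the leaves extend to the legs. -/
theorem exists_leg_signs (hG : G.Connected) {c : V} (hc : G.degree c = 3)
    (hdeg : ∀ v, v ≠ c → G.degree v ≤ 2) (η η' : V → ℤ)
    (h1 : ∀ v, G.degree v = 1 → η v = 1 ∨ η v = -1)
    (h1' : ∀ v, G.degree v = 1 → η' v = 1 ∨ η' v = -1) :
    ∃ σ : V → ℤ, (∀ v, σ v * σ v = 1) ∧ (∀ v, G.degree v = 1 → η' v = σ v * η v) ∧
      ∀ u v, u ≠ c → v ≠ c → G.Adj u v → σ u = σ v := by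
  classical
  -- The sign is flipped exactly on the legs whose leaf carries different prescribed signs.
  let p : V → Prop := fun v => ∃ l, G.degree l = 1 ∧ (isolate G c).Reachable v l ∧ η' l ≠ η l
  refine ⟨fun v => if p v then -1 else 1, fun v => by dsimp only; split_ifs <;> norm_num,
    fun v hv => ?_, fun u v hu hv huv => ?_⟩
  · by_cases h : η' v = η v
    · have : ¬ p v := by
        rintro ⟨l, hl, hr, hne⟩
        have hlc : l ≠ c := by rintro rfl; omega
        obtain rfl := eq_of_reachable_isolate hG hdeg hlc hv hl hr
        exact hne h
      simp [this, h]
    · have : p v := ⟨v, hv, SimpleGraph.Reachable.refl _, h⟩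
      simp only [this, if_true]
      rcases h1 v hv with h2 | h2 <;> rcases h1' v hv with h3 | h3 <;> simp_all
  · have hr : (isolate G c).Adj u v := ⟨huv, hu, hv⟩
    have : p u ↔ p v := by
      constructor
      · rintro ⟨l, hl, hul, hne⟩
        exact ⟨l, hl, hr.symm.reachable.trans hul, hne⟩
      · rintro ⟨l, hl, hul, hne⟩
        exact ⟨l, hl, hr.reachable.trans hul, hne⟩
    simp only [this]

end Legs

/-! ### The quadratic form of the inverse matrix -/

section Quad

open Matrix

variable {N : ℕ}

/-- The quadratic form `x ↦ xᵀ M⁻¹ x` of the inverse of an integral matrix. -/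
noncomputable def invForm (M : Matrix (Fin N) (Fin N) ℤ) (x : Fin N → ℚ) : ℚ :=
  x ⬝ᵥ ((M.map (fun x : ℤ => (x : ℚ)))⁻¹ *ᵥ x)

variable {M : Matrix (Fin N) (Fin N) ℤ}

theorem isSymm_map_of_posDef (hpos : (M.map (fun x : ℤ => (x : ℝ))).PosDef) :
    (M.map (fun x : ℤ => (x : ℚ))).IsSymm := by
  have h := hpos.isHermitian
  ext i j
  have := congrFun (congrFun h i) j
  simp only [conjTranspose_apply, map_apply, star_trivial, transpose_apply] at this ⊢
  exact_mod_cast this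

theorem det_ne_zero_of_posDef (hpos : (M.map (fun x : ℤ => (x : ℝ))).PosDef) : M.det ≠ 0 := by
  have h := hpos.det_pos
  intro h0
  have h2 : (M.map (fun x : ℤ => (x : ℝ))).det = ((M.det : ℤ) : ℝ) :=
    ((Int.castRingHom ℝ).map_det M).symm
  rw [h2, h0] at h
  simp at h

theorem isUnit_det_map_of_posDef (hpos : (M.map (fun x : ℤ => (x : ℝ))).PosDef) :
    IsUnit (M.map (fun x : ℤ => (x : ℚ))).det := by
  have h2 : (M.map (fun x : ℤ => (x : ℚ))).det = ((M.det : ℤ) : ℚ) :=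
    ((Int.castRingHom ℚ).map_det M).symm
  rw [h2, isUnit_iff_ne_zero]
  exact_mod_cast det_ne_zero_of_posDef hpos

theorem dotProduct_mulVec_pos_of_posDef (hpos : (M.map (fun x : ℤ => (x : ℝ))).PosDef)
    {x : Fin N → ℚ} (hx : x ≠ 0) : 0 < x ⬝ᵥ (M.map (fun x : ℤ => (x : ℚ)) *ᵥ x) := by
  have h := hpos.dotProduct_mulVec_pos (x := fun i => (x i : ℝ)) (by
    intro h
    apply hx
    ext i
    simpa using congrFun h i)
  have h2 : (star (fun i => (x i : ℝ)) ⬝ᵥ (M.map (fun x : ℤ => (x : ℝ)) *ᵥ fun i => (x i : ℝ)))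
      = ((x ⬝ᵥ (M.map (fun x : ℤ => (x : ℚ)) *ᵥ x) : ℚ) : ℝ) := by
    simp [dotProduct, mulVec]
  rw [h2] at h
  exact_mod_cast h

theorem dotProduct_mulVec_nonneg_of_posDef (hpos : (M.map (fun x : ℤ => (x : ℝ))).PosDef)
    (x : Fin N → ℚ) : 0 ≤ x ⬝ᵥ (M.map (fun x : ℤ => (x : ℚ)) *ᵥ x) := by
  rcases eq_or_ne x 0 with rfl | hx
  · simp
  · exact (dotProduct_mulVec_pos_of_posDef hpos hx).le

theorem diag_pos_of_posDef (hpos : (M.map (fun x : ℤ => (x : ℝ))).PosDef) (j : Fin N) :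
    0 < M j j := by
  have := dotProduct_mulVec_pos_of_posDef hpos (x := Pi.single j 1) (by simp)
  simp at this
  exact_mod_cast this

/-- Cauchy–Schwarz for the form M and the vectors M⁻¹x and e_j. It gives both the Gaussian decay of
the theta coefficients and the positivity of the leading coefficient on the lines of the centre. -/
theorem sq_le_mul_invForm (hpos : (M.map (fun x : ℤ => (x : ℝ))).PosDef) (x : Fin N → ℚ)
    (j : Fin N) : x j ^ 2 ≤ M j j * invForm M x := by
  set A := M.map (fun x : ℤ => (x : ℚ)) with hA
  have hs : A.IsSymm := isSymm_map_of_posDef hpos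
  set y := A⁻¹ *ᵥ x with hy
  have hAy : A *ᵥ y = x := by
    rw [hy, mulVec_mulVec, mul_nonsing_inv _ (isUnit_det_map_of_posDef hpos), one_mulVec]
  have hd : (0 : ℚ) < M j j := by exact_mod_cast diag_pos_of_posDef hpos j
  -- This t minimises the form at y - t e_j, because (M y)_j = x_j.
  set t := x j / M j j with ht
  have h := dotProduct_mulVec_nonneg_of_posDef hpos (y - t • Pi.single j 1)
  rw [← hA] at h
  have h1 : y ⬝ᵥ A *ᵥ (Pi.single j 1) = x j := by
    rw [dotProduct_mulVec, ← mulVec_transpose, hs.eq, hAy]; simp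
  have h2 : (Pi.single j (1 : ℚ)) ⬝ᵥ A *ᵥ (Pi.single j 1) = M j j := by
    simp [hA]
  have h3 : y ⬝ᵥ x = invForm M x := by rw [invForm, ← hA, ← hy, dotProduct_comm]
  simp only [mulVec_sub, mulVec_smul, sub_dotProduct, dotProduct_sub, smul_dotProduct,
    dotProduct_smul, hAy, h1, h2, h3, single_one_dotProduct, smul_eq_mul] at h
  have h4 : t * M j j = x j := by rw [ht]; field_simp
  have h5 : t * x j * M j j = x j ^ 2 := by rw [mul_right_comm, h4]; ring
  nlinarith

theorem invForm_nonneg (hpos : (M.map (fun x : ℤ => (x : ℝ))).PosDef) (x : Fin N → ℚ) :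
    0 ≤ invForm M x := by
  rcases isEmpty_or_nonempty (Fin N) with h | ⟨⟨j⟩⟩
  · simp [invForm]
  · have hd : (0 : ℚ) < M j j := by exact_mod_cast diag_pos_of_posDef hpos j
    have := sq_le_mul_invForm hpos x j
    by_contra! h
    nlinarith [sq_nonneg (x j)]

/-- On the lines parallel to the axis of the centre of a star that matter for the integrals, the
quadratic form of the inverse matrix has a common minimum. -/
theorem exists_invForm_eq {G : SimpleGraph (Fin N)} [DecidableRel G.Adj]
    (hG : G.Connected) {c : Fin N} (hc : G.degree c = 3) (hdeg : ∀ v, v ≠ c → G.degree v ≤ 2)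
    (hM : IsPlumbingMatrix G M) (hpos : (M.map (fun x : ℤ => (x : ℝ))).PosDef) :
    ∃ A K : ℚ, 0 < A ∧ ∀ η : Fin N → ℤ, (∀ v, G.degree v = 1 → η v = 1 ∨ η v = -1) →
      (∀ v, v ≠ c → G.degree v ≠ 1 → η v = 0) → η c = 0 → ∃ β : ℚ, ∀ n : ℤ,
        invForm M (fun v => ((η + Pi.single c n : Fin N → ℤ) v : ℚ)) = A * (n + β) ^ 2 + K := by
  set B := M.map (fun x : ℤ => (x : ℚ)) with hB
  have hs : B.IsSymm := isSymm_map_of_posDef hpos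
  have hu := isUnit_det_map_of_posDef hpos
  rw [← hB] at hu
  have hsi : B⁻¹.IsSymm := by
    rw [IsSymm, transpose_nonsing_inv, hs.eq]
  set e : Fin N → ℚ := Pi.single c 1 with he
  set A := invForm M e with hA
  have hApos : 0 < A := by
    have h1 := sq_le_mul_invForm hpos e c
    have hd : (0 : ℚ) < M c c := by exact_mod_cast diag_pos_of_posDef hpos c
    simp only [he, Pi.single_eq_same] at h1
    rw [← he] at h1
    by_contra! h
    nlinarith
  -- the minimum on a line
  have key : ∀ x : Fin N → ℚ, ∃ (β : ℚ) (y : Fin N → ℚ), y c = 0 ∧ B *ᵥ y = x - β • e ∧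
      ∀ n : ℚ, invForm M (x + n • e) = A * (n + β) ^ 2 + x ⬝ᵥ y := by
    intro x
    -- The shift is chosen so that y = B⁻¹(x - βe) vanishes at the centre. Then y solves the system
    -- off the centre, and x · y is the minimum of the form on the line.
    set β := (B⁻¹ *ᵥ x) c / A with hβ
    have hA' : (B⁻¹ *ᵥ e) c = A := by
      rw [hA, invForm, ← hB]; simp [he]
    have hβA : β * A = (B⁻¹ *ᵥ x) c := by rw [hβ]; field_simp
    refine ⟨β, B⁻¹ *ᵥ (x - β • e), ?_, ?_, ?_⟩
    · rw [mulVec_sub, mulVec_smul, Pi.sub_apply, Pi.smul_apply, hA', smul_eq_mul, hβA, sub_self]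
    · rw [mulVec_mulVec, mul_nonsing_inv _ hu, one_mulVec]
    · intro n
      have h1 : x ⬝ᵥ B⁻¹ *ᵥ e = β * A := by
        rw [dotProduct_mulVec, ← mulVec_transpose, hsi.eq, hβA]; simp [he]
      have h2 : e ⬝ᵥ B⁻¹ *ᵥ x = β * A := by rw [hβA]; simp [he]
      have h3 : e ⬝ᵥ B⁻¹ *ᵥ e = A := by rw [hA, invForm]
      rw [invForm, ← hB]
      simp only [mulVec_add, mulVec_sub, mulVec_smul, add_dotProduct, dotProduct_add,
        dotProduct_sub, smul_dotProduct, dotProduct_smul, h1, h2, h3, smul_eq_mul]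
      ring
  have hcast : ∀ (η : Fin N → ℤ) (n : ℤ), (fun v => ((η + Pi.single c n : Fin N → ℤ) v : ℚ)) =
      (fun v => (η v : ℚ)) + (n : ℚ) • e := by
    intro η n
    ext v
    rcases eq_or_ne v c with rfl | hv
    · simp [he]
    · simp [he, hv]
  -- The constant K is read off from one reference choice of signs; without any choice the claim is
  -- vacuous.
  by_cases hex : ∃ η : Fin N → ℤ, (∀ v, G.degree v = 1 → η v = 1 ∨ η v = -1) ∧
      (∀ v, v ≠ c → G.degree v ≠ 1 → η v = 0) ∧ η c = 0
  swap
  · exact ⟨A, 0, hApos, fun η h1 h2 h3 => (hex ⟨η, h1, h2, h3⟩).elim⟩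
  obtain ⟨η, h1, h2, h3⟩ := hex
  obtain ⟨β, y, hy0, hy, hq⟩ := key (fun v => (η v : ℚ))
  refine ⟨A, (fun v => (η v : ℚ)) ⬝ᵥ y, hApos, fun η' h1' h2' h3' => ?_⟩
  obtain ⟨β', y', hy0', hy', hq'⟩ := key (fun v => (η' v : ℚ))
  refine ⟨β', fun n => ?_⟩
  rw [hcast, hq']
  congr 1
  obtain ⟨σ, hσ, hση, hσa⟩ := exists_leg_signs hG hc hdeg η η' h1 h1'
  have hησ : ∀ v, v ≠ c → η' v = σ v * η v := by
    intro v hv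
    by_cases hd : G.degree v = 1
    · exact hση v hd
    · rw [h2' v hv hd, h2 v hv hd, mul_zero]
  -- the flipped vector solves the flipped system off the centre
  have hflip : ∃ b : ℚ, B *ᵥ (fun v => (σ v : ℚ) * y v) = (fun v => (η' v : ℚ)) + b • e := by
    refine ⟨(B *ᵥ (fun v => (σ v : ℚ) * y v)) c - η' c, ?_⟩
    ext v
    rcases eq_or_ne v c with rfl | hv
    · simp [he]
    · have e1 : (B *ᵥ (fun v => (σ v : ℚ) * y v)) v = σ v * (B *ᵥ y) v := by
        simp only [mulVec, dotProduct, Finset.mul_sum]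
        refine Finset.sum_congr rfl fun k _ => ?_
        rcases eq_or_ne k c with rfl | hk
        · simp [hy0]
        rcases eq_or_ne v k with rfl | hvk
        · ring
        by_cases hadj : G.Adj v k
        · rw [hσa v k hv hk hadj]; ring
        · simp [hB, hM v k hvk, hadj]
      rw [e1, hy]
      simp [he, hv, hησ v hv]
  obtain ⟨b, hb⟩ := hflip
  have hy'' : y' = (fun v => (σ v : ℚ) * y v) + (-(b + β')) • (B⁻¹ *ᵥ e) := by
    have e1 : y' = B⁻¹ *ᵥ (B *ᵥ y') := by
      rw [mulVec_mulVec, nonsing_inv_mul _ hu, one_mulVec]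
    have e2 : (fun v => (σ v : ℚ) * y v) = B⁻¹ *ᵥ (B *ᵥ (fun v => (σ v : ℚ) * y v)) := by
      rw [mulVec_mulVec, nonsing_inv_mul _ hu, one_mulVec]
    rw [e2, hb, e1, hy', ← mulVec_smul, ← mulVec_add]
    congr 1
    ext v
    simp
    ring
  -- Both y' and the flipped y vanish at the centre, whereas B⁻¹e has the nonzero entry A there.
  have hbb : b + β' = 0 := by
    have := congrFun hy'' c
    have hA' : (B⁻¹ *ᵥ e) c = A := by
      rw [hA, invForm, ← hB]; simp [he]
    rw [hy0', Pi.add_apply, Pi.smul_apply, hA', hy0] at this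
    simp only [mul_zero, zero_add, smul_eq_mul] at this
    rcases mul_eq_zero.1 this.symm with h | h
    · linarith
    · exact absurd h hApos.ne'
  rw [hbb] at hy''
  simp only [neg_zero, zero_smul, add_zero] at hy''
  rw [hy'']
  simp only [dotProduct]
  refine Finset.sum_congr rfl fun v _ => ?_
  rcases eq_or_ne v c with rfl | hv
  · simp [hy0]
  · rw [hησ v hv]
    have : (σ v : ℚ) * σ v = 1 := by exact_mod_cast hσ v
    push_cast
    linear_combination (η v : ℚ) * y v * this

end Quad

end Plumbing

/-! ### Unary theta functions of weight 3/2: inversion, Gauss sums, transformation under Γ(4P). -/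

namespace Plumbing

open Complex

/-! ### Sums over residue classes -/

theorem sum_range_shift_of_periodic {c : ℕ} {f : ℤ → ℂ} (hf : ∀ x, f (x + c) = f x) (u : ℤ) :
    ∑ j ∈ Finset.range c, f (u + j) = ∑ j ∈ Finset.range c, f j := by
  have step : ∀ u : ℤ, ∑ j ∈ Finset.range c, f (u + 1 + j) = ∑ j ∈ Finset.range c, f (u + j) := by
    intro u
    have h1 := Finset.sum_range_succ (fun j : ℕ => f (u + j)) c
    have h2 := Finset.sum_range_succ' (fun j : ℕ => f (u + j)) c
    rw [h1, hf] at h2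
    simp only [Nat.cast_zero, add_zero] at h2
    rw [add_right_cancel h2]
    refine Finset.sum_congr rfl fun j _ => ?_
    congr 1
    push_cast
    ring
  induction u using Int.induction_on with
  | zero => simp
  | succ i ih => rw [step, ih]
  | pred i ih => rw [← ih, ← step (-(i : ℤ) - 1)]; simp

theorem tsum_int_eq_sum_range {f : ℤ → ℂ} (hf : Summable f) {c : ℕ} (hc : 0 < c) :
    ∑' k, f k = ∑ j ∈ Finset.range c, ∑' k : ℤ, f (j + c * k) := by
  have : NeZero c := ⟨hc.ne'⟩
  have h1 : Summable fun p : ℤ × Fin c => f ((Int.divModEquiv c).symm p) :=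
    (Int.divModEquiv c).symm.summable_iff.2 hf
  have h2 : Summable fun p : Fin c × ℤ => f ((Int.divModEquiv c).symm (p.2, p.1)) :=
    (Equiv.prodComm (Fin c) ℤ).summable_iff.2 h1
  rw [← (Int.divModEquiv c).symm.tsum_eq f,
    ← (Equiv.prodComm (Fin c) ℤ).tsum_eq fun p => f ((Int.divModEquiv c).symm p)]
  simp only [Equiv.prodComm_apply, Prod.swap]
  rw [h2.tsum_prod' fun b => h2.comp_injective (Prod.mk_right_injective b), tsum_fintype,
    Finset.sum_range]
  refine Finset.sum_congr rfl fun j _ => tsum_congr fun k => ?_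
  rw [Int.divModEquiv_symm_apply]
  congr 1
  ring

/-! ### Unary theta functions of weight `3 / 2` -/

/-- From e^(-x) ≤ 3x^(-5/4) the terms are at most a constant times y^(-5/4)|n|^(-3/2), which is
summable. The exponent 5/4 serves two ends: with the kernel v^(-1/2) it gives v^(-7/4), integrable
at infinity, and after inversion it becomes y^(3/2 - 5/4), leaving y^(-1/4) at the cusps, where
v^(-3/4) is integrable. -/
theorem exists_abs_mul_exp_bound : ∃ C : ℝ, 0 < C ∧ ∀ y : ℝ, 0 < y →
    Summable (fun n : ℤ => |(n : ℝ)| * Real.exp (-(Real.pi * n ^ 2 * y))) ∧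
    ∑' n : ℤ, |(n : ℝ)| * Real.exp (-(Real.pi * n ^ 2 * y)) ≤ C * y ^ (-(5 / 4) : ℝ) := by
  have hs : Summable fun n : ℤ => |(n : ℝ)| ^ (-(3 / 2) : ℝ) :=
    Real.summable_abs_int_rpow (by norm_num)
  have hexp : ∀ x : ℝ, 0 < x → Real.exp (-x) ≤ 3 * x ^ (-(5 / 4) : ℝ) := by
    intro x hx
    have h1 : x ^ (5 / 4 : ℝ) ≤ 3 * Real.exp x := by
      have hq := Real.quadratic_le_exp_of_nonneg hx.le
      rcases le_total x 1 with h | h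
      · have := Real.rpow_le_one hx.le h (by norm_num : (0 : ℝ) ≤ 5 / 4)
        nlinarith
      · have := Real.rpow_le_rpow_of_exponent_le h (by norm_num : (5 / 4 : ℝ) ≤ 2)
        rw [Real.rpow_two] at this
        nlinarith
    rw [Real.exp_neg, Real.rpow_neg hx.le, ← div_eq_mul_inv, inv_eq_one_div,
      div_le_div_iff₀ (Real.exp_pos x) (Real.rpow_pos_of_pos hx _), one_mul]
    exact h1
  have hterm : ∀ y : ℝ, 0 < y → ∀ n : ℤ, |(n : ℝ)| * Real.exp (-(Real.pi * n ^ 2 * y)) ≤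
      3 * y ^ (-(5 / 4) : ℝ) * |(n : ℝ)| ^ (-(3 / 2) : ℝ) := by
    intro y hy n
    rcases eq_or_ne n 0 with rfl | hn
    · simp
    have hn' : 0 < |(n : ℝ)| := abs_pos.2 (by exact_mod_cast hn)
    have h1 : Real.exp (-(Real.pi * n ^ 2 * y)) ≤ Real.exp (-(|(n : ℝ)| ^ (2 : ℝ) * y)) := by
      apply Real.exp_le_exp.2
      rw [Real.rpow_two, sq_abs]
      have : 0 ≤ (n : ℝ) ^ 2 * y := by positivity
      nlinarith [Real.pi_gt_three]
    have h2 := hexp (|(n : ℝ)| ^ (2 : ℝ) * y) (by positivity)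
    rw [Real.mul_rpow (by positivity) hy.le, ← Real.rpow_mul hn'.le] at h2
    calc _ ≤ |(n : ℝ)| * (3 * (|(n : ℝ)| ^ ((2 : ℝ) * -(5 / 4)) * y ^ (-(5 / 4) : ℝ))) :=
          mul_le_mul_of_nonneg_left (h1.trans h2) hn'.le
      _ = 3 * y ^ (-(5 / 4) : ℝ) * (|(n : ℝ)| ^ (1 : ℝ) * |(n : ℝ)| ^ ((2 : ℝ) * -(5 / 4))) := by
          rw [Real.rpow_one]; ring
      _ = _ := by
          rw [← Real.rpow_add hn']
          norm_num
  refine ⟨3 * ∑' n : ℤ, |(n : ℝ)| ^ (-(3 / 2) : ℝ) + 1, by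
    have : 0 ≤ ∑' n : ℤ, |(n : ℝ)| ^ (-(3 / 2) : ℝ) := tsum_nonneg fun n => by positivity
    positivity, fun y hy => ?_⟩
  have hs' := hs.mul_left (3 * y ^ (-(5 / 4) : ℝ))
  have hsum := Summable.of_nonneg_of_le (fun n => by positivity) (hterm y hy) hs'
  refine ⟨hsum, (hsum.tsum_le_tsum (hterm y hy) hs').trans ?_⟩
  rw [tsum_mul_left]
  have : 0 < y ^ (-(5 / 4) : ℝ) := Real.rpow_pos_of_pos hy _
  nlinarith

theorem norm_intCast_mul_exp (n : ℤ) (σ : ℂ) :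
    ‖(n : ℂ) * cexp (Real.pi * I * (n : ℂ) ^ 2 * σ)‖ =
      |(n : ℝ)| * Real.exp (-(Real.pi * n ^ 2 * σ.im)) := by
  rw [norm_mul, Complex.norm_intCast, Complex.norm_exp]
  congr 2
  have : (Real.pi * I * (n : ℂ) ^ 2 * σ) = ((Real.pi * n ^ 2 : ℝ) : ℂ) * (I * σ) := by
    push_cast; ring
  rw [this, Complex.re_ofReal_mul]
  simp

/-- The theta function `∑ n exp (π i n² σ)`, the sum being over `n ≡ g` modulo `L`. -/
noncomputable def residueTheta (L : ℕ) (g : ℤ) (σ : ℂ) : ℂ :=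
  ∑' k : ℤ, ((g + L * k : ℤ) : ℂ) * cexp (Real.pi * I * ((g + L * k : ℤ) : ℂ) ^ 2 * σ)

theorem injective_add_mul {L : ℕ} (hL : 0 < L) (g : ℤ) :
    Function.Injective fun k : ℤ => g + L * k := by
  intro k l h
  simpa [hL.ne'] using h

theorem summable_norm_residueTheta {L : ℕ} (hL : 0 < L) (g : ℤ) {σ : ℂ} (hσ : 0 < σ.im) :
    Summable fun k : ℤ =>
      ‖((g + L * k : ℤ) : ℂ) * cexp (Real.pi * I * ((g + L * k : ℤ) : ℂ) ^ 2 * σ)‖ := by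
  obtain ⟨C, -, hC⟩ := exists_abs_mul_exp_bound
  have := (hC _ hσ).1.comp_injective (injective_add_mul hL g)
  refine this.congr fun k => ?_
  rw [norm_intCast_mul_exp]
  rfl

theorem exists_norm_residueTheta_le : ∃ C : ℝ, 0 < C ∧ ∀ (L : ℕ) (g : ℤ) (σ : ℂ), 0 < L →
    0 < σ.im → ‖residueTheta L g σ‖ ≤ C * σ.im ^ (-(5 / 4) : ℝ) := by
  obtain ⟨C, hC0, hC⟩ := exists_abs_mul_exp_bound
  refine ⟨C, hC0, fun L g σ hL hσ => ?_⟩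
  have hs := summable_norm_residueTheta hL g hσ
  refine (norm_tsum_le_tsum_norm hs).trans (le_trans ?_ (hC _ hσ).2)
  simp only [norm_intCast_mul_exp]
  exact ((hC _ hσ).1.comp_injective (injective_add_mul hL g)).tsum_le_tsum_of_inj _
    (injective_add_mul hL g) (fun _ _ => by positivity) (fun _ => le_rfl) (hC _ hσ).1

theorem neg_one_div_mem {t : ℂ} (ht : 0 < t.im) (L : ℝ) (hL : 0 < L) :
    0 < (-1 / (L ^ 2 * t)).im := by
  have : (-1 / ((L : ℂ) ^ 2 * t)) = ((L ^ 2)⁻¹ : ℝ) * (-t⁻¹) := by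
    push_cast
    rw [mul_comm, ← div_div, div_eq_inv_mul, neg_div, one_div]
  rw [this, Complex.im_ofReal_mul, neg_im, inv_im]
  have h2 : 0 < normSq t := normSq_pos.2 (by rintro rfl; simp at ht)
  have : -(-t.im / normSq t) = t.im / normSq t := by ring
  rw [this]
  positivity

/-- The functional equation of the z-derivative of the Jacobi theta function at z = g/L. Inversion
exchanges the restriction to a residue class with an additive character. -/
theorem residueTheta_neg_one_div {L : ℕ} (hL : 0 < L) (g : ℤ) {t : ℂ} (ht : 0 < t.im) :
    residueTheta L g (-1 / ((L : ℂ) ^ 2 * t)) = -(L * t * (-I * t) ^ (1 / 2 : ℂ)) *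
      ∑' m : ℤ, (m : ℂ) * cexp (Real.pi * I * m ^ 2 * t + 2 * Real.pi * I * m * (g / L)) := by
  have hL0 : (L : ℂ) ≠ 0 := by exact_mod_cast hL.ne'
  have ht0 : t ≠ 0 := by rintro rfl; simp at ht
  have hpi : (Real.pi : ℂ) ≠ 0 := by exact_mod_cast Real.pi_ne_zero
  have hroot : (-I * t) ^ (1 / 2 : ℂ) ≠ 0 := by
    rw [Ne, cpow_eq_zero_iff, not_and_or]
    left
    exact mul_ne_zero (neg_ne_zero.2 I_ne_zero) ht0
  have hinv : 0 < (-1 / t).im := by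
    have := neg_one_div_mem ht 1 one_pos
    simpa using this
  set z : ℂ := g / L with hz
  have h1 := jacobiTheta₂'_functional_equation z t
  rw [← (hasSum_jacobiTheta₂'_term z ht).tsum_eq,
    ← (hasSum_jacobiTheta₂'_term (z / t) hinv).tsum_eq,
    ← (hasSum_jacobiTheta₂_term (z / t) hinv).tsum_eq, ← tsum_mul_left,
    ← (hasSum_jacobiTheta₂'_term (z / t) hinv).summable.tsum_sub
      ((hasSum_jacobiTheta₂_term (z / t) hinv).summable.mul_left _)] at h1
  -- The two series combine to the factor n - z; with n = -k it is -(g + Lk)/L, and completing the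
  -- square in the exponent leaves the same integer.
  have h2 : ∑' n : ℤ, (jacobiTheta₂'_term n (z / t) (-1 / t) -
      2 * Real.pi * I * z * jacobiTheta₂_term n (z / t) (-1 / t)) =
      -(2 * Real.pi * I / L * cexp (Real.pi * I * z ^ 2 / t)) *
        residueTheta L g (-1 / ((L : ℂ) ^ 2 * t)) := by
    rw [residueTheta, ← tsum_mul_left, ← (Equiv.neg ℤ).tsum_eq]
    refine tsum_congr fun k => ?_
    rw [Equiv.neg_apply, jacobiTheta₂'_term, jacobiTheta₂_term]
    have e1 : cexp (2 * Real.pi * I * ((-k : ℤ) : ℂ) * (z / t) +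
        Real.pi * I * ((-k : ℤ) : ℂ) ^ 2 * (-1 / t)) = cexp (Real.pi * I * z ^ 2 / t) *
        cexp (Real.pi * I * ((g + L * k : ℤ) : ℂ) ^ 2 * (-1 / ((L : ℂ) ^ 2 * t))) := by
      rw [← Complex.exp_add]
      congr 1
      rw [hz]
      push_cast
      field_simp
      ring
    rw [e1, hz]
    push_cast
    field_simp
    ring
  have h3 : ∑' n : ℤ, jacobiTheta₂'_term n z t = 2 * Real.pi * I *
      ∑' m : ℤ, (m : ℂ) * cexp (Real.pi * I * m ^ 2 * t + 2 * Real.pi * I * m * z) := by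
    rw [← tsum_mul_left]
    refine tsum_congr fun m => ?_
    rw [jacobiTheta₂'_term, jacobiTheta₂_term, mul_assoc (2 * Real.pi * I)]
    congr 3
    ring
  rw [h2, h3] at h1
  have h4 : cexp (-Real.pi * I * z ^ 2 / t) * cexp (Real.pi * I * z ^ 2 / t) = 1 := by
    rw [← Complex.exp_add, ← Complex.exp_zero]
    congr 1
    ring
  have h5 : ∑' m : ℤ, (m : ℂ) * cexp (Real.pi * I * m ^ 2 * t + 2 * Real.pi * I * m * z) =
      -(1 / (L * t * (-I * t) ^ (1 / 2 : ℂ))) * residueTheta L g (-1 / ((L : ℂ) ^ 2 * t)) := by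
    have h2pi : (2 * Real.pi * I : ℂ) ≠ 0 := by simp [hpi]
    apply mul_left_cancel₀ h2pi
    rw [h1]
    generalize residueTheta L g _ = R
    generalize cexp (-Real.pi * I * z ^ 2 / t) = E at h4 ⊢
    generalize cexp (Real.pi * I * z ^ 2 / t) = E' at h4 ⊢
    field_simp
    linear_combination (-R) * h4
  rw [h5]
  field_simp

/-- On a class modulo Pc the phase exp(πi a n²/(Pc)) is constant because c is even, so splitting the
class modulo P into classes modulo Pc turns the rational translation into constant factors. -/
theorem residueTheta_add_rat {P c : ℕ} (hP : 0 < P) (hc : 0 < c) (hc2 : 2 ∣ c) (a r : ℤ) {σ : ℂ}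
    (hσ : 0 < σ.im) :
    residueTheta P r ((a / c + σ) / P) = ∑ j ∈ Finset.range c,
      cexp (Real.pi * I * (a * ((r + P * j : ℤ) : ℂ) ^ 2 / (P * c))) *
        residueTheta (P * c) (r + P * j) (σ / P) := by
  have hP0 : (P : ℂ) ≠ 0 := by exact_mod_cast hP.ne'
  have hc0 : (c : ℂ) ≠ 0 := by exact_mod_cast hc.ne'
  have him : 0 < ((a / c + σ) / P : ℂ).im := by
    have : ((a / c + σ) / P : ℂ) = ((P : ℝ)⁻¹ : ℝ) * (((a / c : ℝ) : ℂ) + σ) := by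
      push_cast
      rw [div_eq_inv_mul]
    rw [this, im_ofReal_mul, add_im, ofReal_im, zero_add]
    have : (0 : ℝ) < P := by exact_mod_cast hP
    positivity
  rw [residueTheta, tsum_int_eq_sum_range (summable_norm_residueTheta hP r him).of_norm hc]
  refine Finset.sum_congr rfl fun j _ => ?_
  rw [residueTheta, ← tsum_mul_left]
  refine tsum_congr fun k => ?_
  have e1 : (r + P * (j + c * k) : ℤ) = (r + P * j) + (P * c : ℕ) * k := by push_cast; ring
  rw [e1, mul_left_comm]
  congr 1
  set g : ℤ := r + P * j with hg
  obtain ⟨c', rfl⟩ := hc2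
  have e2 : Real.pi * I * ((g + (P * (2 * c') : ℕ) * k : ℤ) : ℂ) ^ 2 *
      ((a / (2 * c' : ℕ) + σ) / P) = Real.pi * I * (a * (g : ℂ) ^ 2 / (P * (2 * c' : ℕ))) +
        Real.pi * I * ((g + (P * (2 * c') : ℕ) * k : ℤ) : ℂ) ^ 2 * (σ / P) +
        ((a * g * k + a * P * c' * k ^ 2 : ℤ) : ℂ) * (2 * Real.pi * I) := by
    push_cast at hc0 ⊢
    have hc0' : (c' : ℂ) ≠ 0 := right_ne_zero_of_mul hc0
    field_simp
    ring
  rw [e2, Complex.exp_periodic.int_mul, Complex.exp_add]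

end Plumbing

namespace Plumbing

open Complex

/-! ### Gauss sums -/

/-- The Gauss sum `∑ exp (π i a x² / (P c))` over the `x` modulo `P c` congruent to `u`
modulo `P`. -/
noncomputable def gaussSumProg (P c : ℕ) (a u : ℤ) : ℂ :=
  ∑ j ∈ Finset.range c, cexp (Real.pi * I * (a * ((u + P * j : ℤ) : ℂ) ^ 2 / (P * c)))

section GaussSum

variable {P c : ℕ} {a : ℤ}

theorem exp_sq_add_period (hP : 0 < P) (hc : 0 < c) (hc2 : 2 ∣ c) (a x : ℤ) :
    cexp (Real.pi * I * (a * ((x + P * c : ℤ) : ℂ) ^ 2 / (P * c))) =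
      cexp (Real.pi * I * (a * (x : ℂ) ^ 2 / (P * c))) := by
  have hP0 : (P : ℂ) ≠ 0 := by exact_mod_cast hP.ne'
  have hc0 : (c : ℂ) ≠ 0 := by exact_mod_cast hc.ne'
  obtain ⟨c', rfl⟩ := hc2
  conv_rhs => rw [← Complex.exp_periodic.int_mul (a * x + a * P * c')]
  congr 1
  push_cast at hc0 ⊢
  have hc0' : (c' : ℂ) ≠ 0 := right_ne_zero_of_mul hc0
  field_simp
  ring

theorem gaussSumProg_add_mul (hP : 0 < P) (hc : 0 < c) (hc2 : 2 ∣ c) (a u k : ℤ) :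
    gaussSumProg P c a (u + P * k) = gaussSumProg P c a u := by
  have := sum_range_shift_of_periodic (c := c)
    (f := fun j => cexp (Real.pi * I * (a * ((u + P * j : ℤ) : ℂ) ^ 2 / (P * c)))) (fun x => by
      have := exp_sq_add_period hP hc hc2 a (u + P * x)
      rw [← this]
      congr 4
      push_cast
      ring) k
  rw [gaussSumProg, gaussSumProg, ← this]
  refine Finset.sum_congr rfl fun j _ => ?_
  congr 4
  push_cast
  ring

theorem gaussSumProg_of_dvd (hP : 0 < P) (hc : 0 < c) (hc2 : 2 ∣ c) (a : ℤ) {u : ℤ}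
    (hu : (P : ℤ) ∣ u) : gaussSumProg P c a u = gaussSumProg P c a 0 := by
  obtain ⟨k, rfl⟩ := hu
  rw [← gaussSumProg_add_mul hP hc hc2 a 0 k, zero_add]

/-- Moving u by 4Pc' = c, a multiple of P, leaves the sum unchanged but also multiplies it by
exp(2πi au/P). As a ≡ 1 modulo P, this factor is nontrivial unless P divides u. -/
theorem gaussSumProg_eq_zero (hP : 0 < P) (hc : 0 < c) (hc4 : 4 * P ∣ c)
    (ha : (P : ℤ) ∣ a - 1) {u : ℤ} (hu : ¬ (P : ℤ) ∣ u) : gaussSumProg P c a u = 0 := by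
  have hP0 : (P : ℂ) ≠ 0 := by exact_mod_cast hP.ne'
  obtain ⟨c', rfl⟩ := hc4
  have hc0 : (c' : ℂ) ≠ 0 := by
    have : c' ≠ 0 := by rintro rfl; simp at hc
    exact_mod_cast this
  have hc2 : 2 ∣ 4 * P * c' := ⟨2 * P * c', by ring⟩
  have h1 : gaussSumProg P (4 * P * c') a u =
      cexp (2 * Real.pi * I * (a * u / P)) * gaussSumProg P (4 * P * c') a u := by
    conv_lhs => rw [← gaussSumProg_add_mul hP hc hc2 a u (4 * c')]
    rw [gaussSumProg, gaussSumProg, Finset.mul_sum]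
    refine Finset.sum_congr rfl fun j _ => ?_
    rw [← Complex.exp_add, ← Complex.exp_periodic.int_mul (a * j + 2 * a * c')]
    conv_rhs => rw [← Complex.exp_periodic.int_mul (2 * (a * j + 2 * a * c'))]
    congr 1
    push_cast
    field_simp
    ring
  have h2 : cexp (2 * Real.pi * I * (a * u / P)) ≠ 1 := by
    intro h
    obtain ⟨n, hn⟩ := Complex.exp_eq_one_iff.1 h
    apply hu
    have h2pi : (2 * Real.pi * I : ℂ) ≠ 0 := by simp [Real.pi_ne_zero]
    have h3 : (a * u : ℂ) = n * P := by
      have : (2 * Real.pi * I : ℂ) * (a * u / P) = 2 * Real.pi * I * n := by rw [hn]; ring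
      have := mul_left_cancel₀ h2pi this
      field_simp at this
      linear_combination this
    have h4 : a * u = n * P := by exact_mod_cast h3
    obtain ⟨k, hk⟩ := ha
    exact ⟨n - k * u, by linear_combination h4 - u * hk⟩
  by_contra h0
  apply h2
  have : (cexp (2 * Real.pi * I * (a * u / P)) - 1) * gaussSumProg P (4 * P * c') a u = 0 := by
    linear_combination -h1
  exact sub_eq_zero.1 ((mul_eq_zero.1 this).resolve_right h0)

theorem sum_range_exp_eq {c : ℕ} (hc : 0 < c) (x : ℤ) :
    ∑ l ∈ Finset.range c, cexp (2 * Real.pi * I * (x * (l : ℤ) / c)) =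
      if (c : ℤ) ∣ x then (c : ℂ) else 0 := by
  have hc0 : (c : ℂ) ≠ 0 := by exact_mod_cast hc.ne'
  have hpow : ∀ l : ℕ, cexp (2 * Real.pi * I * (x * (l : ℤ) / c)) =
      cexp (2 * Real.pi * I * (x / c)) ^ l := by
    intro l
    rw [← Complex.exp_nat_mul]
    congr 1
    push_cast
    ring
  simp only [hpow]
  split_ifs with h
  · obtain ⟨k, rfl⟩ := h
    have : cexp (2 * Real.pi * I * (((c * k : ℤ) : ℂ) / c)) = 1 := by
      rw [Complex.exp_eq_one_iff]
      refine ⟨k, ?_⟩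
      push_cast
      field_simp
    simp only [this, one_pow, Finset.sum_const, Finset.card_range, nsmul_eq_mul, mul_one]
  · have h1 : cexp (2 * Real.pi * I * (x / c)) ≠ 1 := by
      intro h1
      obtain ⟨n, hn⟩ := Complex.exp_eq_one_iff.1 h1
      have h2pi : (2 * Real.pi * I : ℂ) ≠ 0 := by simp [Real.pi_ne_zero]
      have : (2 * Real.pi * I : ℂ) * (x / c) = 2 * Real.pi * I * n := by rw [hn]; ring
      have := mul_left_cancel₀ h2pi this
      field_simp at this
      apply h
      exact ⟨n, by exact_mod_cast this⟩
    rw [geom_sum_eq h1, ← Complex.exp_nat_mul]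
    have : cexp (c * (2 * Real.pi * I * (x / c))) = 1 := by
      rw [Complex.exp_eq_one_iff]
      refine ⟨x, ?_⟩
      field_simp
    rw [this, sub_self, zero_div]

theorem conj_exp_pi_I_mul (x : ℂ) (hx : (starRingEnd ℂ) x = x) :
    (starRingEnd ℂ) (cexp (Real.pi * I * x)) = cexp (-(Real.pi * I * x)) := by
  rw [← Complex.exp_conj]
  congr 1
  simp [hx]

/-- Writing the squared modulus over pairs (l + h, l), the sum over l is a character sum: it equals
c if c divides aPh and vanishes otherwise. The surviving h are the P multiples of 4c', where c =
4Pc', and for these the remaining quadratic phase is 1. -/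
theorem norm_sq_gaussSumProg (hP : 0 < P) (hc : 0 < c) (hc4 : 4 * P ∣ c)
    (ha : IsCoprime a c) : ‖gaussSumProg P c a 0‖ ^ 2 = P * c := by
  have hP0 : (P : ℂ) ≠ 0 := by exact_mod_cast hP.ne'
  have hc2 : 2 ∣ c := (Dvd.intro (2 * P) (by ring : 2 * (2 * P) = 4 * P)).trans hc4
  have hc0 : (c : ℂ) ≠ 0 := by exact_mod_cast hc.ne'
  let f : ℤ → ℂ := fun j => cexp (Real.pi * I * (a * ((0 + P * j : ℤ) : ℂ) ^ 2 / (P * c)))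
  have hfper : ∀ x, f (x + c) = f x := by
    intro x
    have := exp_sq_add_period hP hc hc2 a (0 + P * x)
    simp only [f]
    rw [← this]
    congr 4
    push_cast
    ring
  have hf : gaussSumProg P c a 0 = ∑ j ∈ Finset.range c, f j := rfl
  have h1 : gaussSumProg P c a 0 * (starRingEnd ℂ) (gaussSumProg P c a 0) =
      ∑ h ∈ Finset.range c, cexp (Real.pi * I * (a * P * (h : ℤ) ^ 2 / c)) *
        ∑ l ∈ Finset.range c, cexp (2 * Real.pi * I * (((a * P * h : ℤ) : ℂ) * (l : ℤ) / c)) := by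
    rw [hf, map_sum, Finset.mul_sum]
    have : ∀ l : ℕ, (∑ j ∈ Finset.range c, f j) * (starRingEnd ℂ) (f l) =
        ∑ h ∈ Finset.range c, f (l + h) * (starRingEnd ℂ) (f l) := by
      intro l
      rw [← sum_range_shift_of_periodic hfper l, Finset.sum_mul]
    simp only [this]
    rw [Finset.sum_comm]
    refine Finset.sum_congr rfl fun h _ => ?_
    rw [Finset.mul_sum]
    refine Finset.sum_congr rfl fun l _ => ?_
    simp only [f]
    rw [conj_exp_pi_I_mul _ (by simp), ← Complex.exp_add, ← Complex.exp_add]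
    congr 1
    push_cast
    field_simp
    ring
  obtain ⟨c', hc'⟩ := hc4
  have hc'0 : 0 < c' := by
    rcases Nat.eq_zero_or_pos c' with rfl | h
    · omega
    · exact h
  -- The factor a is prime to c and drops out; then P cancels from c = P · 4c'.
  have hdvd : ∀ h : ℕ, (c : ℤ) ∣ a * P * h ↔ 4 * c' ∣ h := by
    intro h
    rw [mul_assoc]
    refine Iff.trans ⟨IsCoprime.dvd_of_dvd_mul_left ha.symm, fun h => Dvd.dvd.mul_left h a⟩ ?_
    have : (c : ℤ) = P * (4 * c' : ℕ) := by rw [hc']; push_cast; ring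
    rw [this, mul_dvd_mul_iff_left (by exact_mod_cast hP.ne')]
    exact Int.natCast_dvd_natCast
  simp only [sum_range_exp_eq hc, hdvd] at h1
  have h2 : ∀ h ∈ Finset.range c, (cexp (Real.pi * I * (a * P * (h : ℤ) ^ 2 / c)) *
      if 4 * c' ∣ h then (c : ℂ) else 0) = if 4 * c' ∣ h then (c : ℂ) else 0 := by
    intro h _
    split_ifs with hd
    · obtain ⟨k, rfl⟩ := hd
      have : cexp (Real.pi * I * (a * P * ((4 * c' * k : ℕ) : ℤ) ^ 2 / c)) = 1 := by
        rw [Complex.exp_eq_one_iff]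
        refine ⟨2 * a * c' * k ^ 2, ?_⟩
        have hc'' : (c' : ℂ) ≠ 0 := by exact_mod_cast hc'0.ne'
        rw [hc']
        push_cast
        field_simp
        ring
      rw [this, one_mul]
    · simp
  rw [Finset.sum_congr rfl h2, ← Finset.sum_filter, Finset.sum_const, nsmul_eq_mul] at h1
  have h3 : (Finset.range c).filter (fun h => 4 * c' ∣ h) =
      (Finset.range P).image fun k => 4 * c' * k := by
    ext h
    simp only [Finset.mem_filter, Finset.mem_range, Finset.mem_image]
    constructor
    · rintro ⟨hl, k, rfl⟩
      refine ⟨k, ?_, rfl⟩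
      have : k * (4 * c') < P * (4 * c') := by rw [hc'] at hl; linarith
      exact lt_of_mul_lt_mul_right this (by positivity)
    · rintro ⟨k, hk, rfl⟩
      refine ⟨?_, dvd_mul_right _ _⟩
      have : 4 * c' * k < 4 * c' * P := by
        apply Nat.mul_lt_mul_of_pos_left hk (by positivity)
      rw [hc']
      linarith
  rw [h3, Finset.card_image_of_injective _ (fun x y h => by
    simpa [hc'0.ne'] using h), Finset.card_range, Complex.mul_conj, Complex.normSq_eq_norm_sq] at h1
  exact_mod_cast h1

end GaussSum

/-! ### Modularity of the theta functions -/

theorem neg_I_mul_div_cpow_half {z : ℂ} (hz : 0 < z.im) {r : ℝ} (hr : 0 < r) :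
    (-I * (z / r)) ^ (1 / 2 : ℂ) = cexp (-(Real.pi / 4 * I)) * ((r : ℝ) ^ (-(1 / 2) : ℝ) : ℝ) *
      z ^ (1 / 2 : ℂ) := by
  have hz0 : z ≠ 0 := by rintro rfl; simp at hz
  have hr0 : (r : ℂ) ≠ 0 := by exact_mod_cast hr.ne'
  have hlog : Complex.log (-I * (z / r)) = -(Real.pi / 2 * I) + (-(Real.log r) + Complex.log z) := by
    have h1 : -I * (z / r) = ((r⁻¹ : ℝ) : ℂ) * (-I * z) := by push_cast; field_simp
    rw [h1, Complex.log_ofReal_mul (by positivity) (by simp [hz0]), Complex.log_mul (by simp) hz0,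
      Complex.log_neg_I, Real.log_inv]
    · push_cast; ring
    · rw [Complex.arg_neg_I]
      have h2 := Complex.arg_le_pi z
      have h3 : 0 ≤ z.arg := Complex.arg_nonneg_iff.2 hz.le
      constructor <;> linarith [Real.pi_pos]
  rw [Complex.cpow_def_of_ne_zero (by simp [hz0, hr0]), Complex.cpow_def_of_ne_zero hz0, hlog,
    Real.rpow_def_of_pos hr, Complex.ofReal_exp, ← Complex.exp_add, ← Complex.exp_add]
  congr 1
  push_cast
  ring

/-- The theta function `∑ n q ^ (n² / (2 P))`, the sum being over `n ≡ r` modulo `P`. -/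
noncomputable def unaryTheta (P : ℕ) (r : ℤ) (τ : ℂ) : ℂ := residueTheta P r (τ / P)

/-- Translation by a/c and one inversion turn the theta function into a series in m whose
coefficients are Gauss sums over the class of r + m. These vanish unless m ≡ -r modulo P, and
otherwise do not depend on r; so each theta function is mapped to a multiple of itself, with the
same factor for all residues. -/
theorem unaryTheta_transform_of_pos {P : ℕ} (hP : 0 < P) {a b d : ℤ} {c : ℕ} (hc : 0 < c)
    (hdet : a * d - b * c = 1) (ha : (4 * P : ℤ) ∣ a - 1) (hb : (4 * P : ℤ) ∣ b)
    (hc4 : 4 * P ∣ c) (hd : (4 * P : ℤ) ∣ d - 1) (r : ℤ) {τ : ℂ} (hτ : 0 < τ.im) :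
    unaryTheta P r ((a * τ + b) / (c * τ + d)) =
      cexp (-(Real.pi / 4 * I)) * (((P * c : ℝ) ^ (-(1 / 2) : ℝ) : ℝ) : ℂ) * gaussSumProg P c a 0 *
        ((c * τ + d) * (c * τ + d) ^ (1 / 2 : ℂ)) * unaryTheta P r τ := by
  have hP0 : (P : ℂ) ≠ 0 := by exact_mod_cast hP.ne'
  have hc0 : (c : ℂ) ≠ 0 := by exact_mod_cast hc.ne'
  have hPR : (0 : ℝ) < P := by exact_mod_cast hP
  have hcR : (0 : ℝ) < c := by exact_mod_cast hc
  have hc2 : 2 ∣ c := (Dvd.intro (2 * P) (by ring : 2 * (2 * P) = 4 * P)).trans hc4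
  set z : ℂ := c * τ + d with hz
  have hzim : 0 < z.im := by
    have : z.im = c * τ.im := by simp [hz]
    rw [this]; positivity
  have hz0 : z ≠ 0 := by intro h; simp [h] at hzim
  set t : ℂ := z / (P * c : ℝ) with ht
  have htim : 0 < t.im := by
    rw [ht, Complex.div_ofReal_im]; positivity
  have hdetC : (a * d - b * c : ℂ) = 1 := by exact_mod_cast hdet
  have hσ : 0 < (-1 / (c * z) : ℂ).im := by
    have h1 : (-1 / (c * z) : ℂ) = ((c : ℝ)⁻¹ : ℝ) * (-z⁻¹) := by
      push_cast; field_simp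
    rw [h1, im_ofReal_mul, neg_im, inv_im, neg_div, neg_neg]
    have h2 : 0 < normSq z := normSq_pos.2 hz0
    positivity
  -- The standard decomposition γτ = a/c - 1/(c(cτ + d)), from ad - bc = 1.
  have h1 : (a * τ + b) / z = a / c + -1 / (c * z) := by
    field_simp
    rw [hz]
    linear_combination -hdetC
  rw [unaryTheta, h1, residueTheta_add_rat hP hc hc2 a r hσ]
  have h2 : (-1 / (c * z) : ℂ) / P = -1 / (((P * c : ℕ) : ℂ) ^ 2 * t) := by
    rw [ht]
    push_cast
    field_simp
  have hPc : 0 < P * c := Nat.mul_pos hP hc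
  simp only [h2, residueTheta_neg_one_div hPc _ htim]
  have hsum : ∀ g : ℤ, Summable fun m : ℤ =>
      (m : ℂ) * cexp (Real.pi * I * m ^ 2 * t + 2 * Real.pi * I * m * (g / (P * c : ℕ))) := by
    intro g
    obtain ⟨C, -, hC⟩ := exists_abs_mul_exp_bound
    refine Summable.of_norm ((hC _ htim).1.congr fun m => ?_)
    rw [← norm_intCast_mul_exp, Complex.exp_add, ← mul_assoc, norm_mul ((m : ℂ) * _)]
    have : (2 * Real.pi * I * m * (g / (P * c : ℕ)) : ℂ) =
        ((2 * Real.pi * m * (g / (P * c : ℕ)) : ℝ) : ℂ) * I := by push_cast; ring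
    rw [this, Complex.norm_exp_ofReal_mul_I, mul_one]
  have h3 : ∑ j ∈ Finset.range c, cexp (Real.pi * I * (a * ((r + P * j : ℤ) : ℂ) ^ 2 / (P * c))) *
      (-(((P * c : ℕ) : ℂ) * t * (-I * t) ^ (1 / 2 : ℂ)) * ∑' m : ℤ, (m : ℂ) *
        cexp (Real.pi * I * m ^ 2 * t + 2 * Real.pi * I * m * (((r + P * j : ℤ) : ℂ) / (P * c : ℕ)))) =
      -(z * (-I * t) ^ (1 / 2 : ℂ)) * ∑' m : ℤ, (m : ℂ) * cexp (Real.pi * I * m ^ 2 * (τ / P)) *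
        gaussSumProg P c a (r + m) := by
    have e0 : ((P * c : ℕ) : ℂ) * t = z := by rw [ht]; push_cast; field_simp
    rw [e0]
    simp only [mul_left_comm (cexp _) (-(z * (-I * t) ^ (1 / 2 : ℂ)))]
    rw [← Finset.mul_sum]
    congr 1
    simp only [← tsum_mul_left]
    rw [← Summable.tsum_finsetSum fun j _ => (hsum _).mul_left _]
    refine tsum_congr fun m => ?_
    obtain ⟨d', hd'⟩ := hd
    obtain ⟨b', rfl⟩ := hb
    have hdd : d = 1 + 4 * P * d' := by linarith
    -- The Gauss sum depends on r + m only modulo P, so m may be replaced by dm, since d ≡ 1 modulo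
    -- 4P. Then ad = 1 + bc makes the quadratic phases agree up to an integer multiple of 2πi, by 4P
    -- | b.
    rw [← gaussSumProg_add_mul hP hc hc2 a (r + m) (4 * d' * m), gaussSumProg, Finset.mul_sum]
    refine Finset.sum_congr rfl fun j _ => ?_
    rw [mul_left_comm, ← Complex.exp_add, mul_assoc (m : ℂ), ← Complex.exp_add]
    congr 1
    conv_lhs => rw [← Complex.exp_periodic.int_mul (2 * b' * m * (2 * (r + P * j) + d * m))]
    congr 1
    have hdC : (d : ℂ) = 1 + 4 * P * d' := by exact_mod_cast hdd
    rw [ht, hz]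
    push_cast at hdetC ⊢
    have e1 : (r + m + P * (4 * d' * m) + P * j : ℂ) = (r + P * j) + d * m := by rw [hdC]; ring
    rw [e1]
    field_simp
    linear_combination -(m * (2 * (r + P * j) + d * m)) * hdetC
  rw [h3]
  -- Only m ≡ -r modulo P survive; the parametrisation m = -(r + Pk) produces the sign, the summand
  -- being odd in m.
  have h4 : ∑' m : ℤ, (m : ℂ) * cexp (Real.pi * I * m ^ 2 * (τ / P)) * gaussSumProg P c a (r + m) =
      -(gaussSumProg P c a 0 * unaryTheta P r τ) := by
    have ha' : (P : ℤ) ∣ a - 1 := (Dvd.intro_left 4 rfl).trans ha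
    have hinj : Function.Injective fun k : ℤ => -(r + P * k) :=
      neg_injective.comp (injective_add_mul hP r)
    rw [← hinj.tsum_eq, unaryTheta, residueTheta, ← tsum_mul_left, ← tsum_neg]
    · refine tsum_congr fun k => ?_
      rw [gaussSumProg_of_dvd hP hc hc2 a ⟨-k, by ring⟩]
      push_cast
      ring_nf
    · intro m hm
      by_contra hm'
      apply hm
      simp only
      rw [gaussSumProg_eq_zero hP hc hc4 ha', mul_zero]
      rintro ⟨k, hk⟩
      exact hm' ⟨-k, by simp only; linear_combination -hk⟩
  rw [h4, ht, neg_I_mul_div_cpow_half hzim (by positivity)]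
  ring

theorem unaryTheta_add {P : ℕ} (hP : 0 < P) {b : ℤ} (hb : (4 * P : ℤ) ∣ b) (r : ℤ) (τ : ℂ) :
    unaryTheta P r (τ + b) = unaryTheta P r τ := by
  have hP0 : (P : ℂ) ≠ 0 := by exact_mod_cast hP.ne'
  obtain ⟨k, rfl⟩ := hb
  rw [unaryTheta, unaryTheta, residueTheta, residueTheta]
  refine tsum_congr fun n => ?_
  congr 1
  conv_rhs => rw [← Complex.exp_periodic.int_mul ((r + P * n) ^ 2 * 2 * k)]
  congr 1
  push_cast
  field_simp
  ring

theorem norm_thetaMultiplier {P c : ℕ} (hP : 0 < P) (hc : 0 < c) (hc4 : 4 * P ∣ c) {a b d : ℤ}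
    (hdet : a * d - b * c = 1) :
    ‖cexp (-(Real.pi / 4 * I)) * (((P * c : ℝ) ^ (-(1 / 2) : ℝ) : ℝ) : ℂ) *
      gaussSumProg P c a 0‖ = 1 := by
  have hPR : (0 : ℝ) < P := by exact_mod_cast hP
  have hcR : (0 : ℝ) < c := by exact_mod_cast hc
  have h1 : -(Real.pi / 4 * I : ℂ) = ((-(Real.pi / 4) : ℝ) : ℂ) * I := by push_cast; ring
  rw [norm_mul, norm_mul, h1, Complex.norm_exp_ofReal_mul_I, one_mul,
    Complex.norm_of_nonneg (by positivity)]
  have h2 := norm_sq_gaussSumProg hP hc hc4 (a := a) ⟨d, -b, by linarith⟩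
  have h3 : ‖gaussSumProg P c a 0‖ = (P * c : ℝ) ^ (1 / 2 : ℝ) := by
    rw [← Real.sqrt_eq_rpow, ← h2, Real.sqrt_sq (norm_nonneg _)]
  rw [h3, ← Real.rpow_add (by positivity)]
  norm_num

end Plumbing

/-! ### The action of SL(2, ℤ), the multiplier on Γ(4P), growth and non-vanishing of the theta
functions. -/

namespace Plumbing

open Complex

theorem dvd_of_mem_Gamma {n : ℕ} {γ : SL(2, ℤ)} (hγ : γ ∈ CongruenceSubgroup.Gamma n) :
    (n : ℤ) ∣ γ.1 0 0 - 1 ∧ (n : ℤ) ∣ γ.1 0 1 ∧ (n : ℤ) ∣ γ.1 1 0 ∧ (n : ℤ) ∣ γ.1 1 1 - 1 := by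
  obtain ⟨h1, h2, h3, h4⟩ := CongruenceSubgroup.Gamma_mem.1 hγ
  refine ⟨?_, (ZMod.intCast_zmod_eq_zero_iff_dvd _ _).1 h2,
    (ZMod.intCast_zmod_eq_zero_iff_dvd _ _).1 h3, ?_⟩
  · rw [← ZMod.intCast_zmod_eq_zero_iff_dvd]; push_cast; rw [h1, sub_self]
  · rw [← ZMod.intCast_zmod_eq_zero_iff_dvd]; push_cast; rw [h4, sub_self]

theorem det_eq_one (γ : SL(2, ℤ)) : γ.1 0 0 * γ.1 1 1 - γ.1 0 1 * γ.1 1 0 = 1 := by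
  have := γ.2
  rwa [Matrix.det_fin_two] at this

theorem denom_ne_zero (γ : SL(2, ℤ)) {τ : ℂ} (hτ : 0 < τ.im) :
    (γ.1 1 0 : ℂ) * τ + γ.1 1 1 ≠ 0 := by
  intro h
  have h1 := congrArg Complex.im h
  simp [hτ.ne'] at h1
  rw [h1] at h
  have h2 : γ.1 1 1 = 0 := by simpa using h
  have := det_eq_one γ
  rw [h1, h2] at this
  simp at this

theorem moebius_im (γ : SL(2, ℤ)) (τ : ℂ) :
    (moebius γ τ).im = τ.im / normSq ((γ.1 1 0 : ℂ) * τ + γ.1 1 1) := by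
  have h : (γ.1 0 0 * γ.1 1 1 - γ.1 0 1 * γ.1 1 0 : ℝ) = 1 := by exact_mod_cast det_eq_one γ
  rw [moebius, Complex.div_im]
  simp
  rw [← sub_div]
  congr 1
  linear_combination τ.im * h

theorem moebius_im_pos (γ : SL(2, ℤ)) {τ : ℂ} (hτ : 0 < τ.im) : 0 < (moebius γ τ).im := by
  rw [moebius_im]
  exact div_pos hτ (normSq_pos.2 (denom_ne_zero γ hτ))

/-- The theta functions of level `P` transform with the same multiplier of absolute value one. -/
theorem exists_unaryTheta_multiplier {P : ℕ} (hP : 0 < P) {γ : SL(2, ℤ)}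
    (hγ : γ ∈ CongruenceSubgroup.Gamma (4 * P)) :
    ∃ v : ℂ, ‖v‖ = 1 ∧ ∀ (r : ℤ) (τ : ℂ), 0 < τ.im → unaryTheta P r (moebius γ τ) =
      v * (((γ.1 1 0 : ℂ) * τ + γ.1 1 1) * ((γ.1 1 0 : ℂ) * τ + γ.1 1 1) ^ (1 / 2 : ℂ)) *
        unaryTheta P r τ := by
  obtain ⟨ha, hb, hc, hd⟩ := dvd_of_mem_Gamma hγ
  have hdet := det_eq_one γ
  have hden := fun τ => @denom_ne_zero γ τ
  have him := fun τ => @moebius_im_pos γ τ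
  simp only [moebius] at him ⊢
  generalize γ.1 0 0 = a at *
  generalize γ.1 0 1 = b at *
  generalize γ.1 1 0 = c at *
  generalize γ.1 1 1 = d at *
  push_cast at ha hb hc hd
  rcases lt_trichotomy c 0 with h | h | h
  -- For c < 0 the inverse matrix has positive lower left entry; its transformation law is applied
  -- at the point γτ.
  · obtain ⟨c', hc'⟩ := Int.eq_ofNat_of_zero_le (a := -c) (by omega)
    obtain rfl : c = -(c' : ℤ) := by omega
    have hc0 : 0 < c' := by omega
    have hc4 : 4 * P ∣ c' := by
      have := (dvd_neg (a := (4 * P : ℤ))).1 hc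
      exact_mod_cast this
    have hdet' : d * a - (-b) * c' = 1 := by linarith
    have hn := norm_thetaMultiplier hP hc0 hc4 hdet'
    have ht := fun r τ hτ => @unaryTheta_transform_of_pos P hP d (-b) a c' hc0 hdet' hd
      ((dvd_neg (a := (4 * P : ℤ))).2 hb) hc4 ha r τ hτ
    generalize cexp (-(Real.pi / 4 * I)) * (((P * c' : ℝ) ^ (-(1 / 2) : ℝ) : ℝ) : ℂ) *
      gaussSumProg P c' d 0 = w at hn ht
    refine ⟨w⁻¹, by rw [norm_inv, hn, inv_one], fun r τ hτ => ?_⟩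
    have hw : w ≠ 0 := by rintro rfl; simp at hn
    have hz := hden τ hτ
    set z : ℂ := ((-(c' : ℤ) : ℤ) : ℂ) * τ + d with hzdef
    have hdetC : (d * a - (-b) * c' : ℂ) = 1 := by exact_mod_cast hdet'
    have h1 := ht r _ (him τ hτ)
    have h2 : (c' : ℂ) * ((a * τ + b) / z) + a = z⁻¹ := by
      field_simp
      rw [hzdef]
      push_cast
      linear_combination hdetC
    have h3 : (d * ((a * τ + b) / z) + (-b : ℤ)) / ((c' : ℂ) * ((a * τ + b) / z) + a) = τ := by
      rw [h2]
      field_simp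
      rw [hzdef]
      push_cast
      linear_combination τ * hdetC
    have hzim : z.im ≠ 0 := by
      rw [hzdef]
      simp [hc0.ne', hτ.ne']
    rw [h3, h2, Complex.inv_cpow _ _ (fun h => hzim (Complex.arg_eq_pi_iff.1 h).2)] at h1
    have hroot : z ^ (1 / 2 : ℂ) ≠ 0 := by
      rw [Ne, cpow_eq_zero_iff]
      exact fun h => hz h.1
    rw [h1, ← hzdef]
    field_simp
  · subst h
    have had : a * d = 1 := by linarith
    -- The case a = d = -1 is excluded because 4P does not divide -2. Hence γ is a translation by a
    -- multiple of 4P.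
    have had' : a = 1 ∧ d = 1 := by
      rcases Int.eq_one_or_neg_one_of_mul_eq_one' had with h | h
      · exact h
      · exfalso
        rw [h.1] at ha
        have := Int.le_of_dvd (by norm_num) ((dvd_neg (a := (4 * P : ℤ))).2 ha)
        have hP' : (1 : ℤ) ≤ P := by exact_mod_cast hP
        linarith
    obtain ⟨rfl, rfl⟩ := had'
    refine ⟨1, by simp, fun r τ hτ => ?_⟩
    have := unaryTheta_add hP hb r τ
    simpa using this
  · obtain ⟨c', rfl⟩ := Int.eq_ofNat_of_zero_le h.le
    have hc0 : 0 < c' := by omega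
    have hc4 : 4 * P ∣ c' := by exact_mod_cast hc
    refine ⟨_, norm_thetaMultiplier hP hc0 hc4 hdet, fun r τ hτ => ?_⟩
    have := unaryTheta_transform_of_pos hP hc0 hdet ha hb hc4 hd r hτ
    simpa using this

theorem differentiableOn_residueTheta {L : ℕ} (hL : 0 < L) (g : ℤ) :
    DifferentiableOn ℂ (residueTheta L g) {τ | 0 < τ.im} := by
  intro τ hτ
  have hτ' : 0 < τ.im := hτ
  have hopen : IsOpen {σ : ℂ | τ.im / 2 < σ.im} := isOpen_lt continuous_const continuous_im
  obtain ⟨C, -, hC⟩ := exists_abs_mul_exp_bound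
  have hs := (hC (τ.im / 2) (by positivity)).1.comp_injective (injective_add_mul hL g)
  have := differentiableOn_tsum_of_summable_norm (F := fun (k : ℤ) (σ : ℂ) =>
    ((g + L * k : ℤ) : ℂ) * cexp (Real.pi * I * ((g + L * k : ℤ) : ℂ) ^ 2 * σ)) hs
    (fun k => by fun_prop) hopen (fun k σ hσ => by
      rw [norm_intCast_mul_exp]
      have : τ.im / 2 ≤ σ.im := le_of_lt hσ
      simp only [Function.comp]
      gcongr)
  exact (this.differentiableAt (hopen.mem_nhds (by
    show τ.im / 2 < τ.im
    linarith))).differentiableWithinAt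

theorem differentiableOn_unaryTheta {P : ℕ} (hP : 0 < P) (r : ℤ) :
    DifferentiableOn ℂ (unaryTheta P r) {τ | 0 < τ.im} := by
  have hPR : (0 : ℝ) < P := by exact_mod_cast hP
  refine (differentiableOn_residueTheta hP r).comp (by fun_prop) fun τ hτ => ?_
  have hτ' : 0 < τ.im := hτ
  show 0 < (τ / P : ℂ).im
  rw [← Complex.ofReal_natCast, Complex.div_ofReal_im]
  positivity

theorem exists_norm_unaryTheta_le {P : ℕ} (hP : 0 < P) : ∃ C : ℝ, 0 < C ∧ ∀ (r : ℤ) (τ : ℂ),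
    0 < τ.im → ‖unaryTheta P r τ‖ ≤ C * τ.im ^ (-(5 / 4) : ℝ) := by
  obtain ⟨C, hC0, hC⟩ := exists_norm_residueTheta_le
  have hPR : (0 : ℝ) < P := by exact_mod_cast hP
  refine ⟨C * (P : ℝ)⁻¹ ^ (-(5 / 4) : ℝ), by positivity, fun r τ hτ => ?_⟩
  have him : (τ / P : ℂ).im = (P : ℝ)⁻¹ * τ.im := by
    rw [← Complex.ofReal_natCast, Complex.div_ofReal_im, div_eq_inv_mul]
  have := hC P r (τ / P) hP (by rw [him]; positivity)
  rw [him, Real.mul_rpow (by positivity) hτ.le, ← mul_assoc] at this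
  exact this

/-- Inversion sends iy to is with s proportional to 1/y. The automorphy factor s^(3/2) beats the
bound s^(-5/4) and leaves s^(1/4). -/
theorem exists_norm_residueTheta_I_mul_le {L : ℕ} (hL : 0 < L) : ∃ C : ℝ, 0 < C ∧
    ∀ (g : ℤ) (y : ℝ), 0 < y → ‖residueTheta L g (I * y)‖ ≤ C * y ^ (-(1 / 4) : ℝ) := by
  obtain ⟨C, hC0, hC⟩ := exists_abs_mul_exp_bound
  have hLR : (0 : ℝ) < L := by exact_mod_cast hL
  have hL0 : (L : ℂ) ≠ 0 := by exact_mod_cast hL.ne'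
  refine ⟨L * ((L : ℝ) ^ (-2 : ℝ)) ^ (1 / 4 : ℝ) * C, by positivity, fun g y hy => ?_⟩
  have hy0 : (y : ℂ) ≠ 0 := by exact_mod_cast hy.ne'
  set s : ℝ := (L : ℝ) ^ (-2 : ℝ) * y⁻¹ with hs
  have hs0 : 0 < s := by positivity
  have hsC : (s : ℂ) = ((L : ℂ) ^ 2)⁻¹ * (y : ℂ)⁻¹ := by
    rw [hs, Real.rpow_neg hLR.le, Real.rpow_two]
    push_cast
    rfl
  have h1 : (I * y : ℂ) = -1 / ((L : ℂ) ^ 2 * (I * s)) := by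
    rw [hsC]
    field_simp
    rw [I_sq]
  have hsim : 0 < (I * s : ℂ).im := by simpa using hs0
  rw [h1, residueTheta_neg_one_div hL g hsim]
  have h2 : (-I * (I * s) : ℂ) = (s : ℂ) := by linear_combination -(s : ℂ) * I_sq
  have hterm : ∀ m : ℤ, ‖(m : ℂ) * cexp (Real.pi * I * m ^ 2 * (I * s) +
      2 * Real.pi * I * m * (g / L))‖ = |(m : ℝ)| * Real.exp (-(Real.pi * m ^ 2 * s)) := by
    intro m
    have : (2 * Real.pi * I * m * (g / L) : ℂ) = ((2 * Real.pi * m * (g / L) : ℝ) : ℂ) * I := by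
      push_cast; ring
    rw [Complex.exp_add, ← mul_assoc, this, norm_mul ((m : ℂ) * _), Complex.norm_exp_ofReal_mul_I,
      mul_one, norm_intCast_mul_exp]
    simp
  have h3 : ‖∑' m : ℤ, (m : ℂ) * cexp (Real.pi * I * m ^ 2 * (I * s) +
      2 * Real.pi * I * m * (g / L))‖ ≤ C * s ^ (-(5 / 4) : ℝ) := by
    refine (norm_tsum_le_tsum_norm ?_).trans ?_
    · simp only [hterm]; exact (hC s hs0).1
    · simp only [hterm]; exact (hC s hs0).2
  rw [h2, norm_mul, norm_neg, norm_mul, norm_mul, norm_mul, norm_I, one_mul, Complex.norm_natCast,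
    Complex.norm_of_nonneg hs0.le, Complex.norm_cpow_eq_rpow_re_of_pos hs0]
  have hre : (1 / 2 : ℂ).re = 1 / 2 := by norm_num
  rw [hre]
  calc _ ≤ L * s * s ^ (1 / 2 : ℝ) * (C * s ^ (-(5 / 4) : ℝ)) :=
        mul_le_mul_of_nonneg_left h3 (by positivity)
    _ = L * C * (s ^ (1 : ℝ) * s ^ (1 / 2 : ℝ) * s ^ (-(5 / 4) : ℝ)) := by rw [Real.rpow_one]; ring
    _ = L * C * s ^ (1 / 4 : ℝ) := by
        rw [← Real.rpow_add hs0, ← Real.rpow_add hs0]; norm_num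
    _ = _ := by
        rw [hs, Real.mul_rpow (by positivity) (by positivity), Real.inv_rpow hy.le,
          ← Real.rpow_neg hy.le]
        ring

/-- The theta functions have at most slow growth at the cusps. -/
theorem exists_norm_unaryTheta_cusp_le {P : ℕ} (hP : 0 < P) (r : ℤ) (x : ℚ) : ∃ C : ℝ, 0 < C ∧
    ∀ y : ℝ, 0 < y → ‖unaryTheta P r (x + y * I)‖ ≤ C * y ^ (-(1 / 4) : ℝ) := by
  have hPR : (0 : ℝ) < P := by exact_mod_cast hP
  have hc : 0 < 2 * x.den := by have := x.den_pos; omega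
  obtain ⟨C, hC0, hC⟩ := exists_norm_residueTheta_I_mul_le (Nat.mul_pos hP hc)
  refine ⟨(2 * x.den : ℕ) * (C * (P : ℝ)⁻¹ ^ (-(1 / 4) : ℝ)), by positivity, fun y hy => ?_⟩
  -- The fraction is expanded by 2 because `residueTheta_add_rat` asks for an even denominator.
  have hx : (x : ℂ) = ((2 * x.num : ℤ) : ℂ) / ((2 * x.den : ℕ) : ℂ) := by
    conv_lhs => rw [← Rat.num_div_den x]
    push_cast
    have : (x.den : ℂ) ≠ 0 := by exact_mod_cast x.den_pos.ne'
    field_simp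
  rw [unaryTheta, hx, residueTheta_add_rat hP hc ⟨_, rfl⟩ _ _ (by simpa using hy)]
  refine (norm_sum_le _ _).trans ?_
  have hconst : ((2 * x.den : ℕ) * (C * (P : ℝ)⁻¹ ^ (-(1 / 4) : ℝ)) * y ^ (-(1 / 4) : ℝ) : ℝ) =
      ∑ _j ∈ Finset.range (2 * x.den), C * (P : ℝ)⁻¹ ^ (-(1 / 4) : ℝ) * y ^ (-(1 / 4) : ℝ) := by
    rw [Finset.sum_const, Finset.card_range, nsmul_eq_mul, mul_assoc]
  rw [hconst]
  refine Finset.sum_le_sum fun j _ => ?_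
  have h1 : (Real.pi * I * (((2 * x.num : ℤ) : ℂ) * ((r + P * j : ℤ) : ℂ) ^ 2 /
      (P * (2 * x.den : ℕ)))) = ((Real.pi * (((2 * x.num : ℤ) : ℝ) * ((r + P * j : ℤ) : ℝ) ^ 2 /
      (P * (2 * x.den : ℕ))) : ℝ) : ℂ) * I := by push_cast; ring
  have h2 : (y * I / P : ℂ) = I * (((P : ℝ)⁻¹ * y : ℝ) : ℂ) := by push_cast; ring
  rw [norm_mul, h1, Complex.norm_exp_ofReal_mul_I, one_mul, h2]
  refine (hC _ _ (by positivity)).trans_eq ?_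
  rw [Real.mul_rpow (by positivity) hy.le, mul_assoc]

/-- High up on the imaginary axis the term n = 1 dominates, all other n ≡ 1 modulo P having n² > 1
when P > 2. A nonzero value is needed to cancel the theta function when the cocycle relation of the
multiplier is derived. -/
theorem exists_unaryTheta_ne_zero {P : ℕ} (hP : 2 < P) :
    ∃ τ : ℂ, 0 < τ.im ∧ unaryTheta P 1 τ ≠ 0 := by
  by_contra! h
  have hP0 : 0 < P := by omega
  have hPR : (0 : ℝ) < P := by exact_mod_cast hP0
  have hPC : (P : ℂ) ≠ 0 := by exact_mod_cast hP0.ne'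
  have hzero : ∀ y : ℝ, 0 < y → residueTheta P 1 (y * I) = 0 := by
    intro y hy
    have := h (P * (y * I)) (by simp; positivity)
    rwa [unaryTheta, mul_div_cancel_left₀ _ hPC] at this
  obtain ⟨C, -, hC⟩ := exists_abs_mul_exp_bound
  let n : ℤ → ℤ := fun k => 1 + P * k
  have hn : ∀ k, k ≠ 0 → 1 < n k ^ 2 := by
    intro k hk
    have hP' : (3 : ℤ) ≤ P := by exact_mod_cast hP
    have : 1 < |n k| := by
      rcases lt_or_gt_of_ne hk with h | h
      · have : n k < -1 := by simp only [n]; nlinarith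
        exact lt_abs.2 (Or.inr (by linarith))
      · have : 1 < n k := by simp only [n]; nlinarith
        exact lt_abs.2 (Or.inl this)
    rw [← sq_abs]
    nlinarith
  have hn1 : ∀ k, 1 ≤ n k ^ 2 := by
    intro k
    rcases eq_or_ne k 0 with rfl | hk
    · simp [n]
    · exact (hn k hk).le
  -- The series with the leading exponential exp(-πy) divided out; its limit for y → ∞ is 1.
  let f : ℝ → ℤ → ℝ := fun y k => n k * Real.exp (-(Real.pi * ((n k : ℝ) ^ 2 - 1) * y))
  have hsum : Summable fun k : ℤ => Real.exp Real.pi *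
      (|(n k : ℝ)| * Real.exp (-(Real.pi * (n k : ℝ) ^ 2 * 1))) :=
    ((hC 1 one_pos).1.comp_injective (injective_add_mul hP0 1)).mul_left _
  have hlim : Filter.Tendsto (fun y => ∑' k, f y k) Filter.atTop
      (nhds (∑' k : ℤ, if k = 0 then (1 : ℝ) else 0)) := by
    refine tendsto_tsum_of_dominated_convergence hsum ?_ ?_
    · intro k
      by_cases hk : k = 0
      · subst hk
        simp [f, n]
      · simp only [f, hk, if_false]
        have h1 : 0 < Real.pi * ((n k : ℝ) ^ 2 - 1) := by
          have : (1 : ℝ) < (n k : ℝ) ^ 2 := by exact_mod_cast hn k hk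
          exact mul_pos Real.pi_pos (by linarith)
        have h2 : Filter.Tendsto (fun y : ℝ => Real.pi * ((n k : ℝ) ^ 2 - 1) * y) Filter.atTop
            Filter.atTop := Filter.Tendsto.const_mul_atTop h1 Filter.tendsto_id
        have h3 := (Real.tendsto_exp_neg_atTop_nhds_zero.comp h2).const_mul (n k : ℝ)
        rw [mul_zero] at h3
        exact h3
    · filter_upwards [Filter.eventually_ge_atTop 1] with y hy k
      rw [Real.norm_eq_abs, abs_mul, abs_of_pos (Real.exp_pos _), mul_left_comm, ← Real.exp_add]
      refine mul_le_mul_of_nonneg_left (Real.exp_le_exp.2 ?_) (abs_nonneg _)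
      have : (1 : ℝ) ≤ (n k : ℝ) ^ 2 := by exact_mod_cast hn1 k
      have h2 : 0 ≤ Real.pi * ((n k : ℝ) ^ 2 - 1) := mul_nonneg Real.pi_pos.le (by linarith)
      nlinarith
  have hf0 : ∀ y : ℝ, 0 < y → ∑' k, f y k = 0 := by
    intro y hy
    have h1 := hzero y hy
    have h2 : residueTheta P 1 (y * I) =
        ((Real.exp (-(Real.pi * y)) * ∑' k, f y k : ℝ) : ℂ) := by
      rw [residueTheta, ← tsum_mul_left, Complex.ofReal_tsum]
      refine tsum_congr fun k => ?_
      simp only [f, n]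
      push_cast
      rw [mul_left_comm (cexp _), ← Complex.exp_add]
      congr 2
      linear_combination (Real.pi * (1 + P * k) ^ 2 * y : ℂ) * I_sq
    rw [h2] at h1
    have h3 : Real.exp (-(Real.pi * y)) * ∑' k, f y k = 0 := by exact_mod_cast h1
    exact (mul_eq_zero.1 h3).resolve_left (Real.exp_ne_zero _)
  rw [tsum_ite_eq] at hlim
  have h0 : Filter.Tendsto (fun y => ∑' k, f y k) Filter.atTop (nhds 0) := by
    refine tendsto_const_nhds.congr' ?_
    filter_upwards [Filter.eventually_gt_atTop 0] with y hy
    rw [hf0 y hy]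
  exact zero_ne_one (tendsto_nhds_unique h0 hlim)

end Plumbing

/-! ### Branches of the square root, primitives, and boundary limits. -/

namespace Plumbing

open Complex MeasureTheory Filter Set Topology

/-! ### Square roots -/

theorem norm_cpow_half (z : ℂ) : ‖z ^ (1 / 2 : ℂ)‖ = ‖z‖ ^ (1 / 2 : ℝ) := by
  have : (1 / 2 : ℂ) = ((1 / 2 : ℝ) : ℂ) := by push_cast; rfl
  rw [this, Complex.norm_cpow_real]

theorem cpow_half_sq (z : ℂ) : z ^ (1 / 2 : ℂ) * z ^ (1 / 2 : ℂ) = z := by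
  rcases eq_or_ne z 0 with rfl | hz
  · simp
  · rw [← Complex.cpow_add _ _ hz]; norm_num

theorem ofReal_mul_cpow_half {r : ℝ} (hr : 0 < r) (z : ℂ) :
    ((r : ℂ) * z) ^ (1 / 2 : ℂ) = (r ^ (1 / 2 : ℝ) : ℝ) * z ^ (1 / 2 : ℂ) := by
  rcases eq_or_ne z 0 with rfl | hz
  · simp
  have hr0 : (r : ℂ) ≠ 0 := by exact_mod_cast hr.ne'
  rw [Complex.cpow_def_of_ne_zero (mul_ne_zero hr0 hz), Complex.cpow_def_of_ne_zero hz,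
    Complex.log_ofReal_mul hr hz, add_mul, Complex.exp_add, Real.rpow_def_of_pos hr]
  push_cast
  rfl

theorem ofReal_cpow_half {r : ℝ} (hr : 0 < r) :
    (r : ℂ) ^ (1 / 2 : ℂ) = (r ^ (1 / 2 : ℝ) : ℝ) := by
  simpa using ofReal_mul_cpow_half hr 1

theorem neg_cpow_half_of_im_pos {z : ℂ} (hz : 0 < z.im) :
    (-z) ^ (1 / 2 : ℂ) = -I * z ^ (1 / 2 : ℂ) := by
  have hz0 : z ≠ 0 := by rintro rfl; simp at hz
  have hI : -I = cexp (-(Real.pi / 2 * I)) := by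
    rw [Complex.exp_neg, Complex.exp_pi_div_two_mul_I, Complex.inv_I]
  rw [Complex.cpow_def_of_ne_zero (neg_ne_zero.2 hz0), Complex.cpow_def_of_ne_zero hz0,
    Complex.log, Complex.log, Complex.arg_neg_eq_arg_sub_pi_of_im_pos hz, norm_neg, hI,
    ← Complex.exp_add]
  congr 1
  push_cast
  ring

theorem neg_cpow_half_of_im_neg {z : ℂ} (hz : z.im < 0) :
    (-z) ^ (1 / 2 : ℂ) = I * z ^ (1 / 2 : ℂ) := by
  have := neg_cpow_half_of_im_pos (z := -z) (by simpa using hz)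
  rw [neg_neg] at this
  rw [this, ← mul_assoc]
  simp

theorem autFactor_half_of_pos {γ : SL(2, ℤ)} {x : ℝ}
    (h : 0 < (γ.1 1 0 : ℝ) * x + (γ.1 1 1 : ℝ)) :
    autFactor (1 / 2) γ x = (((γ.1 1 0 : ℝ) * x + (γ.1 1 1 : ℝ)) ^ (1 / 2 : ℝ) : ℝ) := by
  have e : ((1 / 2 : ℝ) : ℂ) = 1 / 2 := by push_cast; rfl
  rw [autFactor, e, ofReal_cpow_half h, Complex.conj_ofReal, ite_self]

theorem autFactor_half_of_neg {γ : SL(2, ℤ)} {x : ℝ}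
    (h : (γ.1 1 0 : ℝ) * x + (γ.1 1 1 : ℝ) < 0) :
    autFactor (1 / 2) γ x = (if 0 < γ.1 1 0 then -I else I) *
      ((-((γ.1 1 0 : ℝ) * x + (γ.1 1 1 : ℝ))) ^ (1 / 2 : ℝ) : ℝ) := by
  have e : ((1 / 2 : ℝ) : ℂ) = 1 / 2 := by push_cast; rfl
  have h1 : (((γ.1 1 0 : ℝ) * x + (γ.1 1 1 : ℝ) : ℝ) : ℂ) ^ (1 / 2 : ℂ) =
      I * ((-((γ.1 1 0 : ℝ) * x + (γ.1 1 1 : ℝ))) ^ (1 / 2 : ℝ) : ℝ) := by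
    set D := (γ.1 1 0 : ℝ) * x + (γ.1 1 1 : ℝ) with hD
    have h2 : (D : ℂ) = ((-D : ℝ) : ℂ) * (-1) := by push_cast; ring
    have h3 : (-1 : ℂ) ^ (1 / 2 : ℂ) = I := by
      rw [Complex.cpow_def_of_ne_zero (by simp), Complex.log_neg_one,
        mul_one_div, mul_div_right_comm, Complex.exp_pi_div_two_mul_I]
    rw [h2, ofReal_mul_cpow_half (by linarith), h3, mul_comm]
  rw [autFactor, e, h1]
  split_ifs <;> simp

theorem autFactor_neg_half (γ : SL(2, ℤ)) (x : ℝ) :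
    autFactor (-(1 / 2)) γ x = (autFactor (1 / 2) γ x)⁻¹ := by
  have e : ((-(1 / 2) : ℝ) : ℂ) = -((1 / 2 : ℝ) : ℂ) := by push_cast; rfl
  rw [autFactor, autFactor, e, Complex.cpow_neg]
  split_ifs <;> simp

theorem autFactor_half_ne_zero {γ : SL(2, ℤ)} {x : ℝ}
    (h : (γ.1 1 0 : ℝ) * x + (γ.1 1 1 : ℝ) ≠ 0) : autFactor (1 / 2) γ x ≠ 0 := by
  have e : ((1 / 2 : ℝ) : ℂ) = 1 / 2 := by push_cast; rfl
  have h' : (((γ.1 1 0 : ℝ) * x + (γ.1 1 1 : ℝ) : ℝ) : ℂ) ^ (1 / 2 : ℂ) ≠ 0 := by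
    rw [Ne, cpow_eq_zero_iff, not_and_or]
    left
    exact_mod_cast h
  rw [autFactor, e]
  split_ifs
  · simpa using h'
  · exact h'

/-- The square roots along the geodesic from `x` to `-d / c`. -/
theorem geodesic_cpow_half {γ : SL(2, ℤ)} {x : ℝ} {D : ℝ}
    (hDdef : D = (γ.1 1 0 : ℝ) * x + (γ.1 1 1 : ℝ)) (hc : γ.1 1 0 ≠ 0) (hD : D ≠ 0) {v : ℝ}
    (hv : 0 < v) :
    (v : ℂ) ^ (1 / 2 : ℂ) * (D * (1 - I * ((γ.1 1 0 : ℝ) * D * v : ℝ))⁻¹) ^ (1 / 2 : ℂ) *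
      autFactor (1 / 2) γ x =
    (((D ^ 2 * v : ℝ) : ℂ) * (1 - I * ((γ.1 1 0 : ℝ) * D * v : ℝ))⁻¹) ^ (1 / 2 : ℂ) := by
  set q : ℂ := 1 - I * ((γ.1 1 0 : ℝ) * D * v : ℝ) with hq
  have hqim : q.im = -((γ.1 1 0 : ℝ) * D * v) := by simp [hq]
  have hqre : q.re = 1 := by simp [hq]
  have hq0 : 0 < normSq q := normSq_pos.2 (by intro h; rw [h] at hqre; simp at hqre)
  have hqi : (q⁻¹).im = (γ.1 1 0 : ℝ) * D * v / normSq q := by rw [inv_im, hqim, neg_neg]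
  rw [ofReal_cpow_half hv, ofReal_mul_cpow_half (r := D ^ 2 * v) (by positivity),
    Real.mul_rpow (by positivity) hv.le]
  rcases lt_or_gt_of_ne hD with h | h
  · have h2 : (D ^ 2) ^ (1 / 2 : ℝ) = -D := by
      rw [← Real.sqrt_eq_rpow, Real.sqrt_sq_eq_abs, abs_of_neg h]
    have h3 : (((-D) ^ (1 / 2 : ℝ) : ℝ) : ℂ) * (((-D) ^ (1 / 2 : ℝ) : ℝ) : ℂ) = -D := by
      have := cpow_half_sq ((-D : ℝ) : ℂ)
      rw [ofReal_cpow_half (by linarith)] at this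
      rw [this]; push_cast; rfl
    -- The positive number -D is pulled out of the root. The remaining -q⁻¹ is not real, and the
    -- sign of cD decides on which side of the axis it lies; the resulting factor ±i cancels the ∓i
    -- in `autFactor`.
    have h4 : (D : ℂ) * q⁻¹ = ((-D : ℝ) : ℂ) * (-q⁻¹) := by push_cast; ring
    rw [autFactor_half_of_neg (by rw [← hDdef]; exact h), ← hDdef, h4,
      ofReal_mul_cpow_half (by linarith), h2]
    split_ifs with hc0
    · have hc0' : (0 : ℝ) < γ.1 1 0 := by exact_mod_cast hc0
      rw [neg_cpow_half_of_im_neg (by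
        rw [hqi]
        refine div_neg_of_neg_of_pos ?_ hq0
        nlinarith [mul_pos hc0' hv])]
      push_cast
      linear_combination (-I ^ 2 * (v ^ (1 / 2 : ℝ) : ℝ) * (q⁻¹) ^ (1 / 2 : ℂ)) * h3
        + D * (v ^ (1 / 2 : ℝ) : ℝ) * (q⁻¹) ^ (1 / 2 : ℂ) * I_sq
    · have hc0' : (γ.1 1 0 : ℝ) < 0 := by
        exact_mod_cast lt_of_le_of_ne (not_lt.1 hc0) hc
      rw [neg_cpow_half_of_im_pos (by
        rw [hqi]
        refine div_pos ?_ hq0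
        nlinarith [mul_pos_of_neg_of_neg hc0' h])]
      push_cast
      linear_combination (-I ^ 2 * (v ^ (1 / 2 : ℝ) : ℝ) * (q⁻¹) ^ (1 / 2 : ℂ)) * h3
        + D * (v ^ (1 / 2 : ℝ) : ℝ) * (q⁻¹) ^ (1 / 2 : ℂ) * I_sq
  · have h2 : (D ^ 2) ^ (1 / 2 : ℝ) = D := by
      rw [← Real.sqrt_eq_rpow, Real.sqrt_sq h.le]
    have h3 : ((D ^ (1 / 2 : ℝ) : ℝ) : ℂ) * ((D ^ (1 / 2 : ℝ) : ℝ) : ℂ) = D := by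
      have := cpow_half_sq (D : ℂ)
      rwa [ofReal_cpow_half h] at this
    rw [autFactor_half_of_pos (by rw [← hDdef]; exact h), ← hDdef, ofReal_mul_cpow_half h, h2]
    push_cast
    linear_combination ((v ^ (1 / 2 : ℝ) : ℝ) * (q⁻¹) ^ (1 / 2 : ℂ)) * h3

/-! ### Primitives and limits -/

/-- The Cayley transform carries the half-plane to the unit disc, on which holomorphic functions
have primitives. -/
theorem exists_primitive_upperHalfPlane {g : ℂ → ℂ} (hg : DifferentiableOn ℂ g {u | 0 < u.im}) :
    ∃ G : ℂ → ℂ, ∀ u : ℂ, 0 < u.im → HasDerivAt G (g u) u := by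
  have hball : ∀ z ∈ Metric.ball (0 : ℂ) 1, (1 - z) ≠ 0 ∧ 0 < (I * (1 + z) / (1 - z)).im := by
    intro z hz
    rw [mem_ball_zero_iff] at hz
    have h1 : (1 - z) ≠ 0 := by
      intro h
      rw [← sub_eq_zero.1 h] at hz
      simp at hz
    refine ⟨h1, ?_⟩
    have h2 : 0 < normSq (1 - z) := normSq_pos.2 h1
    have h3 : normSq z < 1 := by
      rw [normSq_eq_norm_sq]
      nlinarith [norm_nonneg z]
    rw [normSq_apply] at h3
    rw [Complex.div_im, ← sub_div]
    refine div_pos ?_ h2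
    simp
    nlinarith
  have hdiff : DifferentiableOn ℂ (fun z => g (I * (1 + z) / (1 - z)) * (2 * I / (1 - z) ^ 2))
      (Metric.ball 0 1) := by
    refine DifferentiableOn.mul (hg.comp ?_ fun z hz => (hball z hz).2) ?_
    · exact DifferentiableOn.div (by fun_prop) (by fun_prop) fun z hz => (hball z hz).1
    · exact DifferentiableOn.div (by fun_prop) (by fun_prop) fun z hz =>
        pow_ne_zero 2 (hball z hz).1
  obtain ⟨G, hG⟩ := hdiff.isExactOn_ball
  refine ⟨fun u => G ((u - I) / (u + I)), fun u hu => ?_⟩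
  have hu0 : u + I ≠ 0 := by
    intro h
    have := congrArg Complex.im h
    simp at this
    linarith
  have hmem : (u - I) / (u + I) ∈ Metric.ball (0 : ℂ) 1 := by
    rw [mem_ball_zero_iff, norm_div, div_lt_one (norm_pos_iff.2 hu0)]
    refine lt_of_pow_lt_pow_left₀ 2 (norm_nonneg _) ?_
    rw [← normSq_eq_norm_sq, ← normSq_eq_norm_sq, normSq_apply, normSq_apply]
    simp
    nlinarith
  have h1 : HasDerivAt (fun u : ℂ => (u - I) / (u + I)) (2 * I / (u + I) ^ 2) u := by
    have := ((hasDerivAt_id u).sub_const I).div ((hasDerivAt_id u).add_const I) hu0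
    refine this.congr_deriv ?_
    simp only [id]
    congr 1
    ring
  have h2 := (hG _ hmem).comp u h1
  refine h2.congr_deriv ?_
  have h3 : 1 - (u - I) / (u + I) = 2 * I / (u + I) := by field_simp; ring
  have h4 : I * (1 + (u - I) / (u + I)) / (1 - (u - I) / (u + I)) = u := by
    rw [h3]
    field_simp
    ring
  beta_reduce
  rw [h4, h3]
  field_simp

/-- This makes endpoint values available for a primitive whose integrand is singular at the
boundary; contour integrals can then be compared by comparing limits. -/
theorem exists_limits_of_hasDerivAt {F φ : ℝ → ℂ} (h : ∀ v, 0 < v → HasDerivAt F (φ v) v)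
    (hφ : IntegrableOn φ (Ioi 0)) : ∃ a b, Tendsto F (𝓝[>] 0) (𝓝 a) ∧ Tendsto F atTop (𝓝 b) ∧
      ∫ v in Ioi (0 : ℝ), φ v = b - a := by
  have hφ1 : IntegrableOn φ (Ioi 1) := hφ.mono_set (Ioi_subset_Ioi zero_le_one)
  have hφ0 : IntegrableOn φ (uIcc 0 1) := by
    rw [uIcc_of_le zero_le_one, integrableOn_Icc_iff_integrableOn_Ioc]
    exact hφ.mono_set Ioc_subset_Ioi_self
  have hb := tendsto_limUnder_of_hasDerivAt_of_integrableOn_Ioi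
    (fun v (hv : v ∈ Ioi (1 : ℝ)) => h v (lt_trans one_pos hv)) hφ1
  have h1 := integral_Ioi_of_hasDerivAt_of_tendsto'
    (fun v (hv : v ∈ Ici (1 : ℝ)) => h v (lt_of_lt_of_le one_pos hv)) hφ1 hb
  have h2 := (intervalIntegral.continuousOn_primitive_interval_left hφ0) 0 left_mem_uIcc
  have h3 : Tendsto (fun v => F 1 - ∫ t in v..1, φ t) (𝓝[>] 0) (𝓝 (F 1 - ∫ t in (0 : ℝ)..1, φ t)) :=
    tendsto_const_nhds.sub (h2.tendsto.mono_left (nhdsWithin_le_of_mem (by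
      rw [uIcc_of_le zero_le_one]; exact Icc_mem_nhdsGT one_pos)))
  refine ⟨_, _, h3.congr' ?_, hb, ?_⟩
  · filter_upwards [Ioo_mem_nhdsGT one_pos] with v hv
    rw [intervalIntegral.integral_eq_sub_of_hasDerivAt (f := F)]
    · ring
    · intro t ht
      rw [uIcc_of_le hv.2.le] at ht
      exact h t (hv.1.trans_le ht.1)
    · rw [intervalIntegrable_iff_integrableOn_Ioc_of_le hv.2.le]
      exact hφ.mono_set fun t ht => hv.1.trans ht.1
  · rw [← Ioc_union_Ioi_eq_Ioi zero_le_one, setIntegral_union (by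
      rw [Set.disjoint_left]
      exact fun t ht ht' => not_lt.2 ht.2 ht') measurableSet_Ioi
      (hφ.mono_set Ioc_subset_Ioi_self) hφ1, h1, intervalIntegral.integral_of_le zero_le_one]
    ring

end Plumbing

namespace Plumbing

open Complex MeasureTheory Filter Set Topology

/-! ### Eichler integrals -/

/-- Holomorphic functions on the upper half-plane with the growth of a weight `3 / 2` cusp form,
in a weak form that suffices for the convergence of Eichler integrals at the cusps. -/
structure HasCuspDecay (θ : ℂ → ℂ) : Prop where
  diff : DifferentiableOn ℂ θ {τ | 0 < τ.im}
  bound : ∃ C : ℝ, 0 < C ∧ ∀ τ : ℂ, 0 < τ.im → ‖θ τ‖ ≤ C * τ.im ^ (-(5 / 4) : ℝ)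
  cusp : ∀ x : ℚ, ∃ C : ℝ, 0 < C ∧
    ∀ y : ℝ, 0 < y → ‖θ (((x : ℝ) : ℂ) + y * I)‖ ≤ C * y ^ (-(1 / 4) : ℝ)

/-- A majorant for the integrands of Eichler integrals. -/
noncomputable def cuspWeight (v : ℝ) : ℝ :=
  if v ≤ 1 then v ^ (-(3 / 4) : ℝ) else v ^ (-(7 / 4) : ℝ)

/-- The Eichler integral `∫ θ(u) (-i (u - x)) ^ (-1/2) du`, up to a factor `i`, along the vertical
line above `κ`. -/
noncomputable def eichlerIntegral (θ : ℂ → ℂ) (κ x : ℝ) : ℂ :=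
  ∫ v in Ioi (0 : ℝ), θ (κ + v * I) * ((-I * (κ + v * I - x)) ^ (1 / 2 : ℂ))⁻¹

theorem integrableOn_cuspWeight : IntegrableOn cuspWeight (Ioi 0) := by
  rw [← Ioc_union_Ioi_eq_Ioi zero_le_one, integrableOn_union]
  constructor
  · have h : IntegrableOn (fun v : ℝ => v ^ (-(3 / 4) : ℝ)) (Ioc 0 1) := by
      have := intervalIntegral.intervalIntegrable_rpow' (a := 0) (b := 1)
        (by norm_num : (-1 : ℝ) < -(3 / 4))
      rwa [intervalIntegrable_iff_integrableOn_Ioc_of_le zero_le_one] at this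
    refine h.congr_fun (fun v hv => ?_) measurableSet_Ioc
    simp [cuspWeight, hv.2]
  · have h : IntegrableOn (fun v : ℝ => v ^ (-(7 / 4) : ℝ)) (Ioi 1) :=
      integrableOn_Ioi_rpow_of_lt (by norm_num) one_pos
    refine h.congr_fun (fun v hv => ?_) measurableSet_Ioi
    have hv' : 1 < v := hv
    simp [cuspWeight, not_le.2 hv']

/-- The cusp bound is used for v ≤ 1, the general bound for v > 1. The estimate is uniform in the
height shift t, so that it also dominates the limit x + it → x. -/
theorem HasCuspDecay.exists_bound {θ : ℂ → ℂ} (hθ : HasCuspDecay θ) (κ : ℚ) :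
    ∃ C : ℝ, 0 < C ∧ ∀ v t : ℝ, 0 < v → 0 ≤ t →
      ‖θ (((κ : ℝ) : ℂ) + (v + t : ℝ) * I)‖ * v ^ (-(1 / 2) : ℝ) ≤ C * cuspWeight v := by
  obtain ⟨C₁, h₁, hC₁⟩ := hθ.bound
  obtain ⟨C₂, h₂, hC₂⟩ := hθ.cusp κ
  refine ⟨max C₁ C₂, lt_max_of_lt_left h₁, fun v t hv ht => ?_⟩
  have hvt : 0 < v + t := by linarith
  have e1 : ‖θ (((κ : ℝ) : ℂ) + (v + t : ℝ) * I)‖ ≤ max C₁ C₂ * v ^ (-(5 / 4) : ℝ) := by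
    have h := hC₁ (((κ : ℝ) : ℂ) + (v + t : ℝ) * I) (by simpa using hvt)
    have him : (((κ : ℝ) : ℂ) + (v + t : ℝ) * I).im = v + t := by simp
    rw [him] at h
    refine h.trans (mul_le_mul (le_max_left _ _) ?_ (by positivity) (by positivity))
    exact Real.rpow_le_rpow_of_nonpos hv (by linarith) (by norm_num)
  have e2 : ‖θ (((κ : ℝ) : ℂ) + (v + t : ℝ) * I)‖ ≤ max C₁ C₂ * v ^ (-(1 / 4) : ℝ) := by
    refine (hC₂ _ hvt).trans (mul_le_mul (le_max_right _ _) ?_ (by positivity) (by positivity))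
    exact Real.rpow_le_rpow_of_nonpos hv (by linarith) (by norm_num)
  rw [cuspWeight]
  split_ifs with h
  · refine (mul_le_mul_of_nonneg_right e2 (by positivity)).trans_eq ?_
    rw [mul_assoc, ← Real.rpow_add hv]
    norm_num
  · refine (mul_le_mul_of_nonneg_right e1 (by positivity)).trans_eq ?_
    rw [mul_assoc, ← Real.rpow_add hv]
    norm_num

theorem neg_I_mul_sub_re (u : ℂ) (x : ℝ) : (-I * (u - x)).re = u.im := by simp

theorem norm_inv_cpow_half_le {z : ℂ} {v : ℝ} (hv : 0 < v) (hz : v ≤ ‖z‖) :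
    ‖(z ^ (1 / 2 : ℂ))⁻¹‖ ≤ v ^ (-(1 / 2) : ℝ) := by
  rw [norm_inv, norm_cpow_half, Real.rpow_neg hv.le]
  exact inv_anti₀ (by positivity) (Real.rpow_le_rpow hv.le hz (by norm_num))

theorem im_le_norm_neg_I_mul_sub (u : ℂ) (x : ℝ) : u.im ≤ ‖-I * (u - x)‖ := by
  rw [← neg_I_mul_sub_re u x]
  exact Complex.re_le_norm _

theorem differentiableOn_eichlerIntegrand {θ : ℂ → ℂ} (hθ : DifferentiableOn ℂ θ {τ | 0 < τ.im})
    (x : ℝ) : DifferentiableOn ℂ (fun u => θ u * ((-I * (u - x)) ^ (1 / 2 : ℂ))⁻¹)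
      {u | 0 < u.im} := by
  refine hθ.mul (DifferentiableOn.inv ?_ ?_)
  · refine DifferentiableOn.cpow_const (by fun_prop) fun u hu => ?_
    left
    rw [neg_I_mul_sub_re]
    exact hu
  · intro u hu h
    rw [cpow_eq_zero_iff] at h
    have hu' : 0 < u.im := hu
    rw [← neg_I_mul_sub_re u x, h.1] at hu'
    simp at hu'

theorem continuousOn_vertical {g : ℂ → ℂ} (hg : ContinuousOn g {u | 0 < u.im}) (κ : ℝ) :
    ContinuousOn (fun v : ℝ => g (κ + v * I)) (Ioi 0) := by
  refine hg.comp (by fun_prop) fun v hv => ?_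
  simpa using hv

theorem HasCuspDecay.integrableOn {θ : ℂ → ℂ} (hθ : HasCuspDecay θ) (κ : ℚ) (x : ℝ) :
    IntegrableOn (fun v : ℝ => θ ((κ : ℝ) + v * I) *
      ((-I * ((κ : ℝ) + v * I - x)) ^ (1 / 2 : ℂ))⁻¹) (Ioi 0) := by
  obtain ⟨C, -, hC⟩ := hθ.exists_bound κ
  refine Integrable.mono' (integrableOn_cuspWeight.const_mul C)
    ((continuousOn_vertical (differentiableOn_eichlerIntegrand hθ.diff x).continuousOn
      κ).aestronglyMeasurable measurableSet_Ioi) ?_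
  refine (ae_restrict_iff' measurableSet_Ioi).2 (Eventually.of_forall fun v hv => ?_)
  have hv' : 0 < v := hv
  have h1 := hC v 0 hv' le_rfl
  rw [add_zero] at h1
  rw [norm_mul]
  refine (mul_le_mul_of_nonneg_left (norm_inv_cpow_half_le hv' ?_) (norm_nonneg _)).trans h1
  have := im_le_norm_neg_I_mul_sub ((κ : ℝ) + v * I) x
  simpa using this

/-- Comparison of values of a primitive at points of the same height. -/
theorem exists_horizontal_bound {θ G : ℂ → ℂ} (hθ : HasCuspDecay θ) {x : ℝ}
    (hG : ∀ u : ℂ, 0 < u.im → HasDerivAt G (θ u * ((-I * (u - x)) ^ (1 / 2 : ℂ))⁻¹) u) :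
    ∃ C : ℝ, 0 < C ∧ ∀ η x₁ x₂ : ℝ, 0 < η →
      ‖G (x₁ + η * I) - G (x₂ + η * I)‖ ≤ C * η ^ (-(7 / 4) : ℝ) * |x₁ - x₂| := by
  obtain ⟨C, h0, hC⟩ := hθ.bound
  refine ⟨C, h0, fun η x₁ x₂ hη => ?_⟩
  have hconv : Convex ℝ {u : ℂ | u.im = η} := convex_hyperplane Complex.imLm.isLinear η
  have := hconv.norm_image_sub_le_of_norm_hasDerivWithin_le (f := G)
    (f' := fun u => θ u * ((-I * (u - x)) ^ (1 / 2 : ℂ))⁻¹) (C := C * η ^ (-(7 / 4) : ℝ))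
    (x := x₂ + η * I) (y := x₁ + η * I) (fun u hu => ?_) (fun u hu => ?_) (by simp) (by simp)
  · refine this.trans_eq ?_
    congr 1
    rw [add_sub_add_right_eq_sub, ← Complex.ofReal_sub, Complex.norm_real, Real.norm_eq_abs]
  · have hu' : u.im = η := hu
    exact (hG u (by rw [hu']; exact hη)).hasDerivWithinAt
  · have hu' : u.im = η := hu
    have h1 := hC u (by rw [hu']; exact hη)
    have h2 := norm_inv_cpow_half_le hη (hu' ▸ im_le_norm_neg_I_mul_sub u x)
    rw [hu'] at h1
    rw [norm_mul]
    refine (mul_le_mul h1 h2 (norm_nonneg _) (by positivity)).trans_eq ?_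
    rw [mul_assoc, ← Real.rpow_add hη]
    norm_num

/-- The obstruction to modularity of an Eichler integral is a period integral. -/
theorem HasCuspDecay.obstruction_eq {θ : ℂ → ℂ} (hθ : HasCuspDecay θ) {γ : SL(2, ℤ)}
    (hc : γ.1 1 0 ≠ 0) {w : ℂ} (hw : w ≠ 0)
    (htrans : ∀ τ : ℂ, 0 < τ.im → θ (moebius γ τ) =
      w * (((γ.1 1 0 : ℂ) * τ + γ.1 1 1) * ((γ.1 1 0 : ℂ) * τ + γ.1 1 1) ^ (1 / 2 : ℂ)) * θ τ)
    {x : ℚ} (hx : (γ.1 1 0 : ℚ) * x + γ.1 1 1 ≠ 0) :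
    eichlerIntegral θ x x - w⁻¹ * autFactor (-(1 / 2)) γ x *
      eichlerIntegral θ ((moebius γ x : ℚ) : ℝ) ((moebius γ x : ℚ) : ℝ) =
    eichlerIntegral θ ((-(γ.1 1 1 : ℚ) / (γ.1 1 0 : ℚ) : ℚ) : ℝ) x := by
  set κ : ℚ := -(γ.1 1 1 : ℚ) / (γ.1 1 0 : ℚ) with hκ
  set y : ℚ := moebius γ x with hy
  set c : ℝ := (γ.1 1 0 : ℝ) with hcdef
  set D : ℝ := c * x + (γ.1 1 1 : ℝ) with hDdef
  have hc0 : c ≠ 0 := by rw [hcdef]; exact_mod_cast hc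
  have hD0 : D ≠ 0 := by
    rw [hDdef, hcdef]
    exact_mod_cast hx
  have hκR : (κ : ℝ) = -(γ.1 1 1 : ℝ) / c := by rw [hκ]; push_cast; rfl
  have hyR : (y : ℝ) = ((γ.1 0 0 : ℝ) * x + γ.1 0 1) / D := by
    rw [hy, moebius]; push_cast; rfl
  have hxκ : (x : ℝ) - κ = D / c := by rw [hκR, hDdef]; field_simp; ring
  set g : ℂ → ℂ := fun u => θ u * ((-I * (u - (x : ℝ))) ^ (1 / 2 : ℂ))⁻¹ with hg
  -- One primitive is followed along three curves: the vertical lines above x and above κ = -d/c,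
  -- and the geodesic p(v) = γ⁻¹(γx + iv) from x to κ. The identity follows once its limits are seen
  -- to agree at each common endpoint, including infinity.
  obtain ⟨G, hG⟩ := exists_primitive_upperHalfPlane
    (differentiableOn_eichlerIntegrand hθ.diff (x : ℝ))
  obtain ⟨K, hK0, hK⟩ := exists_horizontal_bound hθ hG
  -- vertical lines
  have hvert : ∀ κ : ℚ, ∃ a b, Tendsto (fun v : ℝ => G ((κ : ℝ) + v * I)) (𝓝[>] 0) (𝓝 a) ∧
      Tendsto (fun v : ℝ => G ((κ : ℝ) + v * I)) atTop (𝓝 b) ∧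
      eichlerIntegral θ κ x * I = b - a := by
    intro κ
    obtain ⟨a, b, ha, hb, hab⟩ := exists_limits_of_hasDerivAt
      (F := fun v : ℝ => G ((κ : ℝ) + v * I)) (φ := fun v : ℝ => g ((κ : ℝ) + v * I) * I)
      (fun v hv => by
        have h1 : HasDerivAt (fun v : ℝ => (((κ : ℝ) : ℂ) + v * I)) (1 * I) v :=
          ((Complex.ofRealCLM.hasDerivAt (x := v)).mul_const I).const_add _
        rw [one_mul] at h1
        exact (hG _ (by simpa using hv)).comp v h1)
      ((hθ.integrableOn κ x).mul_const I)
    refine ⟨a, b, ha, hb, ?_⟩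
    rw [← hab, eichlerIntegral, integral_mul_const]
  obtain ⟨g₀, g₁, hg₀, hg₁, hgI⟩ := hvert x
  obtain ⟨k₀, k₁, hk₀, hk₁, hkI⟩ := hvert κ
  -- the geodesic
  set q : ℝ → ℂ := fun v => 1 - I * (c * D * v : ℝ) with hq
  have hqre : ∀ v, (q v).re = 1 := by intro v; simp [hq]
  have hq0 : ∀ v, q v ≠ 0 := by
    intro v h
    have := hqre v
    rw [h] at this
    simp at this
  set p : ℝ → ℂ := fun v => (x : ℝ) + I * ((D ^ 2 * v : ℝ) * (q v)⁻¹) with hp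
  set Y : ℝ → ℝ := fun v => D ^ 2 * v / (1 + c ^ 2 * D ^ 2 * v ^ 2) with hY
  have hden : ∀ v : ℝ, 0 < 1 + c ^ 2 * D ^ 2 * v ^ 2 := fun v => by positivity
  have hYpos : ∀ v : ℝ, 0 < v → 0 < Y v := fun v hv => div_pos (by positivity) (hden v)
  have hqinv : ∀ v, (q v)⁻¹ = (1 + I * (c * D * v : ℝ)) / (1 + c ^ 2 * D ^ 2 * v ^ 2 : ℝ) := by
    intro v
    have h1 : ((1 + c ^ 2 * D ^ 2 * v ^ 2 : ℝ) : ℂ) ≠ 0 := by exact_mod_cast (hden v).ne'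
    rw [eq_div_iff h1, inv_mul_eq_iff_eq_mul₀ (hq0 v), hq]
    push_cast
    linear_combination ((c * D * v) ^ 2 : ℂ) * I_sq
  have hpY : ∀ v, p v = ((x - c * D * v * Y v : ℝ) : ℂ) + (Y v : ℝ) * I := by
    intro v
    have h1 : ((1 + c ^ 2 * D ^ 2 * v ^ 2 : ℝ) : ℂ) ≠ 0 := by exact_mod_cast (hden v).ne'
    simp only [hp, hqinv, hY]
    push_cast at h1 ⊢
    field_simp
    linear_combination
      (D ^ 3 * c * v ^ 2 : ℂ) * (1 + (c : ℂ) ^ 2 * (D : ℂ) ^ 2 * (v : ℂ) ^ 2)⁻¹ * I_sq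
  have hpim : ∀ v, (p v).im = Y v := by intro v; rw [hpY]; simp
  have hcD : (c : ℂ) * (x : ℝ) + (γ.1 1 1 : ℂ) = D := by rw [hDdef]; push_cast; rfl
  have hdet : (γ.1 0 0 * γ.1 1 1 - γ.1 0 1 * γ.1 1 0 : ℂ) = 1 := by exact_mod_cast det_eq_one γ
  have hcC : (γ.1 1 0 : ℂ) = (c : ℝ) := by rw [hcdef]; push_cast; rfl
  have hDC : (D : ℂ) ≠ 0 := by exact_mod_cast hD0
  have hcp : ∀ v, (γ.1 1 0 : ℂ) * p v + γ.1 1 1 = D * (q v)⁻¹ := by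
    intro v
    have h1 := hq0 v
    rw [hcC]
    simp only [hp]
    field_simp
    rw [hq]
    push_cast
    linear_combination (1 - I * (c * D * v)) * hcD
  have hmoeb : ∀ v : ℝ, moebius γ (p v) = ((y : ℝ) : ℂ) + v * I := by
    intro v
    have h1 := hq0 v
    rw [moebius, hcp, hyR]
    simp only [hp]
    push_cast
    field_simp
    rw [hq]
    push_cast
    have e1 : (γ.1 0 0 : ℂ) * D - c * (γ.1 0 0 * (x : ℝ) + γ.1 0 1) = 1 := by
      rw [← hcC, ← hcD, ← hcC]
      linear_combination hdet
    push_cast at e1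
    linear_combination (v * I * D) * e1
  have hpderiv : ∀ v, HasDerivAt p (I * (D * (q v)⁻¹) ^ 2) v := by
    intro v
    have h1 : HasDerivAt q (-(I * (c * D : ℝ))) v := by
      have := ((((hasDerivAt_id v).const_mul (c * D)).ofReal_comp).const_mul I).const_sub 1
      simpa [hq] using this
    have h2 : HasDerivAt (fun v : ℝ => ((D ^ 2 * v : ℝ) : ℂ)) ((D ^ 2 : ℝ) : ℂ) v := by
      have := ((hasDerivAt_id v).const_mul (D ^ 2)).ofReal_comp
      simpa using this
    have h3 := ((h2.mul (h1.inv (hq0 v))).const_mul I).const_add (((x : ℝ) : ℂ))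
    refine h3.congr_deriv ?_
    have := hq0 v
    simp only [Pi.inv_apply]
    field_simp
    rw [hq]
    push_cast
    ring
  set J := autFactor (1 / 2) γ x with hJ
  have hJ0 : J ≠ 0 := autFactor_half_ne_zero (by rw [← hcdef, ← hDdef]; exact hD0)
  -- The pullback of the differential form to the geodesic: the weight 3/2 factor of θ, the
  -- derivative of p and the square root of the kernel leave the automorphy factor of weight 1/2.
  have hφ₃ : ∀ v : ℝ, 0 < v → g (p v) * (I * (D * (q v)⁻¹) ^ 2) =
      I * (w * J)⁻¹ * (θ ((y : ℝ) + v * I) *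
        ((-I * ((y : ℝ) + v * I - (y : ℝ))) ^ (1 / 2 : ℂ))⁻¹) := by
    intro v hv
    have h1 := htrans (p v) (by rw [hpim]; exact hYpos v hv)
    have h2 := geodesic_cpow_half hDdef hc hD0 hv
    rw [hmoeb, hcp] at h1
    have e1 : -I * (p v - (x : ℝ)) = ((D ^ 2 * v : ℝ) : ℂ) * (q v)⁻¹ := by
      simp only [hp]
      linear_combination (-((D ^ 2 * v : ℝ) : ℂ) * (q v)⁻¹) * I_sq
    have e2 : -I * (((y : ℝ) : ℂ) + v * I - (y : ℝ)) = v := by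
      linear_combination (-(v : ℂ)) * I_sq
    have hqq : q v = 1 - I * (((γ.1 1 0 : ℝ) * D * v : ℝ) : ℂ) := rfl
    rw [← hqq] at h2
    have e3 := cpow_half_sq (D * (q v)⁻¹)
    simp only [hg]
    rw [e1, e2, ← h2, h1]
    have hA : (D * (q v)⁻¹ : ℂ) ≠ 0 := mul_ne_zero hDC (inv_ne_zero (hq0 v))
    generalize (D * (q v)⁻¹ : ℂ) = A at *
    have hA2 : A ^ (1 / 2 : ℂ) ≠ 0 := by
      rw [Ne, cpow_eq_zero_iff]; exact fun h => hA h.1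
    have hv2 : (v : ℂ) ^ (1 / 2 : ℂ) ≠ 0 := by
      rw [Ne, cpow_eq_zero_iff]
      exact fun h => hv.ne' (by exact_mod_cast h.1)
    rw [← hJ]
    generalize A ^ (1 / 2 : ℂ) = B at *
    field_simp
    linear_combination (-θ (p v)) * e3
  obtain ⟨a₀, a₁, ha₀, ha₁, haI⟩ := exists_limits_of_hasDerivAt (F := fun v => G (p v))
    (φ := fun v => g (p v) * (I * (D * (q v)⁻¹) ^ 2))
    (fun v hv => (hG _ (by rw [hpim]; exact hYpos v hv)).comp v (hpderiv v))
    (IntegrableOn.congr_fun ((hθ.integrableOn y y).const_mul (I * (w * J)⁻¹))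
      (fun v hv => (hφ₃ v hv).symm) measurableSet_Ioi)
  have haI' : I * (w * J)⁻¹ * eichlerIntegral θ y y = a₁ - a₀ := by
    rw [← haI, eichlerIntegral, ← integral_const_mul]
    exact (setIntegral_congr_fun measurableSet_Ioi fun v hv => hφ₃ v hv).symm
  -- the three gluings
  have hgk : g₁ = k₁ := by
    have h1 : Tendsto (fun v : ℝ => K * v ^ (-(7 / 4) : ℝ) * |(x : ℝ) - κ|) atTop (𝓝 0) := by
      have := ((tendsto_rpow_neg_atTop (by norm_num : (0 : ℝ) < 7 / 4)).const_mul K).mul_const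
        |(x : ℝ) - κ|
      simpa using this
    have h2 := squeeze_zero_norm' (f := fun v : ℝ => G ((x : ℝ) + v * I) - G ((κ : ℝ) + v * I))
      (by filter_upwards [eventually_gt_atTop 0] with v hv using hK v x κ hv) h1
    exact sub_eq_zero.1 (tendsto_nhds_unique (hg₁.sub hk₁) h2)
  have hYbound : ∀ v, 0 < v → Y v ≤ D ^ 2 * v := fun v hv =>
    div_le_self (by positivity) (by have : 0 ≤ c ^ 2 * D ^ 2 * v ^ 2 := by positivity
                                    linarith)
  have hYpow : ∀ v, 0 < v → Y v ^ (-(7 / 4) : ℝ) * Y v = Y v ^ (-(3 / 4) : ℝ) := by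
    intro v hv
    conv_lhs => rw [← Real.rpow_one (Y v), ← Real.rpow_mul (hYpos v hv).le,
      ← Real.rpow_add (hYpos v hv)]
    norm_num
  -- Near x the geodesic is at horizontal distance |cD|vY from the vertical line, and Y is
  -- comparable to v; the horizontal bound Y^(-7/4) times this distance is O(v^(1/4)).
  have hga : g₀ = a₀ := by
    have hY0 : Tendsto Y (𝓝[>] 0) (𝓝[>] 0) := by
      refine tendsto_nhdsWithin_iff.2 ⟨?_, ?_⟩
      · have h1 : ContinuousAt Y 0 := by
          refine ContinuousAt.div (by fun_prop) (by fun_prop) (hden 0).ne'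
        have h2 : Y 0 = 0 := by simp [hY]
        have h3 := h1.tendsto
        rw [h2] at h3
        exact h3.mono_left nhdsWithin_le_nhds
      · filter_upwards [self_mem_nhdsWithin] with v hv using hYpos v hv
    set K' : ℝ := K * |c * D| * (D ^ 2 / 2) ^ (-(3 / 4) : ℝ) with hK'
    have h1 : Tendsto (fun v : ℝ => K' * v ^ (1 / 4 : ℝ)) (𝓝[>] 0) (𝓝 0) := by
      have h : ContinuousAt (fun v : ℝ => K' * v ^ (1 / 4 : ℝ)) 0 :=
        continuousAt_const.mul (Real.continuousAt_rpow_const _ _ (Or.inr (by norm_num)))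
      have := h.tendsto.mono_left (nhdsWithin_le_nhds (s := Ioi 0))
      simpa using this
    have hev : ∀ᶠ v : ℝ in 𝓝[>] 0, 0 < v ∧ c ^ 2 * D ^ 2 * v ^ 2 ≤ 1 := by
      have h : ContinuousAt (fun v : ℝ => c ^ 2 * D ^ 2 * v ^ 2) 0 := by fun_prop
      have h2 := (h.tendsto.mono_left (nhdsWithin_le_nhds (s := Ioi 0))).eventually_le_const
        (by simp : (c ^ 2 * D ^ 2 * 0 ^ 2 : ℝ) < 1)
      filter_upwards [self_mem_nhdsWithin, h2] with v hv hv2 using ⟨hv, hv2⟩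
    have h2 := squeeze_zero_norm'
      (f := fun v : ℝ => G (p v) - G ((x : ℝ) + (Y v : ℝ) * I)) (by
        filter_upwards [hev] with v ⟨hv, hv1⟩
        rw [hpY]
        refine (hK (Y v) _ _ (hYpos v hv)).trans ?_
        have e1 : |(x - c * D * v * Y v : ℝ) - x| = |c * D| * v * Y v := by
          rw [sub_sub_cancel_left, abs_neg, abs_mul, abs_mul (c * D), abs_of_pos hv,
            abs_of_pos (hYpos v hv)]
        have e2 : D ^ 2 / 2 * v ≤ Y v := by
          rw [hY]
          rw [le_div_iff₀ (hden v)]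
          have : 0 ≤ D ^ 2 / 2 * v := by positivity
          nlinarith
        have e3 : Y v ^ (-(3 / 4) : ℝ) ≤ (D ^ 2 / 2 * v) ^ (-(3 / 4) : ℝ) :=
          Real.rpow_le_rpow_of_nonpos (by positivity) e2 (by norm_num)
        rw [e1]
        calc K * Y v ^ (-(7 / 4) : ℝ) * (|c * D| * v * Y v)
            = K * |c * D| * v * (Y v ^ (-(7 / 4) : ℝ) * Y v) := by ring
          _ ≤ K * |c * D| * v * (D ^ 2 / 2 * v) ^ (-(3 / 4) : ℝ) := by
              rw [hYpow v hv]
              exact mul_le_mul_of_nonneg_left e3 (by positivity)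
          _ = K' * (v ^ (1 : ℝ) * v ^ (-(3 / 4) : ℝ)) := by
              rw [hK', Real.mul_rpow (by positivity) hv.le, Real.rpow_one]; ring
          _ = K' * v ^ (1 / 4 : ℝ) := by
              rw [← Real.rpow_add hv]; norm_num) h1
    exact (sub_eq_zero.1 (tendsto_nhds_unique (ha₀.sub (hg₀.comp hY0)) h2)).symm
  -- Near κ the height Y is comparable to 1/v and the horizontal distance is Y/(|cD|v), so the
  -- difference is O(v^(-1/4)).
  have hka : k₀ = a₁ := by
    have hYle : ∀ v, 0 < v → Y v ≤ (c ^ 2)⁻¹ * v⁻¹ := by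
      intro v hv
      rw [hY, div_le_iff₀ (hden v)]
      have : (c ^ 2)⁻¹ * v⁻¹ * (1 + c ^ 2 * D ^ 2 * v ^ 2) = (c ^ 2)⁻¹ * v⁻¹ + D ^ 2 * v := by
        field_simp
      rw [this]
      have : 0 ≤ (c ^ 2)⁻¹ * v⁻¹ := by positivity
      linarith
    have hY0 : Tendsto Y atTop (𝓝[>] 0) := by
      refine tendsto_nhdsWithin_iff.2 ⟨?_, ?_⟩
      · have h := tendsto_inv_atTop_zero.const_mul (c ^ 2)⁻¹
        rw [mul_zero] at h
        refine squeeze_zero' ?_ ?_ h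
        · filter_upwards [eventually_gt_atTop 0] with v hv using (hYpos v hv).le
        · filter_upwards [eventually_gt_atTop 0] with v hv using hYle v hv
      · filter_upwards [eventually_gt_atTop 0] with v hv using hYpos v hv
    set K' : ℝ := K * |c * D|⁻¹ * (c ^ 2 * 2)⁻¹ ^ (-(3 / 4) : ℝ) with hK'
    have h1 : Tendsto (fun v : ℝ => K' * v ^ (-(1 / 4) : ℝ)) atTop (𝓝 0) := by
      have := (tendsto_rpow_neg_atTop (by norm_num : (0 : ℝ) < 1 / 4)).const_mul K'
      simpa using this
    have hev : ∀ᶠ v : ℝ in atTop, 0 < v ∧ 1 ≤ c ^ 2 * D ^ 2 * v ^ 2 := by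
      have h2 : Tendsto (fun v : ℝ => c ^ 2 * D ^ 2 * v ^ 2) atTop atTop :=
        (tendsto_pow_atTop two_ne_zero).const_mul_atTop (by positivity)
      filter_upwards [eventually_gt_atTop 0, h2.eventually_ge_atTop 1] with v hv hv2 using ⟨hv, hv2⟩
    have h2 := squeeze_zero_norm'
      (f := fun v : ℝ => G (p v) - G ((κ : ℝ) + (Y v : ℝ) * I)) (by
        filter_upwards [hev] with v ⟨hv, hv1⟩
        rw [hpY]
        refine (hK (Y v) _ _ (hYpos v hv)).trans ?_
        have e0 : (x - c * D * v * Y v : ℝ) - κ = Y v * (c * D * v)⁻¹ := by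
          rw [sub_right_comm, hxκ, hY]
          have := (hden v).ne'
          field_simp
          ring
        have e1 : |(x - c * D * v * Y v : ℝ) - κ| = |c * D|⁻¹ * v⁻¹ * Y v := by
          rw [e0, abs_mul, abs_inv, abs_mul (c * D), abs_of_pos hv, abs_of_pos (hYpos v hv)]
          rw [mul_inv]
          ring
        have e2 : (c ^ 2 * 2)⁻¹ * v⁻¹ ≤ Y v := by
          rw [hY]
          rw [le_div_iff₀ (hden v)]
          have e3 : (c ^ 2 * 2)⁻¹ * v⁻¹ * (1 + c ^ 2 * D ^ 2 * v ^ 2) =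
            (c ^ 2 * 2)⁻¹ * v⁻¹ + D ^ 2 * v / 2 := by field_simp
          have e4 : (c ^ 2 * 2)⁻¹ * v⁻¹ ≤ D ^ 2 * v / 2 := by
            rw [← mul_inv, inv_le_iff_one_le_mul₀ (by positivity)]
            nlinarith
          rw [e3]
          linarith
        have e3 : Y v ^ (-(3 / 4) : ℝ) ≤ ((c ^ 2 * 2)⁻¹ * v⁻¹) ^ (-(3 / 4) : ℝ) :=
          Real.rpow_le_rpow_of_nonpos (by positivity) e2 (by norm_num)
        rw [e1]
        calc K * Y v ^ (-(7 / 4) : ℝ) * (|c * D|⁻¹ * v⁻¹ * Y v)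
            = K * |c * D|⁻¹ * v⁻¹ * (Y v ^ (-(7 / 4) : ℝ) * Y v) := by ring
          _ ≤ K * |c * D|⁻¹ * v⁻¹ * ((c ^ 2 * 2)⁻¹ * v⁻¹) ^ (-(3 / 4) : ℝ) := by
              rw [hYpow v hv]
              exact mul_le_mul_of_nonneg_left e3 (by positivity)
          _ = K' * (v⁻¹ ^ (1 : ℝ) * v⁻¹ ^ (-(3 / 4) : ℝ)) := by
              rw [hK', Real.mul_rpow (by positivity) (by positivity), Real.rpow_one]; ring
          _ = K' * v ^ (-(1 / 4) : ℝ) := by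
              rw [← Real.rpow_add (by positivity), Real.inv_rpow hv.le, ← Real.rpow_neg hv.le]
              norm_num) h1
    exact (sub_eq_zero.1 (tendsto_nhds_unique (ha₁.sub (hk₀.comp hY0)) h2)).symm
  rw [autFactor_neg_half, ← hJ]
  apply mul_right_cancel₀ I_ne_zero
  rw [sub_mul, hgI, hkI]
  have : w⁻¹ * J⁻¹ * eichlerIntegral θ y y * I = a₁ - a₀ := by rw [← haI', mul_inv]; ring
  rw [this, hgk, hga, hka]
  ring

end Plumbing

/-! ### Analyticity of period integrals, and false theta functions as Eichler integrals. -/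

namespace Plumbing

open Complex MeasureTheory Filter Set Topology

/-- Eichler integrals along a vertical line are real-analytic off its foot. -/
theorem HasCuspDecay.analyticOnNhd {θ : ℂ → ℂ} (hθ : HasCuspDecay θ) (κ : ℚ) :
    AnalyticOnNhd ℝ (fun x : ℝ => eichlerIntegral θ κ x) {x | x ≠ κ} := by
  intro x₀ hx₀
  have hx₀' : x₀ - κ ≠ 0 := sub_ne_zero.2 hx₀
  set r : ℝ := |x₀ - κ| / 2 with hr
  have hr0 : 0 < r := by positivity
  obtain ⟨C, hC0, hC⟩ := hθ.exists_bound κ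
  let W : ℂ → ℝ → ℂ := fun z v => -I * ((κ : ℝ) + v * I - z)
  have hWre : ∀ z v, (W z v).re = v - z.im := by intro z v; simp [W]
  have hWim : ∀ z v, (W z v).im = z.re - κ := by intro z v; simp [W]
  -- For complex z close to x₀ the base of the power has imaginary part Re z - κ, bounded away from
  -- 0. So it stays off the branch cut, and the integral depends holomorphically on z.
  have hball : ∀ z ∈ Metric.ball (x₀ : ℂ) r, ∀ v : ℝ, 0 < v →
      W z v ∈ slitPlane ∧ r ≤ ‖W z v‖ ∧ v / 2 ≤ ‖W z v‖ := by
    intro z hz v hv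
    rw [mem_ball_iff_norm] at hz
    have h1 : |z.re - x₀| < r := by
      have := Complex.abs_re_le_norm (z - x₀)
      simp only [sub_re, ofReal_re] at this
      linarith
    have h2 : |z.im| < r := by
      have := Complex.abs_im_le_norm (z - x₀)
      simp only [sub_im, ofReal_im, sub_zero] at this
      linarith
    have h3 : r ≤ |z.re - κ| := by
      have h4 : |x₀ - κ| ≤ |z.re - x₀| + |z.re - κ| := by
        rw [abs_sub_comm z.re x₀]; exact abs_sub_le _ _ _
      have : |x₀ - κ| = 2 * r := by rw [hr]; ring
      linarith
    have h5 : r ≤ ‖W z v‖ := by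
      have := Complex.abs_im_le_norm (W z v)
      rw [hWim] at this
      linarith
    refine ⟨Or.inr ?_, h5, ?_⟩
    · rw [hWim]
      intro h
      rw [h, abs_zero] at h3
      linarith
    · have := Complex.re_le_norm (W z v)
      rw [hWre] at this
      have := (abs_lt.1 h2).2
      linarith
  have hdiff : ∀ z ∈ Metric.ball (x₀ : ℂ) r, HasDerivAt
      (fun z => ∫ v in Ioi (0 : ℝ), θ ((κ : ℝ) + v * I) * (W z v) ^ (-(1 / 2) : ℂ))
      (∫ v in Ioi (0 : ℝ), θ ((κ : ℝ) + v * I) * (-(1 / 2) * (W z v) ^ (-(1 / 2) - 1 : ℂ) * I)) z := by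
    intro z hz
    have hcontθ := continuousOn_vertical hθ.diff.continuousOn κ
    have hcont : ∀ z ∈ Metric.ball (x₀ : ℂ) r, ∀ e : ℂ,
        ContinuousOn (fun v : ℝ => (W z v) ^ e) (Ioi 0) := by
      intro z hz e
      refine ContinuousOn.cpow_const (by fun_prop) fun v hv => (hball z hz v hv).1
    have hpow : ∀ v : ℝ, 0 < v → ∀ u : ℂ, v / 2 ≤ ‖u‖ →
        ‖u ^ (-(1 / 2) : ℂ)‖ ≤ 2 ^ (1 / 2 : ℝ) * v ^ (-(1 / 2) : ℝ) := by
      intro v hv u hu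
      have e : (-(1 / 2) : ℂ) = ((-(1 / 2) : ℝ) : ℂ) := by push_cast; rfl
      rw [e, Complex.norm_cpow_real]
      refine (Real.rpow_le_rpow_of_nonpos (by positivity) hu (by norm_num)).trans_eq ?_
      rw [div_eq_mul_inv, Real.mul_rpow hv.le (by norm_num), Real.inv_rpow (by norm_num),
        ← Real.rpow_neg (by norm_num), neg_neg, mul_comm]
    have hθb : ∀ v : ℝ, 0 < v → ‖θ ((κ : ℝ) + v * I)‖ * v ^ (-(1 / 2) : ℝ) ≤ C * cuspWeight v := by
      intro v hv
      have := hC v 0 hv le_rfl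
      rwa [add_zero] at this
    refine (hasDerivAt_integral_of_dominated_loc_of_deriv_le (μ := volume.restrict (Ioi 0))
      (F := fun z v => θ ((κ : ℝ) + v * I) * (W z v) ^ (-(1 / 2) : ℂ))
      (F' := fun z v => θ ((κ : ℝ) + v * I) * (-(1 / 2) * (W z v) ^ (-(1 / 2) - 1 : ℂ) * I))
      (bound := fun v => 2 ^ (1 / 2 : ℝ) * r⁻¹ * (C * cuspWeight v)) (Metric.isOpen_ball.mem_nhds hz)
      ?_ ?_ ?_ ?_ ?_ ?_).2
    · filter_upwards [Metric.isOpen_ball.mem_nhds hz] with z hz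
      exact (hcontθ.mul (hcont z hz _)).aestronglyMeasurable measurableSet_Ioi
    · refine Integrable.mono' ((integrableOn_cuspWeight.const_mul C).const_mul (2 ^ (1 / 2 : ℝ)))
        ((hcontθ.mul (hcont z hz _)).aestronglyMeasurable measurableSet_Ioi) ?_
      refine (ae_restrict_iff' measurableSet_Ioi).2 (Eventually.of_forall fun v hv => ?_)
      have h1 := hpow v hv (W z v) (hball z hz v hv).2.2
      rw [norm_mul]
      refine (mul_le_mul_of_nonneg_left h1 (norm_nonneg _)).trans ?_
      have := mul_le_mul_of_nonneg_left (hθb v hv) (by positivity : (0 : ℝ) ≤ 2 ^ (1 / 2 : ℝ))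
      linarith
    · exact (hcontθ.mul ((continuousOn_const.mul (hcont z hz _)).mul
        continuousOn_const)).aestronglyMeasurable measurableSet_Ioi
    · refine (ae_restrict_iff' measurableSet_Ioi).2 (Eventually.of_forall fun v hv z hz => ?_)
      obtain ⟨hs, hr', hv'⟩ := hball z hz v hv
      have h1 := hpow v hv (W z v) hv'
      have hW0 : W z v ≠ 0 := slitPlane_ne_zero hs
      rw [Complex.cpow_sub _ _ hW0, Complex.cpow_one, norm_mul, norm_mul, norm_mul, norm_I, mul_one,
        norm_div]
      have h2 : ‖W z v‖⁻¹ ≤ r⁻¹ := inv_anti₀ hr0 hr'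
      have h3 : ‖(-(1 / 2) : ℂ)‖ ≤ 1 := by norm_num
      have h4 : ‖W z v ^ (-(1 / 2) : ℂ)‖ / ‖W z v‖ ≤
          2 ^ (1 / 2 : ℝ) * v ^ (-(1 / 2) : ℝ) * r⁻¹ := by
        rw [div_eq_mul_inv]
        exact mul_le_mul h1 h2 (by positivity) (by have : 0 < v := hv; positivity)
      have h5 : ‖(-(1 / 2) : ℂ)‖ * (‖W z v ^ (-(1 / 2) : ℂ)‖ / ‖W z v‖) ≤
          2 ^ (1 / 2 : ℝ) * v ^ (-(1 / 2) : ℝ) * r⁻¹ := by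
        refine le_trans ?_ h4
        exact mul_le_of_le_one_left (by positivity) h3
      refine (mul_le_mul_of_nonneg_left h5 (norm_nonneg _)).trans ?_
      have := mul_le_mul_of_nonneg_left (hθb v hv)
        (by positivity : (0 : ℝ) ≤ 2 ^ (1 / 2 : ℝ) * r⁻¹)
      linarith
    · exact (integrableOn_cuspWeight.const_mul C).const_mul _
    · refine (ae_restrict_iff' measurableSet_Ioi).2 (Eventually.of_forall fun v hv z hz => ?_)
      have h1 : HasDerivAt (fun z : ℂ => W z v) I z := by
        have := ((hasDerivAt_id z).const_sub (((κ : ℝ) : ℂ) + v * I)).const_mul (-I)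
        simpa [W] using this
      exact (h1.cpow_const (hball z hz v hv).1).const_mul _
  have hA : AnalyticAt ℂ
      (fun z => ∫ v in Ioi (0 : ℝ), θ ((κ : ℝ) + v * I) * (W z v) ^ (-(1 / 2) : ℂ)) (x₀ : ℂ) :=
    DifferentiableOn.analyticAt (s := Metric.ball (x₀ : ℂ) r)
      (fun z hz => (hdiff z hz).differentiableAt.differentiableWithinAt)
      (Metric.ball_mem_nhds _ hr0)
  have hB := (hA.restrictScalars (𝕜 := ℝ)).comp (Complex.ofRealCLM.analyticAt x₀)
  refine hB.congr (Eventually.of_forall fun x => ?_)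
  simp only [Function.comp, eichlerIntegral, W, Complex.cpow_neg]

/-! ### False theta functions as Eichler integrals -/

/-- The false theta function `∑ sgn(n) exp (π i n² σ)`, the sum being over `n ≡ g` modulo `L`. -/
noncomputable def signTheta (L : ℕ) (g : ℤ) (σ : ℂ) : ℂ :=
  ∑' k : ℤ, ((g + L * k).sign : ℂ) * cexp (Real.pi * I * ((g + L * k : ℤ) : ℂ) ^ 2 * σ)

theorem summable_exp_neg_sq {L : ℕ} (hL : 0 < L) (g : ℤ) {y : ℝ} (hy : 0 < y) :
    Summable fun k : ℤ => Real.exp (-(Real.pi * ((g + L * k : ℤ) : ℝ) ^ 2 * y)) := by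
  have h : Summable fun n : ℤ => Real.exp (-(Real.pi * (n : ℝ) ^ 2 * y)) := by
    obtain ⟨C, -, hC⟩ := exists_abs_mul_exp_bound
    refine Summable.of_norm_bounded_eventually (hC y hy).1 ?_
    rw [Int.cofinite_eq, eventually_sup]
    constructor
    · filter_upwards [eventually_le_atBot (-1)] with n hn
      rw [Real.norm_eq_abs, Real.abs_exp]
      refine le_mul_of_one_le_left (by positivity) ?_
      rw [← Int.cast_abs]
      exact_mod_cast Int.one_le_abs (by omega)
    · filter_upwards [eventually_ge_atTop 1] with n hn
      rw [Real.norm_eq_abs, Real.abs_exp]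
      refine le_mul_of_one_le_left (by positivity) ?_
      rw [← Int.cast_abs]
      exact_mod_cast Int.one_le_abs (by omega)
  exact h.comp_injective (injective_add_mul hL g)

theorem norm_exp_sq (n : ℤ) (σ : ℂ) : ‖cexp (Real.pi * I * (n : ℂ) ^ 2 * σ)‖ =
    Real.exp (-(Real.pi * (n : ℝ) ^ 2 * σ.im)) := by
  rw [Complex.norm_exp]
  congr 1
  have : (Real.pi * I * (n : ℂ) ^ 2 * σ) = ((Real.pi * n ^ 2 : ℝ) : ℂ) * (I * σ) := by
    push_cast; ring
  rw [this, Complex.re_ofReal_mul]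
  simp

theorem norm_intSign_le (n : ℤ) : ‖((n.sign : ℤ) : ℂ)‖ ≤ 1 := by
  rcases lt_trichotomy n 0 with h | rfl | h
  · simp [Int.sign_eq_neg_one_of_neg h]
  · simp
  · simp [Int.sign_eq_one_of_pos h]

theorem summable_signTheta {L : ℕ} (hL : 0 < L) (g : ℤ) {σ : ℂ} (hσ : 0 < σ.im) :
    Summable fun k : ℤ =>
      ((g + L * k).sign : ℂ) * cexp (Real.pi * I * ((g + L * k : ℤ) : ℂ) ^ 2 * σ) := by
  refine Summable.of_norm_bounded (summable_exp_neg_sq hL g hσ) fun k => ?_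
  rw [norm_mul, norm_exp_sq]
  exact mul_le_of_le_one_left (by positivity) (norm_intSign_le _)

theorem integral_exp_mul_rpow {a : ℝ} (ha : 0 < a) :
    IntegrableOn (fun v : ℝ => Real.exp (-(a * v)) * v ^ (-(1 / 2) : ℝ)) (Ioi 0) ∧
    ∫ v in Ioi (0 : ℝ), Real.exp (-(a * v)) * v ^ (-(1 / 2) : ℝ) = (Real.pi / a) ^ (1 / 2 : ℝ) := by
  have h := Real.integral_rpow_mul_exp_neg_mul_Ioi (a := 1 / 2) (r := a) (by norm_num) ha
  rw [Real.Gamma_one_half_eq, Real.sqrt_eq_rpow, ← Real.mul_rpow (by positivity) (by positivity)] at h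
  have e : ((1 / 2 : ℝ) - 1) = -(1 / 2) := by norm_num
  rw [e] at h
  have h' : ∫ v in Ioi (0 : ℝ), Real.exp (-(a * v)) * v ^ (-(1 / 2) : ℝ) =
      (Real.pi / a) ^ (1 / 2 : ℝ) := by
    rw [show Real.pi / a = 1 / a * Real.pi by ring, ← h]
    exact integral_congr_ae (Eventually.of_forall fun v => mul_comm _ _)
  refine ⟨?_, h'⟩
  -- A non-integrable function would have integral 0 by convention, but the value found is positive.
  by_contra hn
  rw [integral_undef hn] at h'
  have : 0 < (Real.pi / a) ^ (1 / 2 : ℝ) := by positivity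
  linarith

theorem hasCuspDecay_unaryTheta {P : ℕ} (hP : 0 < P) (r : ℤ) : HasCuspDecay (unaryTheta P r) where
  diff := differentiableOn_unaryTheta hP r
  bound := by
    obtain ⟨C, h0, hC⟩ := exists_norm_unaryTheta_le hP
    exact ⟨C, h0, hC r⟩
  cusp x := by
    obtain ⟨C, h0, hC⟩ := exists_norm_unaryTheta_cusp_le hP r x
    exact ⟨C, h0, fun y hy => by rw [Complex.ofReal_ratCast]; exact hC y hy⟩

/-- Term by term, ∫ exp(-πn²v/P) v^(-1/2) dv = √P/|n| converts the coefficient n into sgn(n). The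
term n = 0 vanishes on both sides. -/
theorem integral_unaryTheta {P : ℕ} (hP : 0 < P) (r : ℤ) {τ : ℂ} (hτ : 0 < τ.im) :
    ∫ v in Ioi (0 : ℝ), unaryTheta P r (τ + v * I) * ((v ^ (-(1 / 2) : ℝ) : ℝ) : ℂ) =
      ((P : ℝ) ^ (1 / 2 : ℝ) : ℝ) * signTheta P r (τ / P) := by
  have hPR : (0 : ℝ) < P := by exact_mod_cast hP
  have hPC : (P : ℂ) ≠ 0 := by exact_mod_cast hP.ne'
  let n : ℤ → ℤ := fun k => r + P * k
  let F : ℤ → ℝ → ℂ := fun k v => ((n k : ℂ) * cexp (Real.pi * I * (n k : ℂ) ^ 2 * (τ / P))) *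
    ((Real.exp (-(Real.pi * (n k : ℝ) ^ 2 / P * v)) * v ^ (-(1 / 2) : ℝ) : ℝ) : ℂ)
  have hF : ∀ v : ℝ, unaryTheta P r (τ + v * I) * ((v ^ (-(1 / 2) : ℝ) : ℝ) : ℂ) =
      ∑' k, F k v := by
    intro v
    rw [unaryTheta, residueTheta, ← tsum_mul_right]
    refine tsum_congr fun k => ?_
    simp only [F, n]
    rw [Complex.ofReal_mul, ← mul_assoc]
    congr 1
    rw [mul_assoc ((r + P * k : ℤ) : ℂ), Complex.ofReal_exp, ← Complex.exp_add]
    congr 2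
    push_cast
    field_simp
    linear_combination (r + P * k : ℂ) ^ 2 * v * I_sq
  have hpos : ∀ k, n k ≠ 0 → 0 < Real.pi * (n k : ℝ) ^ 2 / P := by
    intro k hk
    have : (n k : ℝ) ≠ 0 := by exact_mod_cast hk
    positivity
  have hsq : ∀ k, n k ≠ 0 → (Real.pi / (Real.pi * (n k : ℝ) ^ 2 / P)) ^ (1 / 2 : ℝ) =
      (P : ℝ) ^ (1 / 2 : ℝ) * |(n k : ℝ)|⁻¹ := by
    intro k hk
    have h0 : (n k : ℝ) ≠ 0 := by exact_mod_cast hk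
    have : Real.pi / (Real.pi * (n k : ℝ) ^ 2 / P) = P * (|(n k : ℝ)|⁻¹) ^ 2 := by
      rw [inv_pow, sq_abs]
      field_simp
    rw [this, Real.mul_rpow (by positivity) (by positivity), ← Real.sqrt_eq_rpow (_ ^ 2),
      Real.sqrt_sq (by positivity)]
  have hint : ∀ k, IntegrableOn (F k) (Ioi 0) := by
    intro k
    by_cases hk : n k = 0
    · simp [F, hk, IntegrableOn]
    · exact ((integral_exp_mul_rpow (hpos k hk)).1.ofReal).const_mul _
  have hσ : 0 < (τ / P : ℂ).im := by
    rw [← Complex.ofReal_natCast, Complex.div_ofReal_im]; positivity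
  have hval : ∀ k, ∫ v in Ioi (0 : ℝ), F k v = ((P : ℝ) ^ (1 / 2 : ℝ) : ℝ) *
      (((n k).sign : ℂ) * cexp (Real.pi * I * (n k : ℂ) ^ 2 * (τ / P))) := by
    intro k
    by_cases hk : n k = 0
    · simp [F, hk]
    · have h1 : (((n k : ℤ) : ℝ)) * |(n k : ℝ)|⁻¹ = ((n k).sign : ℤ) := by
        have h0 : |(n k : ℝ)| ≠ 0 := abs_ne_zero.2 (by exact_mod_cast hk)
        rw [← div_eq_mul_inv, div_eq_iff h0, ← Int.cast_abs, ← Int.cast_mul, Int.sign_mul_abs]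
      have h1C : (n k : ℂ) * ((|(n k : ℝ)|⁻¹ : ℝ) : ℂ) = ((n k).sign : ℤ) := by exact_mod_cast h1
      simp only [F]
      rw [integral_const_mul, integral_complex_ofReal, (integral_exp_mul_rpow (hpos k hk)).2,
        hsq k hk, Complex.ofReal_mul]
      linear_combination
        ((P : ℝ) ^ (1 / 2 : ℝ) : ℝ) * cexp (Real.pi * I * (n k : ℂ) ^ 2 * (τ / P)) * h1C
  have hnorm : Summable fun k => ∫ v in Ioi (0 : ℝ), ‖F k v‖ := by
    have h1 := (summable_exp_neg_sq hP r hσ).mul_left ((P : ℝ) ^ (1 / 2 : ℝ))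
    refine Summable.of_nonneg_of_le (fun k => integral_nonneg fun v => norm_nonneg _)
      (fun k => ?_) h1
    by_cases hk : n k = 0
    · simp [F, hk]
      positivity
    · have h2 : ∀ v ∈ Ioi (0 : ℝ), ‖F k v‖ =
          (|(n k : ℝ)| * Real.exp (-(Real.pi * (n k : ℝ) ^ 2 * (τ / P : ℂ).im))) *
            (Real.exp (-(Real.pi * (n k : ℝ) ^ 2 / P * v)) * v ^ (-(1 / 2) : ℝ)) := by
        intro v hv
        have hv' : 0 < v := hv
        simp only [F]
        rw [norm_mul, norm_intCast_mul_exp, Complex.norm_of_nonneg (by positivity)]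
      rw [setIntegral_congr_fun measurableSet_Ioi h2, integral_const_mul,
        (integral_exp_mul_rpow (hpos k hk)).2, hsq k hk]
      have h0 : |(n k : ℝ)| ≠ 0 := abs_ne_zero.2 (by exact_mod_cast hk)
      refine le_of_eq ?_
      show _ = (P : ℝ) ^ (1 / 2 : ℝ) * Real.exp (-(Real.pi * (n k : ℝ) ^ 2 * (τ / P : ℂ).im))
      linear_combination (P : ℝ) ^ (1 / 2 : ℝ) *
        Real.exp (-(Real.pi * (n k : ℝ) ^ 2 * (τ / P : ℂ).im)) * mul_inv_cancel₀ h0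
  have hsum := hasSum_integral_of_summable_integral_norm hint hnorm
  rw [setIntegral_congr_fun measurableSet_Ioi fun v _ => hF v, ← hsum.tsum_eq, signTheta,
    ← tsum_mul_left]
  exact tsum_congr hval

/-- Dominated convergence in the integral representation above x + it; the majorant does not depend
on t. -/
theorem tendsto_signTheta {P : ℕ} (hP : 0 < P) (r : ℤ) (x : ℚ) :
    Tendsto (fun t : ℝ => signTheta P r ((x + t * I) / P)) (𝓝[>] 0)
      (𝓝 (((P : ℝ) ^ (-(1 / 2) : ℝ) : ℝ) * eichlerIntegral (unaryTheta P r) x x)) := by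
  have hPR : (0 : ℝ) < P := by exact_mod_cast hP
  have hθ := hasCuspDecay_unaryTheta hP r
  obtain ⟨C, hC0, hC⟩ := hθ.exists_bound x
  have hE : eichlerIntegral (unaryTheta P r) x x = ∫ v in Ioi (0 : ℝ),
      unaryTheta P r ((x : ℝ) + v * I) * ((v ^ (-(1 / 2) : ℝ) : ℝ) : ℂ) := by
    refine setIntegral_congr_fun measurableSet_Ioi fun v hv => ?_
    have hv' : 0 < v := hv
    have e2 : -I * (((x : ℝ) : ℂ) + v * I - (x : ℝ)) = v := by
      linear_combination (-(v : ℂ)) * I_sq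
    rw [e2, ofReal_cpow_half hv', ← Complex.ofReal_inv, ← Real.rpow_neg hv'.le]
  have hmain : Tendsto (fun t : ℝ => ∫ v in Ioi (0 : ℝ), unaryTheta P r ((x + t * I) + v * I) *
      ((v ^ (-(1 / 2) : ℝ) : ℝ) : ℂ)) (𝓝[>] 0) (𝓝 (eichlerIntegral (unaryTheta P r) x x)) := by
    rw [hE]
    refine tendsto_integral_filter_of_dominated_convergence (fun v => C * cuspWeight v) ?_ ?_
      (integrableOn_cuspWeight.const_mul C) ?_
    · filter_upwards [self_mem_nhdsWithin] with t ht
      have ht' : (0 : ℝ) < t := ht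
      refine ContinuousOn.aestronglyMeasurable ?_ measurableSet_Ioi
      refine ContinuousOn.mul ?_ ?_
      · refine hθ.diff.continuousOn.comp (by fun_prop) fun v hv => ?_
        have hv' : (0 : ℝ) < v := hv
        show 0 < (((x : ℂ) + t * I) + v * I).im
        simp
        linarith
      · exact Complex.continuous_ofReal.comp_continuousOn
          (continuousOn_id.rpow_const fun v hv => Or.inl (ne_of_gt hv))
    · filter_upwards [self_mem_nhdsWithin] with t ht
      have ht' : (0 : ℝ) < t := ht
      refine (ae_restrict_iff' measurableSet_Ioi).2 (Eventually.of_forall fun v hv => ?_)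
      have hv' : (0 : ℝ) < v := hv
      have := hC v t hv' ht'.le
      rw [norm_mul, Complex.norm_of_nonneg (by positivity)]
      convert! this using 4
      push_cast
      ring
    · refine (ae_restrict_iff' measurableSet_Ioi).2 (Eventually.of_forall fun v hv => ?_)
      have hv' : (0 : ℝ) < v := hv
      refine Tendsto.mul_const _ ?_
      have h1 : ContinuousAt (unaryTheta P r) ((x : ℝ) + v * I) :=
        (hθ.diff.differentiableAt ((isOpen_lt continuous_const continuous_im).mem_nhds
          (by simpa using hv'))).continuousAt
      have h2 : ContinuousAt (fun t : ℝ => ((x : ℂ) + t * I) + v * I) 0 := by fun_prop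
      have h3 : Tendsto (fun t : ℝ => ((x : ℂ) + t * I) + v * I) (𝓝[>] 0)
          (𝓝 ((x : ℝ) + v * I)) := by
        have := h2.tendsto.mono_left (nhdsWithin_le_nhds (s := Ioi 0))
        simpa using this
      exact h1.tendsto.comp h3
  refine (hmain.const_mul (((P : ℝ) ^ (-(1 / 2) : ℝ) : ℝ) : ℂ)).congr' ?_
  filter_upwards [self_mem_nhdsWithin] with t ht
  have ht' : (0 : ℝ) < t := ht
  rw [integral_unaryTheta hP r (by simpa using ht'), ← mul_assoc, ← Complex.ofReal_mul,
    ← Real.rpow_add hPR]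
  norm_num

end Plumbing

namespace Plumbing

open Complex MeasureTheory Filter Set Topology

/-! ### The multiplier system -/

open Classical in
/-- The multiplier of the theta functions of level `P` on `Γ(4 P)`. -/
noncomputable def thetaMultiplier (P : ℕ) (γ : SL(2, ℤ)) : ℂ :=
  if h : 0 < P ∧ γ ∈ CongruenceSubgroup.Gamma (4 * P) then
    Classical.choose (exists_unaryTheta_multiplier h.1 h.2) else 1

theorem thetaMultiplier_spec {P : ℕ} (hP : 0 < P) {γ : SL(2, ℤ)}
    (hγ : γ ∈ CongruenceSubgroup.Gamma (4 * P)) :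
    ‖thetaMultiplier P γ‖ = 1 ∧ ∀ (r : ℤ) (τ : ℂ), 0 < τ.im → unaryTheta P r (moebius γ τ) =
      thetaMultiplier P γ * (((γ.1 1 0 : ℂ) * τ + γ.1 1 1) *
        ((γ.1 1 0 : ℂ) * τ + γ.1 1 1) ^ (1 / 2 : ℂ)) * unaryTheta P r τ := by
  rw [thetaMultiplier, dif_pos ⟨hP, hγ⟩]
  exact Classical.choose_spec (exists_unaryTheta_multiplier hP hγ)

theorem eq_one_of_mem_Gamma {P : ℕ} (hP : 0 < P) {γ : SL(2, ℤ)}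
    (hγ : γ ∈ CongruenceSubgroup.Gamma (4 * P)) (hc : γ.1 1 0 = 0) :
    γ.1 0 0 = 1 ∧ γ.1 1 1 = 1 := by
  have hdet := det_eq_one γ
  obtain ⟨ha, -, -, -⟩ := dvd_of_mem_Gamma hγ
  rw [hc, mul_zero, sub_zero] at hdet
  rcases Int.eq_one_or_neg_one_of_mul_eq_one' hdet with h | h
  · exact h
  · exfalso
    rw [h.1] at ha
    have := Int.le_of_dvd (by norm_num) ((dvd_neg (a := ((4 * P : ℕ) : ℤ))).2 ha)
    push_cast at this
    omega

/-- The conjugate appears because `autFactor` is the boundary value from the lower half-plane,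
whereas τ approaches x from above. -/
theorem tendsto_denom_cpow_half {P : ℕ} (hP : 0 < P) {γ : SL(2, ℤ)}
    (hγ : γ ∈ CongruenceSubgroup.Gamma (4 * P)) {x : ℝ}
    (hx : (γ.1 1 0 : ℝ) * x + (γ.1 1 1 : ℝ) ≠ 0) :
    Tendsto (fun τ : ℂ => ((γ.1 1 0 : ℂ) * τ + γ.1 1 1) ^ (1 / 2 : ℂ)) (𝓝[{τ | 0 < τ.im}] (x : ℂ))
      (𝓝 ((starRingEnd ℂ) (autFactor (1 / 2) γ x))) := by
  have hcast : (γ.1 1 0 : ℂ) * x + γ.1 1 1 = (((γ.1 1 0 : ℝ) * x + (γ.1 1 1 : ℝ) : ℝ) : ℂ) := by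
    push_cast; rfl
  rcases lt_or_gt_of_ne hx with h | h
  · have hc : γ.1 1 0 ≠ 0 := by
      intro hc
      rw [hc, (eq_one_of_mem_Gamma hP hγ hc).2] at h
      norm_num at h
    have hneg : 0 < -((γ.1 1 0 : ℝ) * x + (γ.1 1 1 : ℝ)) := by linarith
    have h1 : ContinuousAt (fun τ : ℂ => (if 0 < γ.1 1 0 then I else -I) *
        (-((γ.1 1 0 : ℂ) * τ + γ.1 1 1)) ^ (1 / 2 : ℂ)) (x : ℂ) := by
      refine continuousAt_const.mul (ContinuousAt.cpow (by fun_prop) continuousAt_const ?_)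
      rw [hcast, ← Complex.ofReal_neg, Complex.ofReal_mem_slitPlane]
      exact hneg
    have h2 := h1.tendsto.mono_left (nhdsWithin_le_nhds (s := {τ : ℂ | 0 < τ.im}))
    rw [hcast, ← Complex.ofReal_neg, ofReal_cpow_half hneg] at h2
    have h3 : (starRingEnd ℂ) (autFactor (1 / 2) γ x) = (if 0 < γ.1 1 0 then I else -I) *
        ((-((γ.1 1 0 : ℝ) * x + (γ.1 1 1 : ℝ))) ^ (1 / 2 : ℝ) : ℝ) := by
      rw [autFactor_half_of_neg h]
      split_ifs <;> simp
    rw [h3]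
    refine h2.congr' ?_
    filter_upwards [self_mem_nhdsWithin] with τ hτ
    have hτ' : 0 < τ.im := hτ
    have him : (-((γ.1 1 0 : ℂ) * τ + γ.1 1 1)).im = -(γ.1 1 0 : ℝ) * τ.im := by simp
    split_ifs with hc0
    · have hc0' : (0 : ℝ) < γ.1 1 0 := by exact_mod_cast hc0
      have := neg_cpow_half_of_im_neg (z := -((γ.1 1 0 : ℂ) * τ + γ.1 1 1)) (by
        rw [him]; nlinarith)
      rw [neg_neg] at this
      exact this.symm
    · have hc0' : (γ.1 1 0 : ℝ) < 0 := by
        exact_mod_cast lt_of_le_of_ne (not_lt.1 hc0) hc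
      have := neg_cpow_half_of_im_pos (z := -((γ.1 1 0 : ℂ) * τ + γ.1 1 1)) (by
        rw [him]; nlinarith)
      rw [neg_neg] at this
      exact this.symm
  · have h1 : ContinuousAt (fun τ : ℂ => ((γ.1 1 0 : ℂ) * τ + γ.1 1 1) ^ (1 / 2 : ℂ)) (x : ℂ) := by
      refine ContinuousAt.cpow (by fun_prop) continuousAt_const ?_
      rw [hcast, Complex.ofReal_mem_slitPlane]
      exact h
    have h2 := h1.tendsto.mono_left (nhdsWithin_le_nhds (s := {τ : ℂ | 0 < τ.im}))
    rw [autFactor_half_of_pos h, Complex.conj_ofReal, ← ofReal_cpow_half h, ← hcast]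
    exact h2

theorem moebius_mul_denom (γ δ : SL(2, ℤ)) {K : Type*} [Field K] {x : K}
    (hx : (δ.1 1 0 : K) * x + δ.1 1 1 ≠ 0) :
    ((γ.1 1 0 : K) * moebius δ x + γ.1 1 1) * ((δ.1 1 0 : K) * x + δ.1 1 1) =
      ((γ * δ).1 1 0 : K) * x + (γ * δ).1 1 1 := by
  have h1 : (γ * δ).1 1 0 = γ.1 1 0 * δ.1 0 0 + γ.1 1 1 * δ.1 1 0 := by
    simp [Matrix.mul_apply, Fin.sum_univ_two]
  have h2 : (γ * δ).1 1 1 = γ.1 1 0 * δ.1 0 1 + γ.1 1 1 * δ.1 1 1 := by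
    simp [Matrix.mul_apply, Fin.sum_univ_two]
  have h3 : moebius δ x * ((δ.1 1 0 : K) * x + δ.1 1 1) = (δ.1 0 0 : K) * x + δ.1 0 1 :=
    div_mul_cancel₀ _ hx
  rw [h1, h2]
  push_cast
  linear_combination (γ.1 1 0 : K) * h3

theorem moebius_mul (γ δ : SL(2, ℤ)) {τ : ℂ} (hτ : 0 < τ.im) :
    moebius (γ * δ) τ = moebius γ (moebius δ τ) := by
  have h0 := denom_ne_zero δ hτ
  have h3 := denom_ne_zero γ (moebius_im_pos δ hτ)
  have h4 := denom_ne_zero (γ * δ) hτ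
  have h5 := moebius_mul_denom γ δ h0
  have h1 : (γ * δ).1 0 0 = γ.1 0 0 * δ.1 0 0 + γ.1 0 1 * δ.1 1 0 := by
    simp [Matrix.mul_apply, Fin.sum_univ_two]
  have h2 : (γ * δ).1 0 1 = γ.1 0 0 * δ.1 0 1 + γ.1 0 1 * δ.1 1 1 := by
    simp [Matrix.mul_apply, Fin.sum_univ_two]
  rw [moebius, moebius, div_eq_div_iff h4 h3, ← h5, h1, h2]
  have h6 : moebius δ τ * ((δ.1 1 0 : ℂ) * τ + δ.1 1 1) = (δ.1 0 0 : ℂ) * τ + δ.1 0 1 :=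
    div_mul_cancel₀ _ h0
  push_cast
  linear_combination (-(γ.1 0 0 : ℂ)) * (γ.1 1 0 * moebius δ τ + γ.1 1 1) * h6

theorem continuousOn_denom_cpow_half {P : ℕ} (hP : 0 < P) {γ : SL(2, ℤ)}
    (hγ : γ ∈ CongruenceSubgroup.Gamma (4 * P)) :
    ContinuousOn (fun τ : ℂ => ((γ.1 1 0 : ℂ) * τ + γ.1 1 1) ^ (1 / 2 : ℂ)) {τ | 0 < τ.im} := by
  refine ContinuousOn.cpow_const (by fun_prop) fun τ hτ => ?_
  have hτ' : 0 < τ.im := hτ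
  by_cases hc : γ.1 1 0 = 0
  · rw [hc, (eq_one_of_mem_Gamma hP hγ hc).2]
    simp
  · right
    simp [hc, hτ'.ne']

theorem continuousOn_moebius (γ : SL(2, ℤ)) :
    ContinuousOn (fun τ : ℂ => moebius γ τ) {τ | 0 < τ.im} := by
  unfold moebius
  exact ContinuousOn.div (by fun_prop) (by fun_prop) fun τ hτ => denom_ne_zero γ hτ

/-- Comparing two transformations of a theta function at a point where it does not vanish shows that
the multiplier has the cocycle defect of the square roots. That defect is a sign, constant on the
half-plane, and passes to the boundary values. -/
theorem isMultiplierSystem_thetaMultiplier {P : ℕ} (hP : 2 < P) :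
    IsMultiplierSystem (CongruenceSubgroup.Gamma (4 * P)) (1 / 2) (thetaMultiplier P) := by
  have hP0 : 0 < P := by omega
  refine ⟨fun γ hγ => (thetaMultiplier_spec hP0 hγ).1, fun γ hγ δ hδ x hδx hγδx => ?_⟩
  have hγδ := mul_mem hγ hδ
  obtain ⟨τ₀, hτ₀, hθ₀⟩ := exists_unaryTheta_ne_zero hP
  set H : Set ℂ := {τ | 0 < τ.im} with hH
  let u : SL(2, ℤ) → ℂ → ℂ := fun γ τ => ((γ.1 1 0 : ℂ) * τ + γ.1 1 1) ^ (1 / 2 : ℂ)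
  have hu0 : ∀ γ, ∀ τ ∈ H, u γ τ ≠ 0 := by
    intro γ τ hτ h
    rw [cpow_eq_zero_iff] at h
    exact denom_ne_zero γ hτ h.1
  have husq : ∀ γ τ, u γ τ ^ 2 = (γ.1 1 0 : ℂ) * τ + γ.1 1 1 := by
    intro γ τ
    rw [sq]
    exact cpow_half_sq _
  have hmaps : MapsTo (fun τ : ℂ => moebius δ τ) H H := fun τ hτ => moebius_im_pos δ hτ
  -- Both sides are continuous square roots of the same nowhere vanishing function on a connected
  -- set.
  have hsign : ∃ s : ℂ, (s = 1 ∨ s = -1) ∧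
      ∀ τ ∈ H, u γ (moebius δ τ) * u δ τ = s * u (γ * δ) τ := by
    have hconn : IsPreconnected H := (convex_halfSpace_im_gt 0).isPreconnected
    have h1 : ContinuousOn (fun τ => u γ (moebius δ τ) * u δ τ) H :=
      ((continuousOn_denom_cpow_half hP0 hγ).comp (continuousOn_moebius δ) hmaps).mul
        (continuousOn_denom_cpow_half hP0 hδ)
    have h2 : ContinuousOn (u (γ * δ)) H := continuousOn_denom_cpow_half hP0 hγδ
    have h3 : EqOn ((fun τ => u γ (moebius δ τ) * u δ τ) ^ 2) (u (γ * δ) ^ 2) H := by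
      intro τ hτ
      simp only [Pi.pow_apply]
      rw [mul_pow, husq, husq, husq, moebius_mul_denom γ δ (denom_ne_zero δ hτ)]
    rcases hconn.eq_or_eq_neg_of_sq_eq h1 h2 h3 (fun {τ} hτ => hu0 _ τ hτ) with h | h
    · exact ⟨1, Or.inl rfl, fun τ hτ => by rw [one_mul]; exact h hτ⟩
    · exact ⟨-1, Or.inr rfl, fun τ hτ => by rw [neg_one_mul]; exact h hτ⟩
  obtain ⟨s, hs, hsu⟩ := hsign
  have hmult : thetaMultiplier P (γ * δ) = thetaMultiplier P γ * thetaMultiplier P δ * s := by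
    have h1 := (thetaMultiplier_spec hP0 hγδ).2 1 τ₀ hτ₀
    rw [moebius_mul γ δ hτ₀, (thetaMultiplier_spec hP0 hγ).2 1 _ (moebius_im_pos δ hτ₀),
      (thetaMultiplier_spec hP0 hδ).2 1 τ₀ hτ₀] at h1
    have h2 := moebius_mul_denom γ δ (denom_ne_zero δ hτ₀)
    have h3 := hsu τ₀ hτ₀
    have h4 := hu0 (γ * δ) τ₀ hτ₀
    have h5 := denom_ne_zero (γ * δ) hτ₀
    simp only [u] at h3 h4
    rw [← h2] at h5 h1
    generalize ((γ * δ).1 1 0 : ℂ) * τ₀ + (γ * δ).1 1 1 = Z at *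
    generalize (γ.1 1 0 : ℂ) * moebius δ τ₀ + γ.1 1 1 = X at *
    generalize (δ.1 1 0 : ℂ) * τ₀ + δ.1 1 1 = Y at *
    rw [h2] at h1 h5
    apply mul_right_cancel₀ (mul_ne_zero (mul_ne_zero h5 h4) hθ₀)
    have h6 : thetaMultiplier P (γ * δ) * (Z * Z ^ (1 / 2 : ℂ) * unaryTheta P 1 τ₀) =
        thetaMultiplier P γ * (X * X ^ (1 / 2 : ℂ)) *
          (thetaMultiplier P δ * (Y * Y ^ (1 / 2 : ℂ)) * unaryTheta P 1 τ₀) := by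
      rw [h1]; ring
    rw [h6]
    linear_combination (thetaMultiplier P γ * thetaMultiplier P δ * X * Y *
      unaryTheta P 1 τ₀) * h3 + (thetaMultiplier P γ * thetaMultiplier P δ * s *
      unaryTheta P 1 τ₀ * Z ^ (1 / 2 : ℂ)) * h2
  have hden := moebius_mul_denom γ δ hδx
  have hγx : (γ.1 1 0 : ℝ) * moebius δ x + (γ.1 1 1 : ℝ) ≠ 0 := by
    intro h
    rw [h, zero_mul] at hden
    exact hγδx hden.symm
  have hmx : ((moebius δ x : ℝ) : ℂ) = moebius δ (x : ℂ) := by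
    rw [moebius, moebius]; push_cast; rfl
  have hp : Tendsto (fun t : ℝ => (x : ℂ) + t * I) (𝓝[>] 0) (𝓝[H] (x : ℂ)) := by
    refine tendsto_nhdsWithin_iff.2 ⟨?_, ?_⟩
    · have h2 : ContinuousAt (fun t : ℝ => (x : ℂ) + t * I) 0 := by fun_prop
      have := h2.tendsto.mono_left (nhdsWithin_le_nhds (s := Ioi 0))
      simpa using this
    · filter_upwards [self_mem_nhdsWithin] with t ht
      have ht' : (0 : ℝ) < t := ht
      simpa [hH] using ht'
  have hδp : Tendsto (fun τ : ℂ => moebius δ τ) (𝓝[H] (x : ℂ)) (𝓝[H] ((moebius δ x : ℝ) : ℂ)) := by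
    refine tendsto_nhdsWithin_iff.2 ⟨?_, ?_⟩
    · have h2 : ContinuousAt (fun τ : ℂ => moebius δ τ) (x : ℂ) := by
        unfold moebius
        refine ContinuousAt.div (by fun_prop) (by fun_prop) ?_
        exact_mod_cast hδx
      rw [hmx]
      exact h2.tendsto.mono_left nhdsWithin_le_nhds
    · filter_upwards [self_mem_nhdsWithin] with τ hτ using hmaps hτ
  have l1 := ((tendsto_denom_cpow_half hP0 hγ hγx).comp (hδp.comp hp)).mul
    ((tendsto_denom_cpow_half hP0 hδ hδx).comp hp)
  have l2 := ((tendsto_denom_cpow_half hP0 hγδ hγδx).comp hp).const_mul s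
  have hlim := tendsto_nhds_unique l1 (l2.congr' (by
    filter_upwards [self_mem_nhdsWithin] with t ht
    have ht' : (0 : ℝ) < t := ht
    exact (hsu _ (by simpa [hH] using ht')).symm))
  -- The sign is real, so conjugating the limit relation transfers it to `autFactor`.
  have hs' : (starRingEnd ℂ) s = s := by rcases hs with rfl | rfl <;> simp
  have hA := congrArg (starRingEnd ℂ) hlim
  simp only [map_mul, Complex.conj_conj, hs'] at hA
  rw [hmult]
  linear_combination (-(thetaMultiplier P γ * thetaMultiplier P δ)) * hA

/-! ### Quantum modularity at a fixed level -/

/-- Quantum modularity of weight `1 / 2` on `Γ(4 P)` for the multiplier of the theta functions of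
level `P`, with quantum set `ℚ`. -/
def IsLevelQuantum (P : ℕ) (F : ℂ → ℂ) : Prop :=
  ∃ f : ℚ → ℂ,
    (∀ x : ℚ, Tendsto (fun t : ℝ => F ((x : ℂ) + (t : ℂ) * I)) (𝓝[>] 0) (𝓝 (f x))) ∧
    ∀ γ ∈ CongruenceSubgroup.Gamma (4 * P), ∃ h : ℝ → ℂ,
      AnalyticOnNhd ℝ h {x : ℝ | (γ.1 1 0 : ℝ) * x + (γ.1 1 1 : ℝ) ≠ 0} ∧
      ∀ x : ℚ, (γ.1 1 0 : ℚ) * x + (γ.1 1 1 : ℚ) ≠ 0 →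
        f x - (thetaMultiplier P γ)⁻¹ * autFactor (-(1 / 2)) γ (x : ℝ) * f (moebius γ x) =
          h (x : ℝ)

theorem IsLevelQuantum.isQuantumModularForm {P : ℕ} (hP : 2 < P) {F : ℂ → ℂ}
    (hF : IsLevelQuantum P F) : IsQuantumModularForm (1 / 2) Set.univ F := by
  obtain ⟨f, hf, hq⟩ := hF
  have : NeZero (4 * P) := ⟨by omega⟩
  refine ⟨f, fun x _ => hf x, CongruenceSubgroup.Gamma (4 * P),
    CongruenceSubgroup.Gamma_is_cong_sub _, thetaMultiplier P,
    isMultiplierSystem_thetaMultiplier hP, fun γ hγ => ?_⟩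
  obtain ⟨h, h1, h2⟩ := hq γ hγ
  exact ⟨h, h1, fun x _ hx _ => h2 x hx⟩

theorem IsLevelQuantum.const_mul {P : ℕ} {F : ℂ → ℂ} (hF : IsLevelQuantum P F) (κ : ℂ) :
    IsLevelQuantum P fun τ => κ * F τ := by
  obtain ⟨f, hf, hq⟩ := hF
  refine ⟨fun x => κ * f x, fun x => (hf x).const_mul κ, fun γ hγ => ?_⟩
  obtain ⟨h, h1, h2⟩ := hq γ hγ
  refine ⟨fun x => κ * h x, fun x hx => analyticAt_const.mul (h1 x hx), fun x hx => ?_⟩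
  beta_reduce
  rw [← h2 x hx]
  ring

theorem IsLevelQuantum.sum {P : ℕ} {ι : Type*} (s : Finset ι) {F : ι → ℂ → ℂ}
    (hF : ∀ i, IsLevelQuantum P (F i)) : IsLevelQuantum P fun τ => ∑ i ∈ s, F i τ := by
  choose f hf hq using hF
  refine ⟨fun x => ∑ i ∈ s, f i x, fun x => tendsto_finsetSum _ fun i _ => hf i x, fun γ hγ => ?_⟩
  choose h h1 h2 using fun i => hq i γ hγ
  refine ⟨fun x => ∑ i ∈ s, h i x, fun x hx => s.analyticAt_fun_sum fun i _ => h1 i x hx,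
    fun x hx => ?_⟩
  rw [Finset.mul_sum, ← Finset.sum_sub_distrib]
  exact Finset.sum_congr rfl fun i _ => h2 i x hx

theorem IsLevelQuantum.add {P : ℕ} {F G : ℂ → ℂ} (hF : IsLevelQuantum P F)
    (hG : IsLevelQuantum P G) : IsLevelQuantum P fun τ => F τ + G τ := by
  have := IsLevelQuantum.sum (P := P) Finset.univ (F := fun i : Bool => if i then F else G)
    (by rintro (_ | _) <;> simpa)
  simpa using this

theorem IsLevelQuantum.congr {P : ℕ} {F G : ℂ → ℂ} (hF : IsLevelQuantum P F)
    (h : ∀ τ : ℂ, 0 < τ.im → F τ = G τ) : IsLevelQuantum P G := by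
  obtain ⟨f, hf, hq⟩ := hF
  refine ⟨f, fun x => (hf x).congr' ?_, hq⟩
  filter_upwards [self_mem_nhdsWithin] with t ht
  have ht' : (0 : ℝ) < t := ht
  exact h _ (by simpa using ht')

theorem analyticAt_autFactor_neg_half {γ : SL(2, ℤ)} {x : ℝ}
    (hx : (γ.1 1 0 : ℝ) * x + (γ.1 1 1 : ℝ) ≠ 0) :
    AnalyticAt ℝ (fun x : ℝ => autFactor (-(1 / 2)) γ x) x := by
  have hroot : ∀ (g : ℝ → ℝ), AnalyticAt ℝ g x → 0 < g x →
      AnalyticAt ℝ (fun x => ((g x ^ (1 / 2 : ℝ) : ℝ) : ℂ)) x := by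
    intro g hg hpos
    have h1 : AnalyticAt ℂ (fun z : ℂ => z ^ (1 / 2 : ℂ)) (g x) :=
      analyticAt_id.cpow analyticAt_const (Complex.ofReal_mem_slitPlane.2 hpos)
    refine ((h1.restrictScalars (𝕜 := ℝ)).comp_of_eq
      ((Complex.ofRealCLM.analyticAt _).comp hg) rfl).congr ?_
    filter_upwards [hg.continuousAt.eventually_const_lt hpos] with y hy
    exact ofReal_cpow_half hy
  have hlin : AnalyticAt ℝ (fun x : ℝ => (γ.1 1 0 : ℝ) * x + (γ.1 1 1 : ℝ)) x :=
    (analyticAt_const.mul analyticAt_id).add analyticAt_const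
  have h1 : AnalyticAt ℝ (fun x : ℝ => autFactor (1 / 2) γ x) x := by
    rcases lt_or_gt_of_ne hx with h | h
    · refine (analyticAt_const.mul (hroot _ hlin.neg (neg_pos.2 h))).congr
        (f := fun x => (if 0 < γ.1 1 0 then -I else I) * _) ?_
      filter_upwards [hlin.continuousAt.eventually_lt_const h] with y hy
      rw [autFactor_half_of_neg hy]
      rfl
    · refine (hroot _ hlin h).congr ?_
      filter_upwards [hlin.continuousAt.eventually_const_lt h] with y hy
      rw [autFactor_half_of_pos hy]
  refine (h1.inv (autFactor_half_ne_zero hx)).congr (Eventually.of_forall fun y => ?_)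
  simp only [autFactor_neg_half, Pi.inv_apply]

theorem analyticAt_qpow_comp (r : ℚ) {g : ℝ → ℝ} {x : ℝ} (hg : AnalyticAt ℝ g x) :
    AnalyticAt ℝ (fun x => qpow r (g x)) x := by
  unfold qpow
  have h1 : AnalyticAt ℂ (fun z : ℂ => cexp (2 * Real.pi * I * r * z)) (g x) := by fun_prop
  exact (h1.restrictScalars (𝕜 := ℝ)).comp_of_eq ((Complex.ofRealCLM.analyticAt _).comp hg) rfl

/-- The boundary function is analytic on the whole real line, and so is its composite with γ away
from -d/c. The obstruction is therefore analytic, whatever the multiplier. -/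
theorem isLevelQuantum_qpow (P : ℕ) (r : ℚ) : IsLevelQuantum P (qpow r) := by
  refine ⟨fun x => qpow r x, fun x => ?_, fun γ hγ => ?_⟩
  · have h : ContinuousAt (fun t : ℝ => qpow r ((x : ℂ) + t * I)) 0 := by
      unfold qpow
      fun_prop
    have := h.tendsto.mono_left (nhdsWithin_le_nhds (s := Ioi 0))
    simpa using this
  · refine ⟨fun x => qpow r x - (thetaMultiplier P γ)⁻¹ * autFactor (-(1 / 2)) γ x *
      qpow r ((moebius γ x : ℝ) : ℂ), fun x hx => ?_, fun x hx => ?_⟩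
    · refine (analyticAt_qpow_comp r analyticAt_id).sub ((analyticAt_const.mul
        (analyticAt_autFactor_neg_half hx)).mul (analyticAt_qpow_comp r ?_))
      unfold moebius
      exact ((analyticAt_const.mul analyticAt_id).add analyticAt_const).div
        ((analyticAt_const.mul analyticAt_id).add analyticAt_const) hx
    · have : ((moebius γ (x : ℝ) : ℝ) : ℂ) = ((moebius γ x : ℚ) : ℂ) := by
        rw [moebius, moebius]; push_cast; rfl
      simp only [this, Complex.ofReal_ratCast]

theorem isLevelQuantum_signTheta {P : ℕ} (hP : 0 < P) (r : ℤ) :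
    IsLevelQuantum P fun τ => signTheta P r (τ / P) := by
  have hθ := hasCuspDecay_unaryTheta hP r
  refine ⟨fun x => ((P : ℝ) ^ (-(1 / 2) : ℝ) : ℝ) * eichlerIntegral (unaryTheta P r) x x,
    fun x => tendsto_signTheta hP r x, fun γ hγ => ?_⟩
  obtain ⟨hw, htrans⟩ := thetaMultiplier_spec hP hγ
  have hw0 : thetaMultiplier P γ ≠ 0 := by
    intro h
    rw [h] at hw
    simp at hw
  by_cases hc : γ.1 1 0 = 0
  -- Here γ is a translation, under which the Eichler integral is multiplied by the multiplier; the
  -- obstruction vanishes.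
  · refine ⟨fun _ => 0, fun x _ => analyticAt_const, fun x hx => ?_⟩
    obtain ⟨ha, hd⟩ := eq_one_of_mem_Gamma hP hγ hc
    have hA : autFactor (-(1 / 2)) γ (x : ℝ) = 1 := by
      rw [autFactor_neg_half, autFactor_half_of_pos (by rw [hc, hd]; norm_num), hc, hd]
      simp
    have hE : eichlerIntegral (unaryTheta P r) ((moebius γ x : ℚ) : ℝ) ((moebius γ x : ℚ) : ℝ) =
        thetaMultiplier P γ * eichlerIntegral (unaryTheta P r) x x := by
      rw [eichlerIntegral, eichlerIntegral, ← integral_const_mul]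
      refine setIntegral_congr_fun measurableSet_Ioi fun v hv => ?_
      have hv' : (0 : ℝ) < v := hv
      have h1 := htrans r ((x : ℝ) + v * I) (by simpa using hv')
      have h2 : moebius γ (((x : ℝ) : ℂ) + v * I) = ((moebius γ x : ℚ) : ℝ) + v * I := by
        rw [moebius, moebius, ha, hd, hc]
        push_cast
        simp
        ring
      rw [h2, hc, hd] at h1
      simp only [Int.cast_zero, zero_mul, Int.cast_one, zero_add, Complex.one_cpow, mul_one] at h1
      rw [h1, add_sub_cancel_left, add_sub_cancel_left]
      ring
    beta_reduce
    rw [hA, hE]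
    field_simp
    ring
  · have hcR : (γ.1 1 0 : ℝ) ≠ 0 := by exact_mod_cast hc
    refine ⟨fun x => ((P : ℝ) ^ (-(1 / 2) : ℝ) : ℝ) * eichlerIntegral (unaryTheta P r)
      ((-(γ.1 1 1 : ℚ) / (γ.1 1 0 : ℚ) : ℚ) : ℝ) x, fun x hx => ?_, fun x hx => ?_⟩
    · refine analyticAt_const.mul (hθ.analyticOnNhd _ x ?_)
      intro h
      apply hx
      rw [h]
      push_cast
      field_simp
      ring
    · beta_reduce
      rw [← hθ.obstruction_eq hc hw0 (htrans r) hx]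
      ring

/-! ### False theta functions -/

theorem signTheta_eq_sum {L b : ℕ} (hL : 0 < L) (hb : 0 < b) (g : ℤ) {σ : ℂ} (hσ : 0 < σ.im) :
    signTheta L g σ = ∑ i ∈ Finset.range b, signTheta (L * b) (g + L * i) σ := by
  rw [signTheta, tsum_int_eq_sum_range (summable_signTheta hL g hσ) hb]
  refine Finset.sum_congr rfl fun i _ => tsum_congr fun k => ?_
  have : (g + L * (i + b * k) : ℤ) = g + L * i + (L * b : ℕ) * k := by push_cast; ring
  rw [this]

/-- A false theta function is a sum of Eichler integrals and finitely many powers of `q`. -/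
theorem falseTheta_eq {p A B : ℕ} (hp : 0 < p) (hA : 0 < A) (hB : 0 < B) (j : ℤ) {τ : ℂ}
    (hτ : 0 < τ.im) :
    falseTheta j p (((A / B : ℚ) : ℂ) * τ) =
      (∑ i ∈ Finset.range (2 * p * B), signTheta (8 * p ^ 2 * A * B) (2 * A * j + 4 * p * A * i)
        (τ / (8 * p ^ 2 * A * B : ℕ))) +
      ∑ m ∈ Finset.Icc (-|j|) |j|, ((if 0 ≤ m then (1 : ℂ) else -1) - ((2 * p * m + j).sign : ℂ)) *
        qpow ((A / B : ℚ) * ((m : ℚ) + (j : ℚ) / (2 * (p : ℚ))) ^ 2) τ := by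
  have hpC : (p : ℂ) ≠ 0 := by exact_mod_cast hp.ne'
  have hAC : (A : ℂ) ≠ 0 := by exact_mod_cast hA.ne'
  have hBC : (B : ℂ) ≠ 0 := by exact_mod_cast hB.ne'
  have hL : 0 < 4 * p * A := by positivity
  have hP : 0 < 8 * p ^ 2 * A * B := by positivity
  have hLP : 4 * p * A * (2 * p * B) = 8 * p ^ 2 * A * B := by ring
  have hσ : 0 < (τ / (8 * p ^ 2 * A * B : ℕ) : ℂ).im := by
    have : (0 : ℝ) < (8 * p ^ 2 * A * B : ℕ) := by exact_mod_cast hP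
    rw [← Complex.ofReal_natCast, Complex.div_ofReal_im]
    positivity
  -- With n = 2A(2pm + j) and P = 8p²AB the exponent (A/B)(m + j/(2p))² equals n²/(2P). These n form
  -- a class modulo 4pA, which splits into 2pB classes modulo P.
  have hq : ∀ m : ℤ, qpow ((A / B : ℚ) * ((m : ℚ) + (j : ℚ) / (2 * (p : ℚ))) ^ 2) τ =
      cexp (Real.pi * I * ((2 * A * j + (4 * p * A : ℕ) * m : ℤ) : ℂ) ^ 2 *
        (τ / (8 * p ^ 2 * A * B : ℕ))) := by
    intro m
    rw [qpow]
    congr 1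
    push_cast
    field_simp
    ring
  have hsign : ∀ m : ℤ, (2 * A * j + (4 * p * A : ℕ) * m).sign = (2 * p * m + j).sign := by
    intro m
    have : (2 * A * j + (4 * p * A : ℕ) * m : ℤ) = (2 * A : ℕ) * (2 * p * m + j) := by
      push_cast; ring
    rw [this, Int.sign_mul, Int.sign_eq_one_of_pos (by positivity), one_mul]
  have h1 := signTheta_eq_sum hL (by positivity : 0 < 2 * p * B) (2 * A * j) hσ
  rw [hLP] at h1
  have h2 : ∀ i : ℕ, (2 * A * j + (4 * p * A : ℕ) * i : ℤ) = 2 * A * j + 4 * p * A * i := by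
    intro i; push_cast; ring
  simp only [h2] at h1
  rw [← h1]
  -- For |m| > |j| the sign of 2pm + j is that of m, so sgn*(m) and sgn(n) differ for finitely many
  -- m only.
  have hzero : ∀ m ∉ Finset.Icc (-|j|) |j|,
      ((if 0 ≤ m then (1 : ℂ) else -1) - ((2 * p * m + j).sign : ℂ)) *
        qpow ((A / B : ℚ) * ((m : ℚ) + (j : ℚ) / (2 * (p : ℚ))) ^ 2) τ = 0 := by
    intro m hm
    have hp1 : (1 : ℤ) ≤ p := by exact_mod_cast hp
    have hj := neg_abs_le j
    have hj' := le_abs_self j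
    have hj0 := abs_nonneg j
    rw [Finset.mem_Icc, not_and_or, not_le, not_le] at hm
    rcases hm with hm | hm
    · rw [Int.sign_eq_neg_one_of_neg (by nlinarith), if_neg (by omega)]
      simp
    · rw [Int.sign_eq_one_of_pos (by nlinarith), if_pos (by omega)]
      simp
  rw [← tsum_eq_sum (L := SummationFilter.unconditional ℤ) hzero, signTheta, ← (summable_signTheta hL (2 * A * j) hσ).tsum_add
    (summable_of_ne_finset_zero hzero), falseTheta]
  refine tsum_congr fun m => ?_
  have h3 : qpow (((m : ℚ) + (j : ℚ) / (2 * (p : ℚ))) ^ 2) (((A / B : ℚ) : ℂ) * τ) =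
      qpow ((A / B : ℚ) * ((m : ℚ) + (j : ℚ) / (2 * (p : ℚ))) ^ 2) τ := by
    rw [qpow, qpow]
    congr 1
    push_cast
    ring
  rw [h3, ← hq, hsign]
  ring

theorem isLevelQuantum_falseTheta {p A B : ℕ} (hp : 0 < p) (hA : 0 < A) (hB : 0 < B) (j : ℤ) :
    IsLevelQuantum (8 * p ^ 2 * A * B) fun τ => falseTheta j p (((A / B : ℚ) : ℂ) * τ) :=
  ((IsLevelQuantum.sum _ fun _ => isLevelQuantum_signTheta (by positivity) _).add
    (IsLevelQuantum.sum _ fun _ => (isLevelQuantum_qpow _ _).const_mul _)).congr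
      fun _ hτ => (falseTheta_eq hp hA hB j hτ).symm

theorem exists_falseTheta_eq_of_dvd {p q : ℕ} (hp : 0 < p) (hq : 0 < q) (h : p ∣ q) (j : ℤ) :
    ∃ j' : ℤ, falseTheta j p = falseTheta j' q := by
  obtain ⟨k, rfl⟩ := h
  have hk : (k : ℚ) ≠ 0 := by
    rintro h
    rw [Nat.cast_eq_zero] at h
    subst h
    simp at hq
  have hp' : (p : ℚ) ≠ 0 := by exact_mod_cast hp.ne'
  refine ⟨j * k, funext fun τ => ?_⟩
  rw [falseTheta, falseTheta]
  have : (((j * k : ℤ) : ℚ) / (2 * ((p * k : ℕ) : ℚ))) = (j : ℚ) / (2 * (p : ℚ)) := by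
    push_cast
    field_simp
  rw [this]

/-- Finite linear combinations of false theta functions with a common scaling are quantum modular
forms of weight `1 / 2` on all of `ℚ`. -/
theorem isQuantumModularForm_sum_falseTheta {ι : Type*} [Fintype ι] (κ : ι → ℂ) (j : ι → ℤ)
    (p : ι → ℕ) (hp : ∀ i, 0 < p i) {s : ℚ} (hs : 0 < s) {F : ℂ → ℂ}
    (hF : ∀ τ : ℂ, 0 < τ.im → F τ = ∑ i, κ i * falseTheta (j i) (p i) ((s : ℂ) * τ)) :
    IsQuantumModularForm (1 / 2) Set.univ F := by
  have hA : 0 < s.num.toNat := by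
    have := Rat.num_pos.2 hs
    omega
  have hs' : s = ((s.num.toNat : ℚ) / (s.den : ℚ) : ℚ) := by
    have h1 : ((s.num.toNat : ℕ) : ℚ) = (s.num : ℚ) := by
      have : ((s.num.toNat : ℕ) : ℤ) = s.num := Int.toNat_of_nonneg (Rat.num_pos.2 hs).le
      exact_mod_cast this
    rw [h1, Rat.num_div_den]
  have hq : 0 < ∏ i, p i := Finset.prod_pos fun i _ => hp i
  -- A common denominator puts all terms at one level, where they share one multiplier.
  choose j' hj' using fun i =>
    exists_falseTheta_eq_of_dvd (hp i) hq (Finset.dvd_prod_of_mem p (Finset.mem_univ i)) (j i)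
  -- A level above 2 is what the non-vanishing of the theta function in the multiplier system
  -- requires.
  have hlevel : 2 < 8 * (∏ i, p i) ^ 2 * s.num.toNat * s.den := by
    have h1 : 0 < (∏ i, p i) ^ 2 * s.num.toNat * s.den :=
      Nat.mul_pos (Nat.mul_pos (by positivity) hA) s.den_pos
    have h2 : 8 * (∏ i, p i) ^ 2 * s.num.toNat * s.den =
      8 * ((∏ i, p i) ^ 2 * s.num.toNat * s.den) := by ring
    omega
  refine IsLevelQuantum.isQuantumModularForm hlevel ((IsLevelQuantum.sum Finset.univ fun i =>
    (isLevelQuantum_falseTheta hq hA s.den_pos (j' i)).const_mul (κ i)).congr fun τ hτ => ?_)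
  rw [hF τ hτ, ← hs']
  simp only [hj']

end Plumbing

/-! ### Principal values of the one-variable integrals. -/

namespace Plumbing

open Complex MeasureTheory Filter Set Topology

/-! ### Vertex functions -/

/-- The function attached to a vertex of degree `d` once the edge functions are distributed among
the vertices. -/
noncomputable def vertexFactor (d : ℕ) (w : ℂ) : ℂ := (w - w⁻¹) ^ 2 * ((w - w⁻¹)⁻¹) ^ d

theorem edgeFactor_eq_prod {N : ℕ} (w : Fin N → ℂ) {e : Sym2 (Fin N)} (he : ¬ e.IsDiag) :
    edgeFactor w e = ∏ v, if v ∈ e then (w v - (w v)⁻¹)⁻¹ else 1 := by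
  induction e using Sym2.ind with
  | _ a b =>
    have hab : a ≠ b := by simpa using he
    have h : (Finset.univ.filter fun v => v ∈ s(a, b)) = {a, b} := by
      ext v; simp
    rw [← Finset.prod_filter, h, Finset.prod_pair hab]
    simp [edgeFactor, mul_comm]

theorem graphFactor_eq_prod {N : ℕ} (G : SimpleGraph (Fin N)) [DecidableRel G.Adj]
    (w : Fin N → ℂ) : graphFactor G w = ∏ j, vertexFactor (G.degree j) (w j) := by
  simp only [vertexFactor]
  rw [graphFactor, Finset.prod_mul_distrib]
  congr 1
  rw [Finset.prod_congr rfl fun e he => edgeFactor_eq_prod w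
    (G.not_isDiag_of_mem_edgeSet (SimpleGraph.mem_edgeFinset.1 he)), Finset.prod_comm]
  refine Finset.prod_congr rfl fun v _ => ?_
  rw [← Finset.prod_filter, Finset.prod_const, ← SimpleGraph.incidenceFinset_eq_filter,
    SimpleGraph.card_incidenceFinset_eq_degree]

/-- The angles whose points on the unit circle keep distance `ε` from `1` and `-1`. -/
def cutCircle (ε : ℝ) : Set ℝ :=
  {θ | ε ≤ ‖cexp (θ * I) - 1‖ ∧ ε ≤ ‖cexp (θ * I) + 1‖}

theorem measurableSet_cutCircle (ε : ℝ) : MeasurableSet (cutCircle ε) := by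
  have h1 : IsClosed {θ : ℝ | ε ≤ ‖cexp (θ * I) - 1‖} := isClosed_le (by fun_prop) (by fun_prop)
  have h2 : IsClosed {θ : ℝ | ε ≤ ‖cexp (θ * I) + 1‖} := isClosed_le (by fun_prop) (by fun_prop)
  exact (h1.inter h2).measurableSet

/-- The integrand of a single variable of the torus integral, against `dθ`. -/
noncomputable def vertexIntegrand (ε : ℝ) (d : ℕ) (m : ℤ) : ℝ → ℂ :=
  (cutCircle ε).indicator fun θ => I * (vertexFactor d (cexp (θ * I)) * cexp (θ * I) ^ m)

theorem measurable_vertexFactor (d : ℕ) : Measurable (vertexFactor d) := by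
  unfold vertexFactor
  fun_prop

theorem measurable_vertexIntegrand (ε : ℝ) (d : ℕ) (m : ℤ) :
    Measurable (vertexIntegrand ε d m) := by
  refine Measurable.indicator ?_ (measurableSet_cutCircle ε)
  have h1 : Measurable fun θ : ℝ => cexp (θ * I) := by fun_prop
  have h2 : Measurable fun θ : ℝ => cexp (θ * I) ^ m := by
    have : Continuous fun θ : ℝ => cexp (θ * I) ^ m :=
      Continuous.zpow₀ (by fun_prop) m fun θ => Or.inl (Complex.exp_ne_zero _)
    exact this.measurable
  exact (((measurable_vertexFactor d).comp h1).mul h2).const_mul I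

theorem norm_sub_inv_of_norm_eq_one {w : ℂ} (hw : ‖w‖ = 1) :
    ‖w - w⁻¹‖ = ‖w - 1‖ * ‖w + 1‖ := by
  have hw0 : w ≠ 0 := by rintro rfl; simp at hw
  have : w - w⁻¹ = w⁻¹ * ((w - 1) * (w + 1)) := by field_simp; ring
  rw [this, norm_mul, norm_mul, norm_inv, hw, inv_one, one_mul]

theorem norm_vertexIntegrand_le {ε : ℝ} (hε : 0 < ε) (d : ℕ) (m : ℤ) (θ : ℝ) :
    ‖vertexIntegrand ε d m θ‖ ≤ 4 * ((ε ^ 2)⁻¹) ^ d := by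
  rw [vertexIntegrand]
  by_cases hθ : θ ∈ cutCircle ε
  · rw [indicator_of_mem hθ]
    have hw : ‖cexp (θ * I)‖ = 1 := Complex.norm_exp_ofReal_mul_I θ
    obtain ⟨h1, h2⟩ := hθ
    generalize cexp (θ * I) = w at *
    have h3 : ε ^ 2 ≤ ‖w - w⁻¹‖ := by
      rw [norm_sub_inv_of_norm_eq_one hw, sq]
      exact mul_le_mul h1 h2 hε.le (norm_nonneg _)
    have h4 : ‖w - w⁻¹‖ ≤ 2 := by
      refine (norm_sub_le _ _).trans ?_
      rw [norm_inv, hw]; norm_num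
    rw [vertexFactor, norm_mul, norm_mul, norm_mul, norm_zpow, hw, norm_I, norm_pow, norm_pow,
      norm_inv, one_zpow, one_mul, mul_one]
    have h5 : ‖w - w⁻¹‖ ^ 2 ≤ 4 := by nlinarith [norm_nonneg (w - w⁻¹)]
    gcongr
  · rw [indicator_of_notMem hθ, norm_zero]
    positivity

/-- The contribution of a single variable to the truncated torus integral. -/
noncomputable def vertexIntegral (ε : ℝ) (d : ℕ) (m : ℤ) : ℂ :=
  ∫ θ in Icc 0 (2 * Real.pi), vertexIntegrand ε d m θ

/-- The symmetrisation of the integrand of a single variable under `w ↦ w⁻¹`. -/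
noncomputable def symmIntegrand (d : ℕ) (m : ℤ) (w : ℂ) : ℂ :=
  I / 2 * (vertexFactor d w * w ^ m + vertexFactor d w⁻¹ * w⁻¹ ^ m)

/-- The principal value of the integral over a single variable. -/
noncomputable def vertexValue (d : ℕ) (m : ℤ) : ℂ :=
  ∫ θ in Icc 0 (2 * Real.pi), symmIntegrand d m (cexp (θ * I))

theorem cexp_two_pi_sub (θ : ℝ) : cexp ((2 * Real.pi - θ : ℝ) * I) = (cexp (θ * I))⁻¹ := by
  rw [← Complex.exp_neg]
  have : ((2 * Real.pi - θ : ℝ) : ℂ) * I = -(θ * I) + 2 * Real.pi * I := by push_cast; ring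
  rw [this, Complex.exp_add, Complex.exp_two_pi_mul_I, mul_one]

theorem mem_cutCircle_two_pi_sub {ε θ : ℝ} : 2 * Real.pi - θ ∈ cutCircle ε ↔ θ ∈ cutCircle ε := by
  have hw : ‖cexp (θ * I)‖ = 1 := Complex.norm_exp_ofReal_mul_I θ
  have hw0 : cexp (θ * I) ≠ 0 := Complex.exp_ne_zero _
  rw [cutCircle, mem_ofPred_eq, mem_ofPred_eq, cexp_two_pi_sub]
  generalize cexp (θ * I) = w at *
  have h1 : w⁻¹ - 1 = -(w⁻¹ * (w - 1)) := by field_simp; ring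
  have h2 : w⁻¹ + 1 = w⁻¹ * (w + 1) := by field_simp; ring
  rw [h1, h2, norm_neg, norm_mul, norm_mul, norm_inv, hw, inv_one, one_mul, one_mul]

/-- The truncated circle is invariant under w ↦ w⁻¹, so the integrand may be averaged over this
involution. At degree three the averaging cancels the simple poles at 1 and -1. -/
theorem vertexIntegral_eq {ε : ℝ} (hε : 0 < ε) (d : ℕ) (m : ℤ) :
    vertexIntegral ε d m = ∫ θ in Icc 0 (2 * Real.pi),
      (cutCircle ε).indicator (fun θ : ℝ => symmIntegrand d m (cexp (θ * I))) θ := by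
  have hint : IntegrableOn (vertexIntegrand ε d m) (Icc 0 (2 * Real.pi)) :=
    Measure.integrableOn_of_bounded (M := 4 * ((ε ^ 2)⁻¹) ^ d) measure_Icc_lt_top.ne
      (measurable_vertexIntegrand ε d m).aestronglyMeasurable
      (Eventually.of_forall fun θ => norm_vertexIntegrand_le hε d m θ)
  have hpi : (0 : ℝ) ≤ 2 * Real.pi := by positivity
  have hint2 : IntervalIntegrable (vertexIntegrand ε d m) volume 0 (2 * Real.pi) :=
    (intervalIntegrable_iff_integrableOn_Icc_of_le hpi).2 hint
  have hint3 : IntervalIntegrable (fun θ => vertexIntegrand ε d m (2 * Real.pi - θ)) volume 0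
      (2 * Real.pi) := by
    have := hint2.comp_sub_left (2 * Real.pi)
    simpa using this.symm
  have h1 : vertexIntegral ε d m = ∫ θ in (0 : ℝ)..2 * Real.pi, vertexIntegrand ε d m θ := by
    rw [vertexIntegral, integral_Icc_eq_integral_Ioc, intervalIntegral.integral_of_le hpi]
  have h2 : ∫ θ in (0 : ℝ)..2 * Real.pi, vertexIntegrand ε d m (2 * Real.pi - θ) =
      ∫ θ in (0 : ℝ)..2 * Real.pi, vertexIntegrand ε d m θ := by
    rw [intervalIntegral.integral_comp_sub_left]
    simp
  have h3 : vertexIntegral ε d m = ∫ θ in (0 : ℝ)..2 * Real.pi,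
      (1 / 2 : ℂ) * (vertexIntegrand ε d m θ + vertexIntegrand ε d m (2 * Real.pi - θ)) := by
    rw [intervalIntegral.integral_const_mul, intervalIntegral.integral_add hint2 hint3, h2, ← h1]
    ring
  rw [h3, intervalIntegral.integral_of_le hpi, ← integral_Icc_eq_integral_Ioc]
  refine setIntegral_congr_fun measurableSet_Icc fun θ _ => ?_
  rw [vertexIntegrand]
  by_cases hθ : θ ∈ cutCircle ε
  · rw [indicator_of_mem hθ, indicator_of_mem hθ,
      indicator_of_mem (mem_cutCircle_two_pi_sub.2 hθ), cexp_two_pi_sub, symmIntegrand]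
    ring
  · rw [indicator_of_notMem hθ, indicator_of_notMem hθ,
      indicator_of_notMem fun h => hθ (mem_cutCircle_two_pi_sub.1 h)]
    simp

/-! ### Uniform bounds -/

theorem norm_pow_sub_one_le {z : ℂ} (hz : ‖z‖ = 1) (n : ℕ) : ‖z ^ n - 1‖ ≤ n * ‖z - 1‖ := by
  induction n with
  | zero => simp
  | succ k ih =>
    have : z ^ (k + 1) - 1 = z * (z ^ k - 1) + (z - 1) := by ring
    rw [this]
    refine (norm_add_le _ _).trans ?_
    rw [norm_mul, hz, one_mul]
    push_cast
    linarith

/-- This compensates the pole of 1/(w - w⁻¹), at the price of a factor |m|. -/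
theorem norm_zpow_sub_le {w : ℂ} (hw : ‖w‖ = 1) (m : ℤ) :
    ‖w ^ m - w⁻¹ ^ m‖ ≤ |(m : ℝ)| * ‖w - w⁻¹‖ := by
  have hw0 : w ≠ 0 := by rintro rfl; simp at hw
  have key : ∀ n : ℕ, ‖w ^ n - w⁻¹ ^ n‖ ≤ n * ‖w - w⁻¹‖ := by
    intro n
    have h1 : w ^ n - w⁻¹ ^ n = w⁻¹ ^ n * ((w ^ 2) ^ n - 1) := by
      rw [← pow_mul, mul_comm 2 n, pow_mul, inv_pow]
      field_simp
    have h2 : w - w⁻¹ = w⁻¹ * (w ^ 2 - 1) := by field_simp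
    rw [h1, h2, norm_mul, norm_mul, norm_pow, norm_inv, hw]
    simpa using norm_pow_sub_one_le (z := w ^ 2) (by rw [norm_pow, hw, one_pow]) n
  obtain ⟨n, rfl | rfl⟩ := m.eq_nat_or_neg
  · simpa using key n
  · have := key n
    rw [← norm_neg, neg_sub] at this
    simpa using this

theorem symmIntegrand_three (m : ℤ) (w : ℂ) :
    symmIntegrand 3 m w = I / 2 * ((w - w⁻¹)⁻¹ * (w ^ m - w⁻¹ ^ m)) := by
  rw [symmIntegrand, vertexFactor, vertexFactor, inv_inv, ← neg_sub w w⁻¹]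
  generalize w - w⁻¹ = x
  rcases eq_or_ne x 0 with rfl | hx
  · simp
  · field_simp
    ring

/-- The bound is independent of ε after truncation, and its linear growth in m is absorbed by the
Gaussian decay of the theta coefficients. -/
theorem norm_symmIntegrand_le {d : ℕ} (hd : d = 1 ∨ d = 2 ∨ d = 3) (m : ℤ) {w : ℂ}
    (hw : ‖w‖ = 1) : ‖symmIntegrand d m w‖ ≤ 2 * (1 + |(m : ℝ)|) := by
  have hm := abs_nonneg (m : ℝ)
  by_cases h3 : d = 3
  · subst h3
    rw [symmIntegrand_three, norm_mul, norm_mul, norm_inv]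
    have h1 := norm_zpow_sub_le hw m
    have h2 : ‖w - w⁻¹‖⁻¹ * ‖w ^ m - w⁻¹ ^ m‖ ≤ |(m : ℝ)| := by
      rcases eq_or_ne ‖w - w⁻¹‖ 0 with h | h
      · rw [h, inv_zero, zero_mul]; exact hm
      · rw [inv_mul_le_iff₀ (by positivity), mul_comm]; exact h1
    have h4 : ‖(I / 2 : ℂ)‖ = 1 / 2 := by simp
    rw [h4]
    linarith
  · have hb : ∀ v : ℂ, ‖v‖ = 1 → ‖vertexFactor d v‖ ≤ 2 := by
      intro v hv
      have h4 : ‖v - v⁻¹‖ ≤ 2 := by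
        refine (norm_sub_le _ _).trans ?_
        rw [norm_inv, hv]; norm_num
      rw [vertexFactor]
      rcases eq_or_ne (v - v⁻¹) 0 with h | h
      · rw [h]; simp
      rcases hd with rfl | rfl | rfl
      · have : (v - v⁻¹) ^ 2 * (v - v⁻¹)⁻¹ ^ 1 = v - v⁻¹ := by
          generalize v - v⁻¹ = x at h
          field_simp
        rw [this]; exact h4
      · rw [← mul_pow, mul_inv_cancel₀ h]; simp
      · exact absurd rfl h3
    have hw' : ‖w⁻¹‖ = 1 := by rw [norm_inv, hw, inv_one]
    have h1 := hb w hw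
    have h2 := hb w⁻¹ hw'
    rw [symmIntegrand, norm_mul]
    have h4 : ‖(I / 2 : ℂ)‖ = 1 / 2 := by simp
    have h5 : ‖vertexFactor d w * w ^ m + vertexFactor d w⁻¹ * w⁻¹ ^ m‖ ≤ 2 + 2 := by
      refine (norm_add_le _ _).trans ?_
      rw [norm_mul, norm_mul, norm_zpow, norm_zpow, hw, hw', one_zpow, mul_one, mul_one]
      linarith
    rw [h4]
    linarith

theorem measurable_symmIntegrand_exp (d : ℕ) (m : ℤ) :
    Measurable fun θ : ℝ => symmIntegrand d m (cexp (θ * I)) := by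
  have h1 : Measurable fun θ : ℝ => cexp (θ * I) := by fun_prop
  have h2 : ∀ m : ℤ, Measurable fun θ : ℝ => cexp (θ * I) ^ m := fun m =>
    (Continuous.zpow₀ (f := fun θ : ℝ => cexp (θ * I)) (by fun_prop) m
      fun θ => Or.inl (Complex.exp_ne_zero _)).measurable
  have h3 := ((measurable_vertexFactor d).comp h1).mul (h2 m)
  have h4 := ((measurable_vertexFactor d).comp h1.inv).mul (h2 (-m))
  simp only [symmIntegrand, inv_zpow']
  exact (h3.add h4).const_mul _

theorem norm_vertexIntegral_le {ε : ℝ} (hε : 0 < ε) {d : ℕ} (hd : d = 1 ∨ d = 2 ∨ d = 3) (m : ℤ) :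
    ‖vertexIntegral ε d m‖ ≤ 4 * Real.pi * (1 + |(m : ℝ)|) := by
  rw [vertexIntegral_eq hε]
  have := norm_setIntegral_le_of_norm_le_const (μ := volume) (s := Icc 0 (2 * Real.pi))
    (f := (cutCircle ε).indicator (fun θ : ℝ => symmIntegrand d m (cexp (θ * I))))
    (C := 2 * (1 + |(m : ℝ)|)) measure_Icc_lt_top fun θ _ =>
      (norm_indicator_le_norm_self _ _).trans
        (norm_symmIntegrand_le hd m (Complex.norm_exp_ofReal_mul_I θ))
  refine this.trans (le_of_eq ?_)
  rw [measureReal_def, Real.volume_Icc, sub_zero, ENNReal.toReal_ofReal (by positivity)]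
  ring

/-- Division by zero yields 0 here. Hence the truncated integrands also converge at the two removed
points, and pointwise convergence needs no exceptional set. -/
theorem symmIntegrand_eq_zero (d : ℕ) (m : ℤ) {w : ℂ} (hw : w = 1 ∨ w = -1) :
    symmIntegrand d m w = 0 := by
  rcases hw with rfl | rfl <;> simp [symmIntegrand, vertexFactor]

theorem tendsto_vertexIntegral {d : ℕ} (hd : d = 1 ∨ d = 2 ∨ d = 3) (m : ℤ) :
    Tendsto (fun ε => vertexIntegral ε d m) (𝓝[>] 0) (𝓝 (vertexValue d m)) := by
  have h : Tendsto (fun ε => ∫ θ in Icc 0 (2 * Real.pi),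
      (cutCircle ε).indicator (fun θ : ℝ => symmIntegrand d m (cexp (θ * I))) θ) (𝓝[>] 0)
      (𝓝 (vertexValue d m)) := by
    refine tendsto_integral_filter_of_norm_le_const (Eventually.of_forall fun ε =>
      ((measurable_symmIntegrand_exp d m).indicator
        (measurableSet_cutCircle ε)).aestronglyMeasurable)
      ⟨2 * (1 + |(m : ℝ)|), Eventually.of_forall fun ε => Eventually.of_forall fun θ =>
        (norm_indicator_le_norm_self _ _).trans
          (norm_symmIntegrand_le hd m (Complex.norm_exp_ofReal_mul_I θ))⟩
      (Eventually.of_forall fun θ => ?_)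
    by_cases hθ : cexp (θ * I) = 1 ∨ cexp (θ * I) = -1
    · rw [symmIntegrand_eq_zero d m hθ]
      refine tendsto_const_nhds.congr fun ε => ?_
      rw [indicator]
      split_ifs
      · exact (symmIntegrand_eq_zero d m hθ).symm
      · rfl
    · rw [not_or] at hθ
      have h1 : 0 < ‖cexp (θ * I) - 1‖ := norm_pos_iff.2 (sub_ne_zero.2 hθ.1)
      have h2 : 0 < ‖cexp (θ * I) + 1‖ := by
        rw [norm_pos_iff]
        intro h
        exact hθ.2 (eq_neg_of_add_eq_zero_left h)
      refine tendsto_const_nhds.congr' ?_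
      filter_upwards [nhdsWithin_le_nhds (Iio_mem_nhds h1), nhdsWithin_le_nhds (Iio_mem_nhds h2)]
        with ε hε1 hε2
      rw [indicator_of_mem]
      exact ⟨le_of_lt hε1, le_of_lt hε2⟩
  refine h.congr' ?_
  filter_upwards [self_mem_nhdsWithin] with ε hε
  exact (vertexIntegral_eq hε d m).symm

/-! ### Values -/

theorem integral_cexp_zpow (m : ℤ) :
    ∫ θ in Icc (0 : ℝ) (2 * Real.pi), cexp (θ * I) ^ m = if m = 0 then 2 * Real.pi else 0 := by
  have hpi : (0 : ℝ) ≤ 2 * Real.pi := by positivity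
  rw [integral_Icc_eq_integral_Ioc, ← intervalIntegral.integral_of_le hpi]
  split_ifs with h
  · subst h
    simp
  · have h1 : ∀ θ : ℝ, cexp (θ * I) ^ m = cexp ((m * I) * θ) := by
      intro θ
      rw [← Complex.exp_int_mul]
      congr 1
      ring
    have hm : (m : ℂ) * I ≠ 0 := mul_ne_zero (by exact_mod_cast h) I_ne_zero
    simp only [h1]
    rw [integral_exp_mul_complex hm]
    have h2 : cexp (m * I * (2 * Real.pi : ℝ)) = 1 := by
      rw [Complex.exp_eq_one_iff]
      exact ⟨m, by push_cast; ring⟩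
    rw [h2]
    simp

theorem integrableOn_cexp_zpow (m : ℤ) :
    IntegrableOn (fun θ : ℝ => cexp (θ * I) ^ m) (Icc (0 : ℝ) (2 * Real.pi)) :=
  (Continuous.zpow₀ (f := fun θ : ℝ => cexp (θ * I)) (by fun_prop) m
      fun θ => Or.inl (Complex.exp_ne_zero _)).continuousOn.integrableOn_compact isCompact_Icc

/-- The vertex function w - w⁻¹ has only the frequencies 1 and -1. -/
theorem vertexValue_one {m : ℤ} (h1 : m ≠ 1) (h2 : m ≠ -1) : vertexValue 1 m = 0 := by
  have h : ∀ θ : ℝ, symmIntegrand 1 m (cexp (θ * I)) =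
      I / 2 * ((cexp (θ * I) ^ (m + 1) - cexp (θ * I) ^ (m - 1)) +
        (cexp (θ * I) ^ (-m - 1) - cexp (θ * I) ^ (-m + 1))) := by
    intro θ
    have hw0 : cexp (θ * I) ≠ 0 := Complex.exp_ne_zero _
    generalize cexp (θ * I) = w at *
    have hv : ∀ v : ℂ, vertexFactor 1 v = v - v⁻¹ := by
      intro v
      rw [vertexFactor]
      rcases eq_or_ne (v - v⁻¹) 0 with h | h
      · rw [h]; simp
      · generalize v - v⁻¹ = x at h
        field_simp
    rw [symmIntegrand, hv, hv, inv_inv, inv_zpow', zpow_add₀ hw0, zpow_add₀ hw0, zpow_sub₀ hw0,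
      zpow_sub₀ hw0, zpow_one]
    field_simp
  rw [vertexValue]
  simp only [h]
  have i := integrableOn_cexp_zpow
  have i2 : ∀ a b : ℤ, IntegrableOn (fun θ : ℝ => cexp (θ * I) ^ a - cexp (θ * I) ^ b)
    (Icc (0 : ℝ) (2 * Real.pi)) := fun a b => (i a).sub (i b)
  rw [integral_const_mul, integral_add (i2 _ _) (i2 _ _),
    integral_sub (i _) (i _), integral_sub (i _) (i _)]
  simp only [integral_cexp_zpow]
  rw [if_neg (by omega), if_neg (by omega), if_neg (by omega), if_neg (by omega)]
  simp

theorem ae_cexp_ne : ∀ᵐ θ : ℝ ∂volume.restrict (Icc 0 (2 * Real.pi)),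
    cexp (θ * I) - (cexp (θ * I))⁻¹ ≠ 0 := by
  have hfin : {θ : ℝ | Real.sin θ = 0}.Countable := by
    refine (countable_range fun n : ℤ => (n : ℝ) * Real.pi).mono fun θ hθ => ?_
    exact Real.sin_eq_zero_iff.1 hθ
  refine ae_restrict_of_ae ((hfin.ae_notMem volume).mono fun θ hθ h => hθ ?_)
  rw [← Complex.exp_neg] at h
  have h2 : Complex.sin θ = 0 := by
    rw [Complex.sin]
    have : cexp (-θ * I) - cexp (θ * I) = 0 := by
      rw [neg_mul]; linear_combination -h
    rw [this]; simp
  exact_mod_cast h2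

theorem vertexValue_two {m : ℤ} (h : m ≠ 0) : vertexValue 2 m = 0 := by
  have h1 : vertexValue 2 m = ∫ θ in Icc (0 : ℝ) (2 * Real.pi),
      I / 2 * (cexp (θ * I) ^ m + cexp (θ * I) ^ (-m)) := by
    refine integral_congr_ae (ae_cexp_ne.mono fun θ hθ => ?_)
    simp only
    generalize cexp (θ * I) = w at *
    have hx : w⁻¹ - w ≠ 0 := by
      rw [← neg_sub]; exact neg_ne_zero.2 hθ
    rw [symmIntegrand, vertexFactor, vertexFactor, inv_inv, inv_zpow', ← mul_pow, ← mul_pow,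
      mul_inv_cancel₀ hθ, mul_inv_cancel₀ hx]
    ring
  have i := integrableOn_cexp_zpow
  rw [h1, integral_const_mul, integral_add (i _) (i _)]
  simp only [integral_cexp_zpow]
  rw [if_neg h, if_neg (by omega)]
  simp

theorem vertexValue_three_neg (m : ℤ) : vertexValue 3 (-m) = -vertexValue 3 m := by
  rw [vertexValue, vertexValue, ← integral_neg]
  congr 1
  ext θ
  simp only [symmIntegrand_three, inv_zpow', neg_neg]
  ring

/-- The increment of w^m - w^(-m) under m ↦ m + 2 is (w - w⁻¹)(w^(m+1) + w^(-m-1)). The denominator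
cancels, and the integral of what is left vanishes unless m = -1. -/
theorem vertexValue_three_add_two (m : ℤ) : vertexValue 3 (m + 2) =
    vertexValue 3 m + if m = -1 then 2 * Real.pi * I else 0 := by
  have hint : Integrable (fun θ : ℝ => symmIntegrand 3 m (cexp (θ * I)))
      (volume.restrict (Icc 0 (2 * Real.pi))) :=
    Measure.integrableOn_of_bounded (M := 2 * (1 + |(m : ℝ)|)) measure_Icc_lt_top.ne
      (measurable_symmIntegrand_exp 3 m).aestronglyMeasurable
      (Eventually.of_forall fun θ =>
        norm_symmIntegrand_le (by simp) m (Complex.norm_exp_ofReal_mul_I θ))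
  have i := integrableOn_cexp_zpow
  have h1 : vertexValue 3 (m + 2) = ∫ θ in Icc (0 : ℝ) (2 * Real.pi),
      (symmIntegrand 3 m (cexp (θ * I)) +
        I / 2 * (cexp (θ * I) ^ (m + 1) + cexp (θ * I) ^ (-m - 1))) := by
    refine integral_congr_ae (ae_cexp_ne.mono fun θ hθ => ?_)
    simp only [symmIntegrand_three]
    have hw0 : cexp (θ * I) ≠ 0 := Complex.exp_ne_zero _
    generalize cexp (θ * I) = w at *
    have h2 : w ^ (m + 2) - w⁻¹ ^ (m + 2) =
        (w ^ m - w⁻¹ ^ m) + (w - w⁻¹) * (w ^ (m + 1) + w ^ (-m - 1)) := by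
      rw [inv_zpow', inv_zpow', show -(m + 2) = -m - 2 by ring, zpow_add₀ hw0, zpow_add₀ hw0,
        zpow_sub₀ hw0, zpow_sub₀ hw0, zpow_one, zpow_neg]
      have : w ^ (2 : ℤ) = w * w := by rw [zpow_ofNat, sq]
      rw [this]
      field_simp
      ring
    rw [h2, mul_add, inv_mul_cancel_left₀ hθ]
    ring
  have i2 : IntegrableOn (fun θ : ℝ => I / 2 * (cexp (θ * I) ^ (m + 1) + cexp (θ * I) ^ (-m - 1)))
    (Icc (0 : ℝ) (2 * Real.pi)) := ((i _).add (i _)).const_mul _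
  rw [h1, integral_add hint i2, integral_const_mul,
    integral_add (i _) (i _)]
  simp only [integral_cexp_zpow]
  rw [vertexValue]
  congr 1
  by_cases h : m = -1
  · subst h; simp; ring
  · rw [if_neg (by omega), if_neg (by omega), if_neg h]; simp

theorem vertexValue_three_zero : vertexValue 3 0 = 0 := by
  simp [vertexValue, symmIntegrand_three]

theorem vertexValue_three_one : vertexValue 3 1 = Real.pi * I := by
  have h1 := vertexValue_three_add_two (-1)
  rw [vertexValue_three_neg] at h1
  norm_num at h1
  linear_combination (1 / 2 : ℂ) * h1

theorem vertexValue_three (m : ℤ) :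
    vertexValue 3 m = if Odd m then (m.sign : ℂ) * (Real.pi * I) else 0 := by
  -- By the recursion the value is constant on nonnegative integers of fixed parity. Oddness gives 0
  -- at m = 0, and the jump 2πi between -1 and 1 gives πi at m = 1.
  have key : ∀ n : ℕ, vertexValue 3 (2 * n) = 0 ∧ vertexValue 3 (2 * n + 1) = Real.pi * I := by
    intro n
    induction n with
    | zero => simpa using ⟨vertexValue_three_zero, vertexValue_three_one⟩
    | succ k ih =>
      constructor
      · have := vertexValue_three_add_two (2 * k)
        rw [if_neg (by omega), ih.1] at this
        rw [← add_zero (0 : ℂ), ← this]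
        congr 1
      · have := vertexValue_three_add_two (2 * k + 1)
        rw [if_neg (by omega), ih.2, add_zero] at this
        rw [← this]
        congr 1
  have hpos : ∀ n : ℕ, vertexValue 3 n = if Odd (n : ℤ) then ((n : ℤ).sign : ℂ) * (Real.pi * I)
      else 0 := by
    intro n
    rcases n.even_or_odd' with ⟨k, rfl | rfl⟩
    · rw [if_neg (by simp)]
      exact_mod_cast (key k).1
    · rw [if_pos (by simp), Int.sign_eq_one_of_pos (by positivity)]
      push_cast
      rw [one_mul]
      exact_mod_cast (key k).2
  obtain ⟨n, rfl | rfl⟩ := m.eq_nat_or_neg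
  · exact hpos n
  · rw [vertexValue_three_neg, hpos n]
    simp only [odd_neg, Int.sign_neg]
    split_ifs
    · push_cast; ring
    · simp

theorem norm_vertexValue_le {d : ℕ} (hd : d = 1 ∨ d = 2 ∨ d = 3) (m : ℤ) :
    ‖vertexValue d m‖ ≤ 4 * Real.pi * (1 + |(m : ℝ)|) :=
  le_of_tendsto (tendsto_vertexIntegral hd m).norm
    (by filter_upwards [self_mem_nhdsWithin] with ε hε using norm_vertexIntegral_le hε hd m)

end Plumbing

/-! ### Termwise evaluation of the torus integral. -/

namespace Plumbing

open Complex MeasureTheory Filter Set Topology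

/-! ### Summability over lattices -/

/-- A finite set of exponents lies in a box, over which the sum of products is a product of sums. -/
theorem summable_prod_pi {N : ℕ} {g : Fin N → ℤ → ℝ} (h0 : ∀ j n, 0 ≤ g j n)
    (hs : ∀ j, Summable (g j)) : Summable fun m : Fin N → ℤ => ∏ j, g j (m j) := by
  refine summable_of_sum_le (c := ∏ j, ∑' n, g j n)
    (fun m => Finset.prod_nonneg fun j _ => h0 j _) fun s => ?_
  calc ∑ m ∈ s, ∏ j, g j (m j)
      ≤ ∑ m ∈ Fintype.piFinset fun j => s.image fun m => m j, ∏ j, g j (m j) := by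
        refine Finset.sum_le_sum_of_subset_of_nonneg (fun m hm => ?_)
          fun m _ _ => Finset.prod_nonneg fun j _ => h0 j _
        exact Fintype.mem_piFinset.2 fun j => Finset.mem_image_of_mem (fun m => m j) hm
    _ = ∏ j, ∑ n ∈ s.image fun m => m j, g j n := (Finset.prod_univ_sum _ _).symm
    _ ≤ ∏ j, ∑' n, g j n := Finset.prod_le_prod
        (fun j _ => Finset.sum_nonneg fun n _ => h0 j n)
        fun j _ => (hs j).sum_le_tsum _ fun n _ => h0 j n

theorem summable_one_add_abs_mul_exp {y : ℝ} (hy : 0 < y) :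
    Summable fun n : ℤ => (1 + |(n : ℝ)|) * Real.exp (-(Real.pi * n ^ 2 * y)) := by
  obtain ⟨C, -, hC⟩ := exists_abs_mul_exp_bound
  have h1 := (hC y hy).1.mul_left 2
  have h2 : Summable fun n : ℤ => if n = 0 then (1 : ℝ) else 0 :=
    summable_of_ne_finset_zero (s := {0}) fun n hn => if_neg (by simpa using hn)
  refine Summable.of_nonneg_of_le (fun n => by positivity) (fun n => ?_) (h1.add h2)
  rcases eq_or_ne n 0 with rfl | hn
  · simp
  · have h3 : (1 : ℝ) ≤ |(n : ℝ)| := by exact_mod_cast Int.one_le_abs hn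
    have h4 := Real.exp_pos (-(Real.pi * n ^ 2 * y))
    rw [if_neg hn, add_zero, ← mul_assoc]
    gcongr
    linarith

theorem norm_qpow (r : ℚ) (τ : ℂ) : ‖qpow r τ‖ = Real.exp (-(2 * Real.pi * r * τ.im)) := by
  rw [qpow, Complex.norm_exp]
  congr 1
  have : 2 * Real.pi * I * (r : ℂ) * τ = ((2 * Real.pi * r : ℝ) : ℂ) * (τ * I) := by
    push_cast; ring
  rw [this, Complex.re_ofReal_mul]
  simp

variable {N : ℕ} {M : Matrix (Fin N) (Fin N) ℤ}

/-- The coefficients of the theta series decay like a product of Gaussians. -/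
theorem exists_norm_qpow_invForm_le (hpos : (M.map (fun x : ℤ => (x : ℝ))).PosDef) {s : ℚ}
    (hs : 0 < s) {τ : ℂ} (hτ : 0 < τ.im) : ∃ g : Fin N → ℤ → ℝ, (∀ j n, 0 ≤ g j n) ∧
      (∀ j, Summable fun n : ℤ => (1 + |(n : ℝ)|) * g j n) ∧
      ∀ m : Fin N → ℤ, ‖qpow (s * invForm M fun j => (m j : ℚ)) τ‖ ≤ ∏ j, g j (m j) := by
  have hM : ∀ j, (0 : ℝ) < M j j := fun j => by exact_mod_cast diag_pos_of_posDef hpos j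
  have hs' : (0 : ℝ) < s := by exact_mod_cast hs
  -- Adding up the N bounds m_j² ≤ M_jj · Q and distributing the decay evenly; N + 1 in place of N
  -- keeps the denominator nonzero.
  let y : Fin N → ℝ := fun j => 2 * s * τ.im / ((N + 1) * M j j)
  have hy : ∀ j, 0 < y j := fun j => div_pos (by positivity) (mul_pos (by positivity) (hM j))
  refine ⟨fun j n => Real.exp (-(Real.pi * n ^ 2 * y j)), fun j n => (Real.exp_pos _).le,
    fun j => summable_one_add_abs_mul_exp (hy j), fun m => ?_⟩
  rw [norm_qpow, ← Real.exp_sum, Real.exp_le_exp, Finset.sum_neg_distrib, neg_le_neg_iff]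
  set Q : ℝ := ((invForm M fun j => (m j : ℚ) : ℚ) : ℝ) with hQ
  have hQ0 : 0 ≤ Q := Rat.cast_nonneg.2 (invForm_nonneg hpos fun j => (m j : ℚ))
  have h1 : ∀ j, (m j : ℝ) ^ 2 / M j j ≤ Q := by
    intro j
    rw [div_le_iff₀ (hM j), mul_comm]
    have h := Rat.cast_le (K := ℝ).2 (sq_le_mul_invForm hpos (fun j => (m j : ℚ)) j)
    push_cast at h
    exact h
  have h2 : ∑ j, (m j : ℝ) ^ 2 / M j j ≤ (N + 1) * Q := by
    refine (Finset.sum_le_sum fun j _ => h1 j).trans ?_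
    rw [Finset.sum_const, Finset.card_univ, Fintype.card_fin, nsmul_eq_mul]
    nlinarith
  have h3 : ∑ j, Real.pi * (m j : ℝ) ^ 2 * y j =
      (2 * Real.pi * s * τ.im / (N + 1)) * ∑ j, (m j : ℝ) ^ 2 / M j j := by
    rw [Finset.mul_sum]
    refine Finset.sum_congr rfl fun j _ => ?_
    have := (hM j).ne'
    simp only [y]
    field_simp
  rw [h3]
  calc (2 * Real.pi * s * τ.im / (N + 1)) * ∑ j, (m j : ℝ) ^ 2 / M j j
      ≤ (2 * Real.pi * s * τ.im / (N + 1)) * ((N + 1) * Q) := by gcongr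
    _ = 2 * Real.pi * ((s * invForm M fun j => (m j : ℚ) : ℚ) : ℝ) * τ.im := by
      rw [Rat.cast_mul, ← hQ]
      field_simp

/-! ### The torus integral -/

theorem restrict_Icc_pi (a b : Fin N → ℝ) : (volume : Measure (Fin N → ℝ)).restrict (Icc a b) =
    Measure.pi fun j => volume.restrict (Icc (a j) (b j)) := by
  rw [← Set.pi_univ_Icc, volume_pi, Measure.restrict_pi_pi]

section

variable {L : Set (Fin N → ℤ)} {d : Fin N → ℕ} {a : (Fin N → ℤ) → ℂ} {g : Fin N → ℤ → ℝ}

theorem prod_weight (m : Fin N → ℤ) (C : ℝ) :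
    (∏ j, g j (m j)) * ∏ j, C * (1 + |(m j : ℝ)|) =
      C ^ N * ∏ j, ((1 + |(m j : ℝ)|) * g j (m j)) := by
  rw [Finset.prod_mul_distrib, Finset.prod_const, Finset.card_univ, Fintype.card_fin,
    Finset.prod_mul_distrib]
  ring

theorem measurable_prod_vertexIntegrand (ε : ℝ) (d : Fin N → ℕ) (m : Fin N → ℤ) :
    Measurable fun θ : Fin N → ℝ => ∏ j, vertexIntegrand ε (d j) (m j) (θ j) :=
  Finset.measurable_fun_prod _ fun j _ =>
    (measurable_vertexIntegrand ε (d j) (m j)).comp (measurable_pi_apply j)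

theorem norm_mul_prod_vertexIntegrand_le {ε : ℝ} (hε : 0 < ε)
    (ha : ∀ m, ‖a m‖ ≤ ∏ j, g j (m j)) (m : Fin N → ℤ) (θ : Fin N → ℝ) :
    ‖a m * ∏ j, vertexIntegrand ε (d j) (m j) (θ j)‖ ≤
      (∏ j, 4 * ((ε ^ 2)⁻¹) ^ d j) * ∏ j, g j (m j) := by
  rw [norm_mul, norm_prod, mul_comm]
  exact mul_le_mul (Finset.prod_le_prod (fun j _ => norm_nonneg _)
    fun j _ => norm_vertexIntegrand_le hε _ _ _) (ha m) (norm_nonneg _)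
    (Finset.prod_nonneg fun j _ => by positivity)

theorem measurable_tsum_vertexIntegrand (ε : ℝ) (d : Fin N → ℕ) (a : (Fin N → ℤ) → ℂ)
    (L : Set (Fin N → ℤ)) : Measurable fun θ : Fin N → ℝ =>
      ∑' m : L, a m * ∏ j, vertexIntegrand ε (d j) (m.1 j) (θ j) :=
  Measurable.tsum fun m => (measurable_prod_vertexIntegrand ε d m.1).const_mul _

/-- For fixed ε the poles are cut off and the integrands are bounded, so sum and integral may be
exchanged and Fubini factors each term. The bounds degenerate as ε → 0. -/
theorem integral_tsum_vertexIntegrand {ε : ℝ} (hε : 0 < ε) (hg : ∀ j n, 0 ≤ g j n)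
    (hs : ∀ j, Summable fun n : ℤ => (1 + |(n : ℝ)|) * g j n)
    (ha : ∀ m, ‖a m‖ ≤ ∏ j, g j (m j)) :
    ∫ θ in Icc (0 : Fin N → ℝ) fun _ => 2 * Real.pi,
        ∑' m : L, a m * ∏ j, vertexIntegrand ε (d j) (m.1 j) (θ j) =
      ∑' m : L, a m * ∏ j, vertexIntegral ε (d j) (m.1 j) := by
  set K := ∏ j, 4 * ((ε ^ 2)⁻¹) ^ d j with hK
  set μ := (volume : Measure (Fin N → ℝ)).restrict (Icc 0 fun _ => 2 * Real.pi) with hμ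
  have hfin : volume (Icc (0 : Fin N → ℝ) fun _ => 2 * Real.pi) ≠ ⊤ :=
    isCompact_Icc.measure_lt_top.ne
  have hgs : ∀ j, Summable (g j) := fun j =>
    Summable.of_nonneg_of_le (hg j) (fun n => by nlinarith [hg j n, abs_nonneg (n : ℝ)]) (hs j)
  have hsum : Summable fun m : Fin N → ℤ => ∏ j, g j (m j) := summable_prod_pi hg hgs
  have hint : ∀ m : Fin N → ℤ,
      Integrable (fun θ : Fin N → ℝ => a m * ∏ j, vertexIntegrand ε (d j) (m j) (θ j)) μ :=
    fun m => Measure.integrableOn_of_bounded hfin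
      ((measurable_prod_vertexIntegrand ε d m).const_mul _).aestronglyMeasurable
      (Eventually.of_forall fun θ => norm_mul_prod_vertexIntegrand_le hε ha m θ)
  have h1 := hasSum_integral_of_summable_integral_norm (μ := μ)
    (F := fun (m : L) (θ : Fin N → ℝ) => a m * ∏ j, vertexIntegrand ε (d j) (m.1 j) (θ j))
    (fun m => hint m.1) (by
      refine Summable.of_nonneg_of_le (fun m => integral_nonneg fun θ => norm_nonneg _)
        (fun m => ?_)
        ((hsum.comp_injective (Subtype.val_injective (p := (· ∈ L)))).mul_left
          (K * (volume (Icc (0 : Fin N → ℝ) fun _ => 2 * Real.pi)).toReal))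
      have h := norm_setIntegral_le_of_norm_le_const (μ := volume)
        (s := Icc (0 : Fin N → ℝ) fun _ => 2 * Real.pi)
        (f := fun θ : Fin N → ℝ => ‖a m * ∏ j, vertexIntegrand ε (d j) (m.1 j) (θ j)‖)
        (C := K * ∏ j, g j (m.1 j)) hfin.lt_top fun θ _ => by
          rw [norm_norm]
          exact norm_mul_prod_vertexIntegrand_le hε ha m.1 θ
      refine (le_abs_self _).trans (h.trans (le_of_eq ?_))
      simp only [Function.comp_apply, measureReal_def]
      ring)
  rw [← h1.tsum_eq]
  refine tsum_congr fun m => ?_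
  rw [integral_const_mul, hμ, restrict_Icc_pi, integral_fintype_prod_eq_prod]
  rfl

/-- Only after integration in each variable is there a majorant uniform in ε, which allows the limit
to pass through the lattice sum. -/
theorem tendsto_tsum_vertexIntegral (hd : ∀ j, d j = 1 ∨ d j = 2 ∨ d j = 3)
    (hg : ∀ j n, 0 ≤ g j n) (hs : ∀ j, Summable fun n : ℤ => (1 + |(n : ℝ)|) * g j n)
    (ha : ∀ m, ‖a m‖ ≤ ∏ j, g j (m j)) :
    Tendsto (fun ε => ∑' m : L, a m * ∏ j, vertexIntegral ε (d j) (m.1 j)) (𝓝[>] 0)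
      (𝓝 (∑' m : L, a m * ∏ j, vertexValue (d j) (m.1 j))) := by
  have hsum : Summable fun m : Fin N → ℤ => ∏ j, ((1 + |(m j : ℝ)|) * g j (m j)) :=
    summable_prod_pi (g := fun j n => (1 + |(n : ℝ)|) * g j n)
      (fun j n => mul_nonneg (by positivity) (hg j n)) hs
  refine tendsto_tsum_of_dominated_convergence
    ((hsum.comp_injective (Subtype.val_injective (p := (· ∈ L)))).mul_left ((4 * Real.pi) ^ N))
    (fun m => (tendsto_finsetProd _ fun j _ => tendsto_vertexIntegral (hd j) _).const_mul _) ?_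
  filter_upwards [self_mem_nhdsWithin] with ε hε m
  rw [Function.comp_apply, ← prod_weight, norm_mul, norm_prod]
  exact mul_le_mul (ha _) (Finset.prod_le_prod (fun j _ => norm_nonneg _)
    fun j _ => norm_vertexIntegral_le hε (hd j) _) (Finset.prod_nonneg fun j _ => norm_nonneg _)
    (Finset.prod_nonneg fun j _ => hg _ _)

/-- The part of the torus where all coordinates keep distance `ε` from `1` and `-1`. -/
def cutTorus (N : ℕ) (ε : ℝ) : Set (Fin N → ℂ) :=
  {w : Fin N → ℂ | ∀ j, ε ≤ ‖w j - 1‖ ∧ ε ≤ ‖w j + 1‖}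

theorem prod_mul_indicator_cutTorus (ε : ℝ) (d : Fin N → ℕ) (a : (Fin N → ℤ) → ℂ)
    (L : Set (Fin N → ℤ)) (θ : Fin N → ℝ) :
    (∏ j, cexp (θ j * I) * I) * (cutTorus N ε).indicator
        (fun w => (∏ j, vertexFactor (d j) (w j)) * (∑' m : L, a m * ∏ j, w j ^ m.1 j) *
          ∏ j, (w j)⁻¹) (fun j => cexp (θ j * I)) =
      ∑' m : L, a m * ∏ j, vertexIntegrand ε (d j) (m.1 j) (θ j) := by
  by_cases hθ : ∀ j, θ j ∈ cutCircle ε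
  · have hmem : (fun j => cexp (θ j * I)) ∈ cutTorus N ε := hθ
    rw [indicator_of_mem hmem]
    have h1 : ∀ m : L, a m * ∏ j, vertexIntegrand ε (d j) (m.1 j) (θ j) =
        ((∏ j, I * vertexFactor (d j) (cexp (θ j * I)))) *
          (a m * ∏ j, cexp (θ j * I) ^ m.1 j) := by
      intro m
      rw [mul_left_comm, ← Finset.prod_mul_distrib]
      congr 1
      refine Finset.prod_congr rfl fun j _ => ?_
      rw [vertexIntegrand, indicator_of_mem (hθ j), mul_assoc]
    simp only [h1]
    rw [tsum_mul_left]
    have h2 : (∏ j, cexp (θ j * I) * I) * ((∏ j, vertexFactor (d j) (cexp (θ j * I))) *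
        ∏ j, (cexp (θ j * I))⁻¹) = ∏ j, I * vertexFactor (d j) (cexp (θ j * I)) := by
      rw [← Finset.prod_mul_distrib, ← Finset.prod_mul_distrib]
      refine Finset.prod_congr rfl fun j _ => ?_
      have := Complex.exp_ne_zero (θ j * I)
      field_simp
    rw [← h2]
    ring
  · have hmem : (fun j => cexp (θ j * I)) ∉ cutTorus N ε := hθ
    rw [indicator_of_notMem hmem, mul_zero]
    push Not at hθ
    obtain ⟨j, hj⟩ := hθ
    have h1 : ∀ m : L, a m * ∏ j, vertexIntegrand ε (d j) (m.1 j) (θ j) = 0 := by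
      intro m
      rw [Finset.prod_eq_zero (Finset.mem_univ j), mul_zero]
      rw [vertexIntegrand, indicator_of_notMem hj]
    simp only [h1, tsum_zero]

/-- The principal value of a product of vertex functions against a rapidly converging Laurent
series can be computed term by term. -/
theorem hasTorusPV_tsum (hd : ∀ j, d j = 1 ∨ d j = 2 ∨ d j = 3)
    (hg : ∀ j n, 0 ≤ g j n) (hs : ∀ j, Summable fun n : ℤ => (1 + |(n : ℝ)|) * g j n)
    (ha : ∀ m, ‖a m‖ ≤ ∏ j, g j (m j)) :
    HasTorusPV (fun w => (∏ j, vertexFactor (d j) (w j)) * (∑' m : L, a m * ∏ j, w j ^ m.1 j) *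
      ∏ j, (w j)⁻¹) (∑' m : L, a m * ∏ j, vertexValue (d j) (m.1 j)) := by
  have hmap : ∀ θ : Fin N → ℝ, torusMap (0 : Fin N → ℂ) 1 θ = fun j => cexp (θ j * I) := by
    intro θ
    ext j
    simp [torusMap]
  have key := fun ε θ => prod_mul_indicator_cutTorus ε d a L θ
  set f : (Fin N → ℂ) → ℂ := fun w => (∏ j, vertexFactor (d j) (w j)) *
    (∑' m : L, a m * ∏ j, w j ^ m.1 j) * ∏ j, (w j)⁻¹ with hf
  refine ⟨fun ε hε => ?_, ?_⟩
  · set K := ∏ j, 4 * ((ε ^ 2)⁻¹) ^ d j with hK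
    have hgs : ∀ j, Summable (g j) := fun j =>
      Summable.of_nonneg_of_le (hg j) (fun n => by nlinarith [hg j n, abs_nonneg (n : ℝ)]) (hs j)
    have hsum : Summable fun m : L => ∏ j, g j (m.1 j) :=
      (summable_prod_pi hg hgs).comp_injective (Subtype.val_injective (p := (· ∈ L)))
    -- Dividing by the Jacobian ∏ i·exp(iθ_j), of modulus one, expresses the truncated integrand by
    -- a series already known to be measurable and bounded.
    have heq : ∀ θ : Fin N → ℝ, (cutTorus N ε).indicator f (torusMap 0 1 θ) =
        (∏ j, -I * cexp (-(θ j * I))) *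
          ∑' m : L, a m * ∏ j, vertexIntegrand ε (d j) (m.1 j) (θ j) := by
      intro θ
      rw [hmap, ← key ε θ, ← mul_assoc, ← Finset.prod_mul_distrib, Finset.prod_eq_one, one_mul]
      intro j _
      rw [Complex.exp_neg]
      have := Complex.exp_ne_zero (θ j * I)
      field_simp
      simp
    refine Measure.integrableOn_of_bounded (M := ∑' m : L, K * ∏ j, g j (m.1 j))
      isCompact_Icc.measure_lt_top.ne ?_ (Eventually.of_forall fun θ => ?_)
    · refine Measurable.aestronglyMeasurable ?_
      change Measurable fun θ => (cutTorus N ε).indicator f (torusMap 0 1 θ)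
      simp only [heq]
      refine Measurable.mul ?_ (measurable_tsum_vertexIntegrand ε d a L)
      exact Continuous.measurable (by fun_prop)
    · change ‖(cutTorus N ε).indicator f (torusMap 0 1 θ)‖ ≤ _
      have h1 : ‖∏ j, -I * cexp (-(θ j * I))‖ = 1 := by
        rw [norm_prod]
        refine Finset.prod_eq_one fun j _ => ?_
        rw [norm_mul, norm_neg, norm_I, one_mul, ← neg_mul, ← Complex.ofReal_neg,
          Complex.norm_exp_ofReal_mul_I]
      rw [heq, norm_mul, h1, one_mul]
      exact tsum_of_norm_bounded (hsum.mul_left K).hasSum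
        fun m => norm_mul_prod_vertexIntegrand_le hε ha m.1 θ
  · refine (tendsto_tsum_vertexIntegral (L := L) hd hg hs ha).congr' ?_
    filter_upwards [self_mem_nhdsWithin] with ε hε
    rw [← integral_tsum_vertexIntegrand hε hg hs ha]
    refine (integral_congr_ae (Eventually.of_forall fun θ => ?_)).symm
    simp only [smul_eq_mul, hmap, Pi.one_apply, Complex.ofReal_one, one_mul]
    exact key ε θ

end

/-- The principal values of plumbing integrals exist and are sums over the lattice. -/
theorem hasPlumbingIntegral_tsum {G : SimpleGraph (Fin N)} [DecidableRel G.Adj]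
    (hd : ∀ v, G.degree v = 1 ∨ G.degree v = 2 ∨ G.degree v = 3)
    (hpos : (M.map (fun x : ℤ => (x : ℝ))).PosDef) (r : ℚ) (L : Set (Fin N → ℤ)) {s : ℚ}
    (hs : 0 < s) {τ : ℂ} (hτ : 0 < τ.im) :
    HasPlumbingIntegral G M r L s τ (qpow r τ / (2 * Real.pi * I) ^ N *
      ∑' m : L, qpow (s * invForm M fun j => (m.1 j : ℚ)) τ *
        ∏ j, vertexValue (G.degree j) (m.1 j)) := by
  obtain ⟨g, hg0, hgs, hg⟩ := exists_norm_qpow_invForm_le hpos hs hτ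
  have h := hasTorusPV_tsum (L := L) (a := fun m => qpow (s * invForm M fun j => (m j : ℚ)) τ)
    hd hg0 hgs hg
  have hf : (fun w => graphFactor G w * latticeTheta M L s τ w * ∏ j, (w j)⁻¹) =
      fun w => (∏ j, vertexFactor (G.degree j) (w j)) *
        (∑' m : L, qpow (s * invForm M fun j => (m.1 j : ℚ)) τ * ∏ j, w j ^ m.1 j) *
          ∏ j, (w j)⁻¹ := by
    funext w
    rw [graphFactor_eq_prod, latticeTheta]
    rfl
  rw [HasPlumbingIntegral, hf]
  exact ⟨_, h, rfl⟩

theorem summable_qpow_mul_vertexValue {d : Fin N → ℕ} (hd : ∀ j, d j = 1 ∨ d j = 2 ∨ d j = 3)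
    (hpos : (M.map (fun x : ℤ => (x : ℝ))).PosDef) {s : ℚ} (hs : 0 < s) {τ : ℂ}
    (hτ : 0 < τ.im) : Summable fun m : Fin N → ℤ =>
      qpow (s * invForm M fun j => (m j : ℚ)) τ * ∏ j, vertexValue (d j) (m j) := by
  obtain ⟨g, hg0, hgs, hg⟩ := exists_norm_qpow_invForm_le hpos hs hτ
  have hsum : Summable fun m : Fin N → ℤ => ∏ j, ((1 + |(m j : ℝ)|) * g j (m j)) :=
    summable_prod_pi (g := fun j n => (1 + |(n : ℝ)|) * g j n)
      (fun j n => mul_nonneg (by positivity) (hg0 j n)) hgs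
  refine Summable.of_norm_bounded (hsum.mul_left ((4 * Real.pi) ^ N)) fun m => ?_
  rw [← prod_weight, norm_mul, norm_prod]
  exact mul_le_mul (hg _) (Finset.prod_le_prod (fun j _ => norm_nonneg _)
    fun j _ => norm_vertexValue_le (hd j) _) (Finset.prod_nonneg fun j _ => norm_nonneg _)
    (Finset.prod_nonneg fun j _ => hg0 _ _)

end Plumbing

/-! ### From lattice sums to false theta functions. -/

namespace Plumbing

open Complex Filter Set Topology

/-! ### Evaluation by false theta functions -/

theorem qpow_add (r s : ℚ) (τ : ℂ) : qpow (r + s) τ = qpow r τ * qpow s τ := by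
  rw [qpow, qpow, qpow, ← Complex.exp_add]
  congr 1
  push_cast
  ring

theorem qpow_zero (τ : ℂ) : qpow 0 τ = 1 := by
  simp [qpow]

theorem qpow_mul_eq (r s : ℚ) (τ : ℂ) : qpow (r * s) τ = qpow s (r * τ) := by
  rw [qpow, qpow]
  congr 1
  push_cast
  ring

/-- Sums over an arithmetically restricted line are combinations of false theta functions. -/
theorem tsum_line_eq {P : ℤ → Prop} [DecidablePred P] {D : ℕ} (hD : 0 < D) (hD2 : Even D)
    (hP : ∀ n, P (n + D) ↔ P n) (B β : ℚ) (τ : ℂ)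
    (hs : Summable fun n : ℤ => if P n then vertexValue 3 n * qpow (B * (n + β) ^ 2) τ else 0) :
    ∑' n : ℤ, (if P n then vertexValue 3 n * qpow (B * (n + β) ^ 2) τ else 0) =
      ∑ t ∈ Finset.range D, (if P t ∧ Odd (t : ℤ) then Real.pi * I else 0) *
        falseTheta (2 * ((t + β) / D).num) ((t + β) / D).den (((B * D ^ 2 : ℚ) : ℂ) * τ) := by
  rw [tsum_int_eq_sum_range hs hD]
  refine Finset.sum_congr rfl fun t ht => ?_
  have hDq : (D : ℚ) ≠ 0 := by exact_mod_cast hD.ne'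
  have hper : ∀ k : ℤ, P (t + D * k) ↔ P t := by
    intro k
    induction k with
    | zero => simp
    | succ i ih => rw [← ih, ← hP (t + D * i)]; ring_nf
    | pred i ih => rw [← ih, ← hP (t + D * (-i - 1))]; ring_nf
  have hodd : ∀ k : ℤ, Odd (t + D * k : ℤ) ↔ Odd (t : ℤ) := by
    intro k
    have : Even (D * k : ℤ) := (by exact_mod_cast hD2 : Even (D : ℤ)).mul_right k
    rw [Int.odd_add]
    simp [this]
  rw [falseTheta, ← tsum_mul_left]
  refine tsum_congr fun k => ?_
  simp only [hper, vertexValue_three, hodd]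
  by_cases h : P t ∧ Odd (t : ℤ)
  · rw [if_pos h.1, if_pos h.2, if_pos h]
    -- An odd residue satisfies 0 < t < D, so the sign of t + Dk is sgn*(k), including the value 1
    -- at k = 0.
    have ht1 : (0 : ℤ) < t := by
      rcases h.2 with ⟨l, hl⟩
      omega
    have ht2 : (t : ℤ) < D := by exact_mod_cast Finset.mem_range.1 ht
    have hsign : (((t + D * k : ℤ).sign : ℤ) : ℂ) = if 0 ≤ k then 1 else -1 := by
      split_ifs with hk
      · rw [Int.sign_eq_one_of_pos (by positivity)]; simp
      · rw [Int.sign_eq_neg_one_of_neg (by nlinarith)]; simp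
    have hq : B * (((t + D * k : ℤ) : ℚ) + β) ^ 2 = (B * D ^ 2) * ((k : ℚ) +
        ((2 * ((t + β) / D).num : ℤ) : ℚ) / (2 * (((t + β) / D).den : ℚ))) ^ 2 := by
      have : ((2 * ((t + β) / D).num : ℤ) : ℚ) / (2 * (((t + β) / D).den : ℚ)) = (t + β) / D := by
        rw [Int.cast_mul, Int.cast_ofNat, mul_div_mul_left _ _ two_ne_zero, Rat.num_div_den]
      rw [this]
      push_cast
      field_simp
      ring
    rw [hsign, hq, qpow_mul_eq]
    ring
  · rw [if_neg h, zero_mul]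
    by_cases h1 : P t
    · rw [if_pos h1, if_neg fun h2 => h ⟨h1, h2⟩, zero_mul]
    · rw [if_neg h1]

variable {N : ℕ} {M : Matrix (Fin N) (Fin N) ℤ} {G : SimpleGraph (Fin N)} [DecidableRel G.Adj]

theorem degree_eq_of_star (hG : G.Connected) {c : Fin N} (hc : G.degree c = 3)
    (hdeg : ∀ v, v ≠ c → G.degree v ≤ 2) (v : Fin N) :
    G.degree v = 1 ∨ G.degree v = 2 ∨ G.degree v = 3 := by
  have : Nontrivial (Fin N) := by
    obtain ⟨w, hw⟩ := (G.degree_pos_iff_exists_adj c).1 (by omega)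
    exact ⟨c, w, hw.ne⟩
  have h1 := hG.preconnected.degree_pos_of_nontrivial v
  rcases eq_or_ne v c with rfl | hv
  · omega
  · have := hdeg v hv
    omega

/-- Since M · adj(M) = det M, the vector 2|det M| e_c lies in 2Mℤ^N. Membership in the lattice is
therefore periodic along the lines of the centre, with an even period that respects parity. -/
theorem exists_single_eq_two_smul_mulVec (M : Matrix (Fin N) (Fin N) ℤ) (c : Fin N) :
    ∃ v : Fin N → ℤ, (Pi.single c ((2 * M.det.natAbs : ℕ) : ℤ) : Fin N → ℤ) =
      (2 : ℤ) • M.mulVec v := by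
  obtain ⟨σ, hσ⟩ : ∃ σ : ℤ, (M.det.natAbs : ℤ) = M.det * σ := by
    rcases Int.natAbs_eq M.det with h | h
    · exact ⟨1, by omega⟩
    · exact ⟨-1, by omega⟩
  refine ⟨σ • M.adjugate.mulVec (Pi.single c 1), ?_⟩
  rw [Matrix.mulVec_smul, Matrix.mulVec_mulVec, Matrix.mul_adjugate, Matrix.smul_mulVec,
    Matrix.one_mulVec, smul_smul, smul_smul, ← Pi.single_smul]
  congr 1
  rw [Nat.cast_mul, hσ, smul_eq_mul]
  push_cast
  ring

/-- The possible exponents of the monomials with non-vanishing principal value, up to the exponent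
at the centre. -/
def legExponents (G : SimpleGraph (Fin N)) [DecidableRel G.Adj] (c : Fin N) :
    Finset (Fin N → ℤ) :=
  Fintype.piFinset fun v => if v ≠ c ∧ G.degree v = 1 then {1, -1} else {0}

theorem mem_legExponents {c : Fin N} (hc : G.degree c = 3) {η : Fin N → ℤ} :
    η ∈ legExponents G c ↔ (∀ v, G.degree v = 1 → η v = 1 ∨ η v = -1) ∧
      (∀ v, v ≠ c → G.degree v ≠ 1 → η v = 0) ∧ η c = 0 := by
  rw [legExponents, Fintype.mem_piFinset]
  constructor
  · intro h
    refine ⟨fun v hv => ?_, fun v hvc hv => ?_, ?_⟩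
    · have hvc : v ≠ c := by rintro rfl; omega
      simpa [hvc, hv] using h v
    · simpa [hvc, hv] using h v
    · simpa using h c
  · rintro ⟨h1, h2, h3⟩ v
    by_cases hvc : v = c
    · subst hvc; simpa using h3
    · by_cases hv : G.degree v = 1
      · simpa [hvc, hv] using h1 v hv
      · simpa [hvc, hv] using h2 v hvc hv

theorem exists_legExponents_of_ne_zero (hG : G.Connected) {c : Fin N} (hc : G.degree c = 3)
    (hdeg : ∀ v, v ≠ c → G.degree v ≤ 2) {m : Fin N → ℤ}
    (hm : ∏ j, vertexValue (G.degree j) (m j) ≠ 0) :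
    ∃ η ∈ legExponents G c, m = η + Pi.single c (m c) := by
  rw [Finset.prod_ne_zero_iff] at hm
  refine ⟨Function.update m c 0, (mem_legExponents hc).2 ⟨fun v hv => ?_, fun v hvc hv => ?_, ?_⟩,
    ?_⟩
  · have hvc : v ≠ c := by rintro rfl; omega
    rw [Function.update_of_ne hvc]
    by_contra! h
    exact hm v (Finset.mem_univ v) (by rw [hv, vertexValue_one h.1 h.2])
  · rw [Function.update_of_ne hvc]
    by_contra! h
    have h2 : G.degree v = 2 := by
      have := degree_eq_of_star hG hc hdeg v
      have := hdeg v hvc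
      omega
    exact hm v (Finset.mem_univ v) (by rw [h2, vertexValue_two h])
  · rw [Function.update_self]
  · ext v
    rcases eq_or_ne v c with rfl | hv
    · simp
    · simp [hv]

theorem prod_vertexValue_add_single {c : Fin N} (hc : G.degree c = 3) {η : Fin N → ℤ}
    (hη : η c = 0) (n : ℤ) :
    ∏ j, vertexValue (G.degree j) ((η + Pi.single c n : Fin N → ℤ) j) =
      (∏ j ∈ Finset.univ.erase c, vertexValue (G.degree j) (η j)) * vertexValue 3 n := by
  rw [← Finset.prod_erase_mul _ _ (Finset.mem_univ c)]
  congr 1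
  · refine Finset.prod_congr rfl fun v hv => ?_
    rw [Pi.add_apply, Pi.single_eq_of_ne (Finset.ne_of_mem_erase hv), add_zero]
  · rw [Pi.add_apply, Pi.single_eq_same, hη, zero_add, hc]

theorem injective_legExponents_add_single {c : Fin N} (hc : G.degree c = 3) :
    Function.Injective fun x : legExponents G c × ℤ =>
      (x.1.1 + Pi.single c x.2 : Fin N → ℤ) := by
  rintro ⟨⟨η, hη⟩, n⟩ ⟨⟨η', hη'⟩, n'⟩ h
  simp only at h
  have h1 := ((mem_legExponents hc).1 hη).2.2
  have h2 := ((mem_legExponents hc).1 hη').2.2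
  have h3 := congrFun h c
  simp only [Pi.add_apply, Pi.single_eq_same, h1, h2, zero_add] at h3
  subst h3
  have h4 := add_right_cancel h
  subst h4
  rfl

open Classical in
/-- Plumbing integrals of three-leg stars are, up to a power of `q`, linear combinations of false
theta functions with a common scaling. -/
theorem exists_hasPlumbingIntegral_falseTheta (hG : IsThreeLegStar G) (hM : IsPlumbingMatrix G M)
    (hpos : (M.map (fun x : ℤ => (x : ℝ))).PosDef) (r : ℚ) {s : ℚ} (hs : 0 < s)
    {L : Set (Fin N → ℤ)} (hL : ∀ v m : Fin N → ℤ, m + (2 : ℤ) • M.mulVec v ∈ L ↔ m ∈ L) :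
    ∃ (n : ℕ) (κ : Fin n → ℂ) (j : Fin n → ℤ) (p : Fin n → ℕ) (s' ρ : ℚ),
      0 < s' ∧ (∀ i, 0 < p i) ∧ ∀ τ : ℂ, 0 < τ.im → HasPlumbingIntegral G M r L s τ
        (qpow ρ τ * ∑ i, κ i * falseTheta (j i) (p i) ((s' : ℂ) * τ)) := by
  obtain ⟨hT, c, hc, hdeg⟩ := hG
  have hconn := hT.connected
  have hd := degree_eq_of_star hconn hc hdeg
  obtain ⟨A, K, hA, hAK⟩ := exists_invForm_eq hconn hc hdeg hM hpos
  obtain ⟨u, hu⟩ := exists_single_eq_two_smul_mulVec M c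
  set D := 2 * M.det.natAbs with hDdef
  have hD : 0 < D := by
    have := Int.natAbs_pos.2 (det_ne_zero_of_posDef hpos)
    omega
  have hD2 : Even D := even_two_mul _
  have hβ : ∀ η : legExponents G c, ∃ β : ℚ, ∀ n : ℤ,
      invForm M (fun v => ((η.1 + Pi.single c n : Fin N → ℤ) v : ℚ)) = A * (n + β) ^ 2 + K := by
    intro η
    obtain ⟨h1, h2, h3⟩ := (mem_legExponents hc).1 η.2
    exact hAK η.1 h1 h2 h3
  choose β hβ using hβ
  obtain ⟨Q, hQ⟩ : ∃ Q : legExponents G c → ℤ → Prop,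
    ∀ η n, Q η n ↔ (η.1 + Pi.single c n : Fin N → ℤ) ∈ L := ⟨_, fun _ _ => Iff.rfl⟩
  let leg : legExponents G c → ℂ := fun η =>
    ∏ j ∈ Finset.univ.erase c, vertexValue (G.degree j) (η.1 j)
  let e : Fin (Fintype.card (legExponents G c × Fin D)) ≃ legExponents G c × Fin D :=
    (Fintype.equivFin _).symm
  let κ : legExponents G c × Fin D → ℂ := fun x => ((2 * Real.pi * I) ^ N)⁻¹ * leg x.1 *
    if Q x.1 (x.2 : ℕ) ∧ Odd ((x.2 : ℕ) : ℤ) then Real.pi * I else 0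
  let b : legExponents G c × Fin D → ℚ := fun x => (((x.2 : ℕ) : ℚ) + β x.1) / D
  -- The terms are indexed by a leg exponent and a residue modulo D. The scaling sAD² comes from
  -- writing n = t + Dk, and the power of q collects the prefactor and the common minimum K.
  refine ⟨_, fun i => κ (e i), fun i => 2 * (b (e i)).num, fun i => (b (e i)).den,
    s * A * D ^ 2, r + s * K, by positivity, fun i => (b (e i)).den_pos, fun τ hτ => ?_⟩
  convert hasPlumbingIntegral_tsum hd hpos r L hs hτ using 1
  rw [e.sum_comp (fun x => κ x * falseTheta (2 * (b x).num) (b x).den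
    (((s * A * D ^ 2 : ℚ) : ℂ) * τ)), Fintype.sum_prod_type]
  set f : (Fin N → ℤ) → ℂ := fun m => qpow (s * invForm M fun j => (m j : ℚ)) τ *
    ∏ j, vertexValue (G.degree j) (m j) with hf
  have hfs : Summable f := summable_qpow_mul_vertexValue hd hpos hs hτ
  have hinj := injective_legExponents_add_single (G := G) hc
  have h1 : ∑' m : L, f m = ∑' x : legExponents G c × ℤ,
      L.indicator f (x.1.1 + Pi.single c x.2) := by
    rw [tsum_subtype]
    refine (hinj.tsum_eq fun m hm => ?_).symm
    have hm' : f m ≠ 0 := by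
      intro h
      apply hm
      rw [indicator_apply, h, ite_self]
    obtain ⟨η, hη, h⟩ := exists_legExponents_of_ne_zero hconn hc hdeg (right_ne_zero_of_mul hm')
    exact ⟨(⟨η, hη⟩, m c), h.symm⟩
  have h2 : Summable fun x : legExponents G c × ℤ => L.indicator f (x.1.1 + Pi.single c x.2) :=
    (hfs.indicator L).comp_injective hinj
  have h3 : ∀ (η : legExponents G c) (n : ℤ), L.indicator f (η.1 + Pi.single c n) =
      qpow (s * K) τ * leg η * if Q η n then
        vertexValue 3 n * qpow (s * A * (n + β η) ^ 2) τ else 0 := by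
    intro η n
    rw [indicator_apply, ← hQ]
    split_ifs with h
    · rw [hf]
      simp only
      rw [hβ, prod_vertexValue_add_single hc ((mem_legExponents hc).1 η.2).2.2,
        show s * (A * (n + β η) ^ 2 + K) = s * A * (n + β η) ^ 2 + s * K by ring, qpow_add]
      ring
    · rw [mul_zero]
  -- Summability along a line is inherited from the whole lattice by cancelling the constant factor,
  -- which must be nonzero.
  have h4 : ∀ η : legExponents G c, leg η ≠ 0 → Summable fun n : ℤ =>
      if Q η n then vertexValue 3 n * qpow (s * A * (n + β η) ^ 2) τ else 0 := by
    intro η hη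
    have h := h2.comp_injective (Prod.mk_right_injective η)
    simp only [Function.comp_def, h3] at h
    exact (summable_mul_left_iff (mul_ne_zero (Complex.exp_ne_zero _) hη)).1 h
  have h5 : ∀ η : legExponents G c, ∀ n : ℤ,
      Q η (n + D) ↔ Q η n := by
    intro η n
    rw [hQ, hQ, Pi.single_add, ← add_assoc, hu, hL]
  change _ = qpow r τ / (2 * Real.pi * I) ^ N * ∑' m : L, f m
  rw [h1, h2.tsum_prod, tsum_fintype, Finset.mul_sum, Finset.mul_sum]
  refine Finset.sum_congr rfl fun η _ => ?_
  simp only [h3]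
  rw [tsum_mul_left, qpow_add]
  by_cases hη : leg η = 0
  · simp [κ, hη]
  · have h6 := tsum_line_eq (P := Q η) hD hD2 (h5 η) (s * A) (β η) τ
      (h4 η hη)
    rw [h6, Finset.sum_range]
    simp only [Finset.mul_sum]
    refine Finset.sum_congr rfl fun t _ => ?_
    simp only [κ, b]
    ring

theorem isQuantumModularForm_qpow_mul {n : ℕ} (κ : Fin n → ℂ) (j : Fin n → ℤ) (p : Fin n → ℕ)
    (hp : ∀ i, 0 < p i) {s : ℚ} (hs : 0 < s) (ρ : ℚ) :
    IsQuantumModularForm (1 / 2) Set.univ fun τ => qpow (-ρ) τ *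
      (qpow ρ τ * ∑ i, κ i * falseTheta (j i) (p i) ((s : ℂ) * τ)) := by
  refine isQuantumModularForm_sum_falseTheta κ j p hp hs fun τ _ => ?_
  rw [← mul_assoc, ← qpow_add, neg_add_cancel, qpow_zero, one_mul]

end Plumbing

/-! ### The theorem. -/

theorem theorem4p2 {N : ℕ} (G : SimpleGraph (Fin N)) [DecidableRel G.Adj]
    (M : Matrix (Fin N) (Fin N) ℤ) (hG : Plumbing.IsThreeLegStar G)
    (hM : Plumbing.IsPlumbingMatrix G M)
    (hpos : (M.map (fun x : ℤ => (x : ℝ))).PosDef) :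
    (∃ Z : ℂ → ℂ,
      (∀ τ : ℂ, 0 < τ.im → Plumbing.HasZ G M τ (Z τ)) ∧
      (∃ (n : ℕ) (κ : Fin n → ℂ) (ρ : Fin n → ℚ) (j : Fin n → ℤ) (p : Fin n → ℕ)
          (s : Fin n → ℚ),
        (∀ i, 0 < p i ∧ 0 < s i ∧
          Plumbing.IsQuantumModularForm (1 / 2) Set.univ
            (fun τ => Plumbing.falseTheta (j i) (p i) ((s i : ℂ) * τ))) ∧
        ∀ τ : ℂ, 0 < τ.im →
          Z τ = ∑ i, κ i * (Plumbing.qpow (ρ i) τ *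
            Plumbing.falseTheta (j i) (p i) ((s i : ℂ) * τ))) ∧
      ∃ c : ℚ, Plumbing.IsQuantumModularForm (1 / 2) Set.univ
        (fun τ => Plumbing.qpow c τ * Z τ)) ∧
    (IsUnit M.det → ∀ a : Fin N → ℤ, (∀ v, a v ≡ (G.degree v : ℤ) [ZMOD 2]) →
      ∃ Zhat : ℂ → ℂ,
        (∀ τ : ℂ, 0 < τ.im → Plumbing.HasZHat G M a τ (Zhat τ)) ∧
        ∃ c : ℚ, Plumbing.IsQuantumModularForm (1 / 2) Set.univ
          (fun τ => Plumbing.qpow c τ * Zhat τ)) := by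
  refine ⟨?_, fun _ a _ => ?_⟩
  -- The evaluation only needs an index set stable under translation by 2Mℤ^N, which holds for Mℤ^N
  -- and for 2Mℤ^N + a alike; the common exponent ρ is then divided out.
  · obtain ⟨n, κ, j, p, s, ρ, hs, hp, h⟩ := Plumbing.exists_hasPlumbingIntegral_falseTheta hG hM
      hpos ((-3 * (N : ℚ) + (M.trace : ℚ)) / 2) (s := 1 / 2) (by norm_num)
      (L := {m | ∃ n : Fin N → ℤ, m = M.mulVec n}) (by
        intro v m
        constructor
        · rintro ⟨n, hn⟩
          exact ⟨n - (2 : ℤ) • v, by rw [Matrix.mulVec_sub, Matrix.mulVec_smul, ← hn]; abel⟩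
        · rintro ⟨n, rfl⟩
          exact ⟨n + (2 : ℤ) • v, by rw [Matrix.mulVec_add, Matrix.mulVec_smul]⟩)
    refine ⟨_, h, ⟨n, κ, fun _ => ρ, j, p, fun _ => s, fun i => ⟨hp i, hs, ?_⟩, fun τ _ => ?_⟩,
      -ρ, Plumbing.isQuantumModularForm_qpow_mul κ j p hp hs ρ⟩
    · exact Plumbing.isQuantumModularForm_sum_falseTheta (ι := Unit) (fun _ => 1) (fun _ => j i)
        (fun _ => p i) (fun _ => hp i) hs fun τ _ => by simp
    · rw [Finset.mul_sum]
      exact Finset.sum_congr rfl fun i _ => by ring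
  · obtain ⟨n, κ, j, p, s, ρ, hs, hp, h⟩ := Plumbing.exists_hasPlumbingIntegral_falseTheta hG hM
      hpos ((-3 * (N : ℚ) + (M.trace : ℚ)) / 4) (s := 1 / 4) (by norm_num)
      (L := {m | ∃ n : Fin N → ℤ, m = (2 : ℤ) • M.mulVec n + a}) (by
        intro v m
        constructor
        · rintro ⟨n, hn⟩
          exact ⟨n - v, by
            rw [Matrix.mulVec_sub, smul_sub, sub_add_eq_add_sub, ← hn, add_sub_cancel_right]⟩
        · rintro ⟨n, rfl⟩
          exact ⟨n + v, by rw [Matrix.mulVec_add, smul_add]; abel⟩)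
    exact ⟨_, h, -ρ, Plumbing.isQuantumModularForm_qpow_mul κ j p hp hs ρ⟩
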